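/- **Theorem 4 (Moment estimates of the mean hitting time).** *Model.* Let $q\ge 2$ and $\mathcal S_N=\{1,\dots,q\}^N$. Let $(J_{ij})_{1\le i<j<\infty}$ be i.i.d. real random variables on a probability space $(\Omega,\mathcal F,\mathbb P)$ (with expectation $\mathbb E$) such that $\mathbb E[J_{12}]=1$, $\mathrm{Var}(J_{12})=v\in(0,\infty)$, and $0$ lies in the interior of $\{\lambda\in\mathbb R:\mathbb E[e^{\lambda J_{12}}]<\infty\}$. Set $$H_N(\sigma)=-\frac1N\sum_{1\le i<j\le N}J_{ij}\mathbf 1_{\{\sigma_i=\sigma_j\}},\qquad \mu_N(\sigma)=\frac{e^{-\beta H_N(\sigma)}}{\sum_{\eta\in\mathcal S_N}e^{-\beta H_N(\eta)}} .$$ Let $(\Sigma^N_t)_{t\in\mathbb N_0}$ be the discrete-time Markov chain on $\mathcal S_N$ with transition probabilities $\pi_N(\sigma,\eta)=(Nq)^{-1}e^{-\beta\max\{0,\,H_N(\eta)-H_N(\sigma)\}}$ if $\sigma,\eta$ differ in exactly one coordinate, $\pi_N(\sigma,\sigma)=1-\sum_{\eta\ne\sigma}\pi_N(\sigma,\eta)$,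 and $\pi_N(\sigma,\eta)=0$ otherwise. Write $\mathrm P^N_\nu,\mathrm E^N_\nu$ for its law and expectation with initial distribution $\nu$ (and $\mathrm P^N_\sigma$ for start in $\sigma$), $\tau^N_{\mathcal A}=\inf\{t>0:\Sigma^N_t\in\mathcal A\}$, and, for disjoint non-empty $\mathcal A,\mathcal B\subset\mathcal S_N$, $$\nu_{\mathcal A,\mathcal B}(\sigma)=\frac{\mu_N(\sigma)\,\mathrm P^N_\sigma[\tau^N_{\mathcal B}<\tau^N_{\mathcal A}]}{\sum_{\eta\in\mathcal A}\mu_N(\eta)\,\mathrm P^N_\eta[\tau^N_{\mathcal B}<\tau^N_{\mathcal A}]},\qquad \sigma\in\mathcal A .$$ Quantities with a tilde are those of the Curie--Weiss--Potts (CWP) model, obtained by replacing every $J_{ij}$ by $1$. *Landscape.* Let $\mathcal P=\{x\in[0,1]^q:\sum_k x_k=1\}$, $\mathcal P_N=\mathcal P\cap\frac1N\mathbb N_0^q$, and, for $\beta>0$, $$F_{\beta}(x)=-\tfrac12\|x\|_2^2+\tfrac1\beta\sum_{i=1}^q x_i\log x_i\quad(x\in\mathcal P),\qquad m_0=(1/q,\dots,1/q).$$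 Let $\beta_1(q)$ be the infimum of all $\beta>0$ for which $F_\beta$ has a local minimum on $\mathcal P$ other than $m_0$, and $\beta_2(q)$ the supremum of all $\beta>0$ for which $m_0$ is a global minimum of $F_\beta$ on $\mathcal P$. For $i\in\{1,\dots,q\}$ let $m_i\in\mathcal P$ have $i$-th coordinate $(1+(q-1)s)/q$ and all other coordinates $(1-s)/q$, where $s$ is the largest solution of $\log(1+(q-1)s)-\log(1-s)=\beta s$ (with $-\frac1{q-1}<s<1$). For $N\ge1$ and $0\le i\le q$ let $m_{i,N}\in\mathcal P_N$ be a point of $\mathcal P_N$ closest to $m_i$ in Euclidean distance, and let $\mathcal M_{i,N}$ be the set of all $\sigma\in\mathcal S_N$ whose vector of colour frequencies $\bigl(\frac1N\#\{j:\sigma_j=k\}\bigr)_{k=1}^q$ equals $m_{i,N}$. *Statement.* Let $\beta>\beta_1(q)$ and let $(\mathcal A_N,\mathcal B_N)_N$ be one of the following: 1. $\mathcal A_N=\bigcup_{i=1}^q\mathcal M_{i,N}$, $\mathcal B_N=\mathcal M_{0,N}$, if $\beta_1(q)<\beta\le\beta_2(q)$; 2. $\mathcal A_N=\mathcal M_{0,N}$,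 $\mathcal B_N=\bigcup_{i=1}^q\mathcal M_{i,N}$, if $\beta_2(q)<\beta<q$; 3. $\mathcal A_N=\mathcal M_{i,N}$, $\mathcal B_N=\bigcup_{1\le j\le q,\,j\ne i}\mathcal M_{j,N}$ for a fixed $i\in\{1,\dots,q\}$ (for instance $i=1$), if $\beta>\beta_2(q)$. Then for every real $k\ge1$ there exist $c_7,c_8>0$ such that, for all $N$ large enough, $$e^{-c_7}\;\le\;\frac{\mathbb E\Bigl[\bigl(\mathrm E^N_{\nu_{\mathcal A_N,\mathcal B_N}}[\tau^N_{\mathcal B_N}]\bigr)^k\Bigr]^{1/k}}{\widetilde{\mathrm E}^N_{\widetilde\nu_{\mathcal A_N,\mathcal B_N}}[\widetilde\tau^N_{\mathcal B_N}]}\;\le\;e^{c_8k}.$$ -/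

import Mathlib

open MeasureTheory ProbabilityTheory
open scoped ENNReal

noncomputable section

namespace CWP

/-! ### Finite-state Markov chains in discrete time -/

section Chain

variable {S : Type} [Fintype S] [MeasurableSpace S] [MeasurableSingletonClass S]

/-- The one-step kernel of a time-homogeneous chain: the next state is drawn from the row of the
last visited state. -/
def stepKernel (p : S → PMF S) (n : ℕ) : Kernel ((i : Finset.Iic n) → S) S :=
  (Kernel.ofFunOfCountable fun σ => (p σ).toMeasure).comap
    (fun x => x ⟨n, Finset.mem_Iic.2 le_rfl⟩) (measurable_pi_apply _)

instance (p : S → PMF S) (n : ℕ) : IsMarkovKernel (stepKernel p n) := by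
  have : IsMarkovKernel (Kernel.ofFunOfCountable fun σ => (p σ).toMeasure) :=
    ⟨fun σ => PMF.toMeasure.isProbabilityMeasure (p σ)⟩
  unfold stepKernel
  infer_instance

/-- The law, on the space of trajectories, of the Markov chain with transition probabilities `p`
and initial distribution `ν`. -/
def pathLaw (p : S → PMF S) (ν : Measure S) : Measure (ℕ → S) :=
  Kernel.trajMeasure (X := fun _ => S) ν (stepKernel p)

/-- The first return time `inf {t > 0 : x t ∈ A}` (`∞` if there is no such `t`). -/
def returnTime (A : Set S) (x : ℕ → S) : ℝ≥0∞ :=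
  ⨅ (t : ℕ) (_ : 0 < t ∧ x t ∈ A), (t : ℝ≥0∞)

end Chain

/-! ### The model -/

/-- Spin configurations of `N` vertices with `q` colours. -/
abbrev Config (N q : ℕ) : Type := Fin N → Fin q

/-- The Hamiltonian `-(1/N) ∑_{i<j} w_{ij} 1{σ_i = σ_j}` with interaction coefficients `w`;
only the entries `w i j` with `i < j` are used. -/
def hamiltonian (w : ℕ → ℕ → ℝ) {N q : ℕ} (σ : Config N q) : ℝ :=
  -(1 / (N : ℝ)) * ∑ i : Fin N, ∑ j : Fin N, if i < j ∧ σ i = σ j then w i j else 0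

/-- The Gibbs measure at inverse temperature `β`. -/
def gibbs (β : ℝ) (w : ℕ → ℕ → ℝ) {N q : ℕ} (σ : Config N q) : ℝ :=
  Real.exp (-β * hamiltonian w σ) / ∑ η : Config N q, Real.exp (-β * hamiltonian w η)

/-- The Metropolis transition probability between distinct configurations. -/
def offDiag (β : ℝ) (w : ℕ → ℕ → ℝ) {N q : ℕ} (σ η : Config N q) : ℝ :=
  if hammingDist σ η = 1 then
    ((N : ℝ) * q)⁻¹ * Real.exp (-β * max 0 (hamiltonian w η - hamiltonian w σ))
  else 0

/-- The Glauber-Metropolis transition probabilities. -/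
def transProb (β : ℝ) (w : ℕ → ℕ → ℝ) {N q : ℕ} (σ η : Config N q) : ℝ :=
  if η = σ then 1 - ∑ ζ ∈ Finset.univ.erase σ, offDiag β w σ ζ else offDiag β w σ η

theorem offDiag_nonneg (β : ℝ) (w : ℕ → ℕ → ℝ) {N q : ℕ} (σ η : Config N q) :
    0 ≤ offDiag β w σ η := by
  unfold offDiag
  split_ifs <;> positivity

theorem card_neighbours_le {N q : ℕ} (σ : Config N q) :
    (Finset.univ.filter fun η : Config N q => hammingDist σ η = 1).card ≤ N * q := by
  classical
  have hsub : (Finset.univ.filter fun η : Config N q => hammingDist σ η = 1) ⊆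
      (Finset.univ : Finset (Fin N × Fin q)).image fun p => Function.update σ p.1 p.2 := by
    intro η hη
    have h1 : hammingDist σ η = 1 := (Finset.mem_filter.1 hη).2
    obtain ⟨i, hi⟩ := Finset.card_eq_one.1 h1
    refine Finset.mem_image.2 ⟨(i, η i), Finset.mem_univ _, ?_⟩
    funext j
    by_cases hj : j = i
    · subst hj; simp
    · have : j ∉ (Finset.univ.filter fun i => σ i ≠ η i) := by
        rw [hi]; simpa using hj
      have h2 : σ j = η j := by simpa using this
      simp [Function.update_of_ne hj, h2]
  calc _ ≤ _ := Finset.card_le_card hsub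
    _ ≤ _ := Finset.card_image_le
    _ = N * q := by simp

theorem sum_offDiag_le_one (β : ℝ) (hβ : 0 ≤ β) (w : ℕ → ℕ → ℝ) {N q : ℕ} (σ : Config N q) :
    ∑ ζ ∈ Finset.univ.erase σ, offDiag β w σ ζ ≤ 1 := by
  have h1 : ∑ ζ ∈ Finset.univ.erase σ, offDiag β w σ ζ ≤ ∑ ζ, offDiag β w σ ζ :=
    Finset.sum_le_sum_of_subset_of_nonneg (Finset.erase_subset _ _)
      fun _ _ _ => offDiag_nonneg _ _ _ _
  refine h1.trans ?_
  have h2 : ∀ ζ ∈ (Finset.univ : Finset (Config N q)), offDiag β w σ ζ ≤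
      if hammingDist σ ζ = 1 then ((N : ℝ) * q)⁻¹ else 0 := by
    intro ζ _
    unfold offDiag
    split_ifs
    · refine mul_le_of_le_one_right (by positivity) (Real.exp_le_one_iff.2 ?_)
      have := mul_nonneg hβ (le_max_left 0 (hamiltonian w ζ - hamiltonian w σ))
      linarith
    · exact le_rfl
  refine (Finset.sum_le_sum h2).trans ?_
  rw [← Finset.sum_filter, Finset.sum_const, nsmul_eq_mul]
  have h3 : ((Finset.univ.filter fun η : Config N q => hammingDist σ η = 1).card : ℝ) ≤
      (N : ℝ) * q := by exact_mod_cast card_neighbours_le σ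
  calc _ ≤ ((N : ℝ) * q) * ((N : ℝ) * q)⁻¹ := by gcongr
    _ ≤ 1 := mul_inv_le_one

theorem transProb_nonneg (β : ℝ) (hβ : 0 ≤ β) (w : ℕ → ℕ → ℝ) {N q : ℕ} (σ η : Config N q) :
    0 ≤ transProb β w σ η := by
  unfold transProb
  split_ifs
  · linarith [sum_offDiag_le_one β hβ w σ]
  · exact offDiag_nonneg _ _ _ _

theorem sum_transProb (β : ℝ) (w : ℕ → ℕ → ℝ) {N q : ℕ} (σ : Config N q) :
    ∑ η, transProb β w σ η = 1 := by
  rw [← Finset.add_sum_erase _ _ (Finset.mem_univ σ)]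
  have : ∑ η ∈ Finset.univ.erase σ, transProb β w σ η =
      ∑ η ∈ Finset.univ.erase σ, offDiag β w σ η :=
    Finset.sum_congr rfl fun η hη => by simp [transProb, Finset.ne_of_mem_erase hη]
  rw [this]
  simp [transProb]

/-- A row of the transition matrix, as a probability mass function. -/
def row (β : ℝ) (hβ : 0 ≤ β) (w : ℕ → ℕ → ℝ) {N q : ℕ} (σ : Config N q) : PMF (Config N q) :=
  PMF.ofFintype (fun η => ENNReal.ofReal (transProb β w σ η)) (by
    rw [← ENNReal.ofReal_sum_of_nonneg fun η _ => transProb_nonneg β hβ w σ η, sum_transProb,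
      ENNReal.ofReal_one])

/-- `ℙ_σ[τ_B < τ_A]` for the chain started in `σ`. -/
def escapeProb (β : ℝ) (hβ : 0 ≤ β) (w : ℕ → ℕ → ℝ) {N q : ℕ} (A B : Set (Config N q))
    (σ : Config N q) : ℝ≥0∞ :=
  pathLaw (row β hβ w) (Measure.dirac σ) {x | returnTime B x < returnTime A x}

open Classical in
/-- The last-exit biased distribution `ν_{A,B}` on `A` for the transition from `A` to `B`. -/
def lastExit (β : ℝ) (hβ : 0 ≤ β) (w : ℕ → ℕ → ℝ) {N q : ℕ} (A B : Set (Config N q)) :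
    Measure (Config N q) :=
  ∑ σ : Config N q, if σ ∈ A then
    (ENNReal.ofReal (gibbs β w σ) * escapeProb β hβ w A B σ /
      ∑ η : Config N q,
        if η ∈ A then ENNReal.ofReal (gibbs β w η) * escapeProb β hβ w A B η else 0) •
      Measure.dirac σ
    else 0

/-- The mean hitting time `𝔼_{ν_{A,B}}[τ_B]`. -/
def meanHit (β : ℝ) (hβ : 0 ≤ β) (w : ℕ → ℕ → ℝ) {N q : ℕ} (A B : Set (Config N q)) : ℝ≥0∞ :=
  ∫⁻ x, returnTime B x ∂(pathLaw (row β hβ w) (lastExit β hβ w A B))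

/-- The assumption on the disorder: `(J i j)`, `i < j`, are i.i.d. with mean `1` and variance
`v ∈ (0, ∞)`, and their moment generating function is finite in a neighbourhood of `0`. -/
structure DisorderAssumption {Ω : Type*} [MeasurableSpace Ω] (P : Measure Ω)
    (J : ℕ → ℕ → Ω → ℝ) (v : ℝ) : Prop where
  measurable : ∀ i j, i < j → Measurable (J i j)
  indep : iIndepFun (fun e : {e : ℕ × ℕ // e.1 < e.2} => J e.1.1 e.1.2) P
  ident : ∀ i j, i < j → IdentDistrib (J i j) (J 0 1) P P
  mean : ∫ ω, J 0 1 ω ∂P = 1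
  variance : ProbabilityTheory.variance (J 0 1) P = v
  variance_pos : 0 < v
  expMoment : (0 : ℝ) ∈ interior (integrableExpSet (J 0 1) P)

/-! ### The free energy landscape -/

/-- The limiting free energy of the Curie-Weiss-Potts model. -/
def freeEnergy (β : ℝ) {q : ℕ} (x : Fin q → ℝ) : ℝ :=
  -(1 / 2) * ∑ i, x i ^ 2 + (1 / β) * ∑ i, x i * Real.log (x i)

/-- The uniform vector `(1/q, …, 1/q)`. -/
def uniformPoint (q : ℕ) : Fin q → ℝ := fun _ => 1 / (q : ℝ)

/-- `β₁(q)`: the inverse temperature above which the free energy has local minima other than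
the uniform vector. -/
def beta1 (q : ℕ) : ℝ :=
  sInf {β : ℝ | 0 < β ∧ ∃ x ∈ stdSimplex ℝ (Fin q), x ≠ uniformPoint q ∧
    IsLocalMinOn (freeEnergy β) (stdSimplex ℝ (Fin q)) x}

/-- `β₂(q)`: the inverse temperature up to which the uniform vector is a global minimum of the
free energy. -/
def beta2 (q : ℕ) : ℝ :=
  sSup {β : ℝ | 0 < β ∧ IsMinOn (freeEnergy β) (stdSimplex ℝ (Fin q)) (uniformPoint q)}

/-- The largest solution `s` of `log (1 + (q - 1) s) - log (1 - s) = β s` in the interval where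
both logarithms are defined. -/
def largestSol (β : ℝ) (q : ℕ) : ℝ :=
  sSup {s : ℝ | 0 < 1 + ((q : ℝ) - 1) * s ∧ s < 1 ∧
    Real.log (1 + ((q : ℝ) - 1) * s) - Real.log (1 - s) = β * s}

/-- The points `m_0` (index `none`) and `m_i` (index `some i`, for a colour `i`). -/
def minPoint (β : ℝ) (q : ℕ) : Option (Fin q) → Fin q → ℝ
  | none => uniformPoint q
  | some i => fun k =>
      if k = i then (1 + ((q : ℝ) - 1) * largestSol β q) / q else (1 - largestSol β q) / q

/-- The set `𝒫_N` of probability vectors with entries in `(1/N) ℕ₀`. -/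
def latticeSimplex (N q : ℕ) : Set (Fin q → ℝ) :=
  {x | x ∈ stdSimplex ℝ (Fin q) ∧ ∀ k, ∃ n : ℕ, x k = (n : ℝ) / N}

/-- `y` is a closest point to `x` (in Euclidean distance) in `𝒫_N`. -/
def IsClosestLatticePoint (N : ℕ) {q : ℕ} (x y : Fin q → ℝ) : Prop :=
  y ∈ latticeSimplex N q ∧
    ∀ z ∈ latticeSimplex N q, dist (WithLp.toLp 2 y) (WithLp.toLp 2 x) ≤
      dist (WithLp.toLp 2 z) (WithLp.toLp 2 x)

/-- The empirical measure of a configuration. -/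
def empirical {N q : ℕ} (σ : Config N q) : Fin q → ℝ :=
  fun k => (1 / (N : ℝ)) * ∑ i : Fin N, if σ i = k then 1 else 0

/-- The set `L_N⁻¹(y)` of configurations with empirical measure `y`. -/
def levelSet (N : ℕ) {q : ℕ} (y : Fin q → ℝ) : Set (Config N q) :=
  {σ | empirical σ = y}

/-- The starting and target sets of the metastable transitions (first two alternatives) and of the
tunnelling transitions (last alternative); `m N` lists the lattice approximations of the points
`m_0, m_1, …, m_q`. -/
def IsTransition (β : ℝ) (q : ℕ) (m : ℕ → Option (Fin q) → Fin q → ℝ)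
    (A B : (N : ℕ) → Set (Config N q)) : Prop :=
  (beta1 q < β ∧ β ≤ beta2 q ∧
    (∀ N, A N = ⋃ i : Fin q, levelSet N (m N (some i))) ∧
    ∀ N, B N = levelSet N (m N none)) ∨
  (beta2 q < β ∧ β < q ∧
    (∀ N, A N = levelSet N (m N none)) ∧
    ∀ N, B N = ⋃ i : Fin q, levelSet N (m N (some i))) ∨
  (beta2 q < β ∧ ∃ i : Fin q,
    (∀ N, A N = levelSet N (m N (some i))) ∧
    ∀ N, B N = ⋃ j : {j : Fin q // j ≠ i}, levelSet N (m N (some j.1)))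

end CWP

end

open MeasureTheory ProbabilityTheory
open scoped ENNReal

noncomputable section

namespace CWP

/-! ### Return times and escape events as series over trajectories -/

section Trajectories

variable {S : Type}

/-! For a reversible chain the mean hitting time from the last-exit distribution is an exact
quotient: the mass `∑ e^{-βH} h` of the equilibrium potential `h`, divided by its Dirichlet energy,
the capacity (`exists_meanHit_eq`). Both parts are compared with their Curie-Weiss-Potts (CWP)
counterparts through the deviation `Δ(σ) = H(σ) - H̃(σ)`. This is `1/N` times a centred sum of at
most `N²` independent variables, so `E e^{tΔ(σ)} ≤ e^{Kt²}` uniformly in `σ` for large `N`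
(`DisorderAssumption.exists_moment_bound`). The random quantities are therefore bounded by averages
of `e^{±βΔ}` against deterministic weights, and Minkowski's inequality (`posNorm_sum_le`) passes
from single configurations to averages.

Capacities. A Metropolis conductance depends only on the larger energy of the two endpoints, so
conductances of the two models differ by at most a sum of two exponentials of `±βΔ`. The Dirichlet
principle with the CWP potential as test function bounds the random capacity above, and a
Cauchy-Schwarz (Thomson) argument bounds it below. In both cases the error factor is averaged over
edges with the normalized edge energies of the CWP potential, which are deterministic and sum to `1`
(`dirichlet_le_one_mul_sum`, `dirichlet_one_le_mul_sum`).

Mass. Suppose that `|Δ| ≤ δN` everywhere. Then the mass of `h` is that of the starting valley, up to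
a small multiple of the CWP mass `M` of this valley (`Landscape.exists_eventually_mass`). The CWP
model satisfies a Poincare inequality, with a constant of small exponential rate, for functions
vanishing on the target, because each low lattice point is joined to a minimum by a path that hardly
climbs. Applied to `min h t`, whose energy is at most `t` times the capacity, it gives a weak-type
bound on `{h ≥ t}`; a dyadic sum turns this into a bound on the mass of `h` in the target valley.
The capacity is at most the weight of a wall that is higher than the starting level by a definite
amount, so it absorbs all the crude factors `e^{βδN}`. Exchanging the two sets gives `1 - h` on the
starting valley.

Exceptional event. If some `|Δ|` exceeds `δN`, the mass is at most the whole partition function,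
multiplied by a random sum that is then at least `1` (`badSum`). Its exponential rate is taken so
large that it beats both the number `q^N` of configurations and the ratio of the CWP partition
function to `M`.

Landscape. What is needed is a separating wall above the starting level and the absence of other low
critical points. The derivative of the one-coordinate energy is unimodal, so a point at which
transfers of mass do not help has at most two coordinate values, the larger one taken at most once
(`IsStuckLimit.eq_ray`). Along the resulting rays the derivative of the free energy has signs `+, -,
+` (`exists_rayShape`), which locates the saddle and the minima. -/

theorem prod_indicator_eq_one (U : Set S) (x : ℕ → S) (n : ℕ) (h : ∀ i < n, x (i + 1) ∈ U) :
    ∏ i ∈ Finset.range n, U.indicator (fun _ => (1 : ℝ≥0∞)) (x (i + 1)) = 1 :=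
  Finset.prod_eq_one fun i hi => by simp [h i (Finset.mem_range.1 hi)]

theorem prod_indicator_eq_zero (U : Set S) (x : ℕ → S) (n i : ℕ) (hi : i < n)
    (h : x (i + 1) ∉ U) :
    ∏ i ∈ Finset.range n, U.indicator (fun _ => (1 : ℝ≥0∞)) (x (i + 1)) = 0 :=
  Finset.prod_eq_zero (Finset.mem_range.2 hi) (by simp [h])

theorem returnTime_eq_of_first (B : Set S) (x : ℕ → S) (t : ℕ) (ht : x (t + 1) ∈ B)
    (hlt : ∀ i < t, x (i + 1) ∉ B) : returnTime B x = ((t + 1 : ℕ) : ℝ≥0∞) := by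
  unfold returnTime
  refine le_antisymm (iInf₂_le (t + 1) ⟨t.succ_pos, ht⟩) ?_
  refine le_iInf₂ fun s hs => ?_
  have : t + 1 ≤ s := by
    by_contra hcon
    obtain ⟨r, rfl⟩ : ∃ r, s = r + 1 := ⟨s - 1, by omega⟩
    exact hlt r (by omega) hs.2
  exact_mod_cast this

theorem returnTime_eq_top (B : Set S) (x : ℕ → S) (h : ∀ t, x (t + 1) ∉ B) :
    returnTime B x = ⊤ := by
  unfold returnTime
  simp only [iInf_eq_top]
  intro s hs
  obtain ⟨r, rfl⟩ : ∃ r, s = r + 1 := ⟨s - 1, by omega⟩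
  exact absurd hs.2 (h r)

/-- Tail-sum formula: the `n`-th product is the indicator of `τ_B > n`. It reduces the expectation
of an infimum to a series of killed transition operators. -/
theorem returnTime_eq_tsum (B : Set S) (x : ℕ → S) :
    returnTime B x =
      ∑' n, ∏ i ∈ Finset.range n, Bᶜ.indicator (fun _ => (1 : ℝ≥0∞)) (x (i + 1)) := by
  classical
  by_cases h : ∃ t, x (t + 1) ∈ B
  · have ht := Nat.find_spec h
    have hlt : ∀ i < Nat.find h, x (i + 1) ∉ B := fun i hi => Nat.find_min h hi
    set t := Nat.find h
    rw [returnTime_eq_of_first B x t ht hlt, tsum_eq_sum (s := Finset.range (t + 1))]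
    · rw [Finset.sum_congr rfl fun n hn => prod_indicator_eq_one Bᶜ x n fun i hi =>
        hlt i (by have := Finset.mem_range.1 hn; omega)]
      simp
    · intro n hn
      exact prod_indicator_eq_zero Bᶜ x n t (by simpa using hn) (by simpa using ht)
  · push Not at h
    rw [returnTime_eq_top B x h]
    rw [tsum_congr fun n => prod_indicator_eq_one Bᶜ x n fun i _ => h i]
    simp

/-- Decomposition according to the first positive time at which `A ∪ B` is visited; disjointness of
`A` and `B` makes the comparison of the two return times equivalent to this visit being in `B`. -/
theorem indicator_escape_eq_tsum (A B : Set S) (hAB : Disjoint A B) (x : ℕ → S) :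
    {x | returnTime B x < returnTime A x}.indicator (fun _ => (1 : ℝ≥0∞)) x =
      ∑' n, (∏ i ∈ Finset.range n, (A ∪ B)ᶜ.indicator (fun _ => (1 : ℝ≥0∞)) (x (i + 1))) *
        B.indicator (fun _ => 1) (x (n + 1)) := by
  classical
  by_cases h : ∃ t, x (t + 1) ∈ A ∪ B
  · have ht := Nat.find_spec h
    have hlt : ∀ i < Nat.find h, x (i + 1) ∉ A ∪ B := fun i hi => Nat.find_min h hi
    set t := Nat.find h
    rw [tsum_eq_single t]
    · rw [prod_indicator_eq_one _ x t fun i hi => hlt i hi, one_mul]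
      rcases ht with hA | hB
      · have hB' : x (t + 1) ∉ B := Set.disjoint_left.1 hAB hA
        have : ¬ returnTime B x < returnTime A x := by
          rw [returnTime_eq_of_first A x t hA fun i hi hc => hlt i hi (Or.inl hc), not_lt]
          unfold returnTime
          refine le_iInf₂ fun s hs => ?_
          obtain ⟨r, rfl⟩ : ∃ r, s = r + 1 := ⟨s - 1, by omega⟩
          have : t ≤ r := by
            by_contra hcon
            exact hlt r (by omega) (Or.inr hs.2)
          exact_mod_cast Nat.succ_le_succ this
        simp [this, hB']
      · have hA' : x (t + 1) ∉ A := Set.disjoint_right.1 hAB hB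
        have : returnTime B x < returnTime A x := by
          rw [returnTime_eq_of_first B x t hB fun i hi hc => hlt i hi (Or.inr hc)]
          refine lt_of_lt_of_le (b := ((t + 2 : ℕ) : ℝ≥0∞)) (by exact_mod_cast Nat.lt_succ_self _) ?_
          unfold returnTime
          refine le_iInf₂ fun s hs => ?_
          obtain ⟨r, rfl⟩ : ∃ r, s = r + 1 := ⟨s - 1, by omega⟩
          have : t + 1 ≤ r := by
            by_contra hcon
            rcases Nat.lt_or_ge r t with h1 | h1
            · exact hlt r h1 (Or.inl hs.2)
            · exact hA' ((show r = t by omega) ▸ hs.2)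
          exact_mod_cast Nat.succ_le_succ this
        simp [this, hB]
    · intro n hn
      rcases Nat.lt_or_gt_of_ne hn with h1 | h1
      · have : x (n + 1) ∉ B := fun hc => hlt n h1 (Or.inr hc)
        simp [this]
      · rw [prod_indicator_eq_zero (A ∪ B)ᶜ x n t h1 (fun hc => hc ht), zero_mul]
  · push Not at h
    have : ¬ returnTime B x < returnTime A x := by
      rw [returnTime_eq_top A x fun i hc => h i (Or.inl hc),
        returnTime_eq_top B x fun i hc => h i (Or.inr hc)]
      simp
    have h2 : ∀ n, x (n + 1) ∉ B := fun n hc => h n (Or.inr hc)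
    simp [this, h2]

end Trajectories

/-! ### Transition operators and their killed versions -/

section Operators

variable {S : Type} [Fintype S]

/-- The transition operator of the chain acting on nonnegative functions. -/
def avg (p : S → PMF S) (g : S → ℝ≥0∞) (σ : S) : ℝ≥0∞ := ∑ η, p σ η * g η

/-- The transition operator followed by the restriction to `U`. -/
def killedAvg (p : S → PMF S) (U : Set S) (g : S → ℝ≥0∞) : S → ℝ≥0∞ := U.indicator (avg p g)

theorem avg_tsum (p : S → PMF S) (g : ℕ → S → ℝ≥0∞) (σ : S) :
    avg p (fun η => ∑' n, g n η) σ = ∑' n, avg p (g n) σ := by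
  unfold avg
  simp_rw [← ENNReal.tsum_mul_left]
  rw [Summable.tsum_finsetSum fun _ _ => ENNReal.summable]

/-- The probability, seen as a function of the starting point, that the chain (time `0` included)
visits `B` and does so before visiting `A`. -/
def hitBefore (p : S → PMF S) (A B : Set S) (σ : S) : ℝ≥0∞ :=
  ∑' n, (killedAvg p (A ∪ B)ᶜ)^[n] (B.indicator fun _ => 1) σ

/-- The term `n = 0` of the series is the indicator of `B`; the remaining terms contain one more
killed step, which can be pulled out of the sum. -/
theorem hitBefore_eq (p : S → PMF S) (A B : Set S) (σ : S) :
    hitBefore p A B σ = B.indicator (fun _ => 1) σ +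
      (A ∪ B)ᶜ.indicator (avg p (hitBefore p A B)) σ := by
  unfold hitBefore
  rw [tsum_eq_zero_add' ENNReal.summable]
  congr 1
  simp_rw [Function.iterate_succ_apply', killedAvg]
  by_cases h : σ ∈ (A ∪ B)ᶜ
  · simp_rw [Set.indicator_of_mem h]
    rw [← avg_tsum]
  · simp_rw [Set.indicator_of_notMem h]
    simp

/-- `ℙ_σ[τ_B > n]`. -/
def survive (p : S → PMF S) (B : Set S) : ℕ → S → ℝ≥0∞
  | 0 => fun _ => 1
  | n + 1 => avg p (Bᶜ.indicator (survive p B n))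

/-- `survive` restricts before averaging and `killedAvg` after averaging; the two bracketings of the
same alternating product agree once the outermost average is split off. -/
theorem survive_succ_eq (p : S → PMF S) (B : Set S) (n : ℕ) :
    survive p B (n + 1) = avg p ((killedAvg p Bᶜ)^[n] (Bᶜ.indicator fun _ => 1)) := by
  have h : ∀ n, Bᶜ.indicator (survive p B n) =
      (killedAvg p Bᶜ)^[n] (Bᶜ.indicator fun _ => 1) := by
    intro n
    induction n with
    | zero => rfl
    | succ n ih => rw [Function.iterate_succ_apply', ← ih]; rfl
  rw [← h]
  rfl

end Operators

/-! ### From path measures to operators: the Markov property -/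

section Chain

variable {S : Type} [Fintype S] [MeasurableSpace S] [MeasurableSingletonClass S]

/-- The Markov property at time `n`, tested on products of a functional of the past and a function
of the next state; it comes from the composition-product description of the trajectory measure. -/
theorem lintegral_step (p : S → PMF S) (ν : Measure S) [IsProbabilityMeasure ν] (n : ℕ)
    (G : ((i : Finset.Iic n) → S) → ℝ≥0∞) (hG : Measurable G) (g : S → ℝ≥0∞) :
    ∫⁻ x, G (Preorder.frestrictLe n x) * g (x (n + 1)) ∂(pathLaw p ν) =
      ∫⁻ x, G (Preorder.frestrictLe n x) * avg p g (x n) ∂(pathLaw p ν) := by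
  have key := Kernel.map_frestrictLe_trajMeasure_compProd_eq_map_trajMeasure
    (X := fun _ => S) (μ₀ := ν) (κ := stepKernel p) (a := n)
  have hg : Measurable g := measurable_of_finite g
  have hga : Measurable (avg p g) := measurable_of_finite _
  have h1 : ∫⁻ x, G (Preorder.frestrictLe n x) * g (x (n + 1)) ∂(pathLaw p ν) =
      ∫⁻ y, G y.1 * g y.2 ∂((pathLaw p ν).map
        (fun x ↦ (Preorder.frestrictLe (π := fun _ => S) n x, x (n + 1)))) := by
    rw [lintegral_map (by fun_prop) (by fun_prop)]
  rw [h1]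
  unfold pathLaw
  rw [← key, Measure.lintegral_compProd (by fun_prop), lintegral_map
    (Measurable.lintegral_kernel_prod_right' (f := fun y => G y.1 * g y.2) (by fun_prop))
    (by fun_prop)]
  · refine lintegral_congr fun x => ?_
    change ∫⁻ b, G (Preorder.frestrictLe n x) * g b ∂_ = _
    rw [lintegral_const_mul _ hg]
    congr 1
    simp only [stepKernel, Kernel.comap_apply]
    change ∫⁻ a, g a ∂((p (x n)).toMeasure) = _
    rw [lintegral_fintype]
    unfold avg
    refine Finset.sum_congr rfl fun η _ => ?_
    rw [PMF.toMeasure_apply_singleton _ _ (measurableSet_singleton _), mul_comm]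

theorem lintegral_zero_coord (p : S → PMF S) (ν : Measure S) [IsProbabilityMeasure ν]
    (g : S → ℝ≥0∞) : ∫⁻ x, g (x 0) ∂(pathLaw p ν) = ∫⁻ σ, g σ ∂ν := by
  have hg : Measurable g := measurable_of_finite g
  have h0 : ∫⁻ x, g (x 0) ∂(pathLaw p ν) =
      ∫⁻ y, g (y ⟨0, Finset.mem_Iic.2 le_rfl⟩) ∂((pathLaw p ν).map
        (Preorder.frestrictLe (π := fun _ => S) 0)) := by
    rw [lintegral_map (by fun_prop) (by fun_prop)]
    rfl
  rw [h0]
  unfold pathLaw Kernel.trajMeasure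
  rw [Measure.map_comp _ _ (by fun_prop), Kernel.traj_map_frestrictLe, Kernel.partialTraj_self,
    Measure.id_comp, lintegral_map (by fun_prop) (by fun_prop)]
  rfl

/-- The last step is integrated out repeatedly. Only positive times carry the indicator of `U`,
which leaves one unrestricted average at time `0`, as required for return times. -/
theorem lintegral_killed (p : S → PMF S) (ν : Measure S) [IsProbabilityMeasure ν] (U : Set S)
    (n : ℕ) (g : S → ℝ≥0∞) :
    ∫⁻ x, (∏ i ∈ Finset.range n, U.indicator (fun _ => (1 : ℝ≥0∞)) (x (i + 1))) * g (x (n + 1))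
        ∂(pathLaw p ν) = ∫⁻ σ, avg p ((killedAvg p U)^[n] g) σ ∂ν := by
  have hU : Measurable (U.indicator (fun _ => (1 : ℝ≥0∞))) := measurable_of_finite _
  have step : ∀ (n : ℕ) (g : S → ℝ≥0∞),
      ∫⁻ x, (∏ i ∈ Finset.range n, U.indicator (fun _ => (1 : ℝ≥0∞)) (x (i + 1))) * g (x (n + 1))
        ∂(pathLaw p ν) =
      ∫⁻ x, (∏ i ∈ Finset.range n, U.indicator (fun _ => (1 : ℝ≥0∞)) (x (i + 1))) * avg p g (x n)
        ∂(pathLaw p ν) := by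
    intro n g
    have := lintegral_step p ν n (fun y => ∏ i : Fin n, U.indicator (fun _ => (1 : ℝ≥0∞))
      (y ⟨i + 1, Finset.mem_Iic.2 (by omega)⟩)) (by fun_prop) g
    simpa only [Finset.prod_range, Preorder.frestrictLe_apply] using this
  induction n generalizing g with
  | zero =>
    rw [step]
    simp [lintegral_zero_coord]
  | succ n ih =>
    rw [step, Function.iterate_succ_apply, ← ih]
    refine lintegral_congr fun x => ?_
    rw [Finset.prod_range_succ, mul_assoc]
    congr 1
    by_cases h : x (n + 1) ∈ U <;> simp [killedAvg, h]

theorem measurable_returnTime (B : Set S) : Measurable (returnTime B : (ℕ → S) → ℝ≥0∞) := by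
  have : (returnTime B : (ℕ → S) → ℝ≥0∞) = fun x => ∑' n, ∏ i ∈ Finset.range n,
      Bᶜ.indicator (fun _ => (1 : ℝ≥0∞)) (x (i + 1)) := funext fun x => returnTime_eq_tsum B x
  have hU : Measurable (Bᶜ.indicator (fun _ => (1 : ℝ≥0∞))) := measurable_of_finite _
  rw [this]
  fun_prop

theorem escape_eq (p : S → PMF S) (A B : Set S) (hAB : Disjoint A B) (σ : S) :
    pathLaw p (Measure.dirac σ) {x | returnTime B x < returnTime A x} =
      avg p (hitBefore p A B) σ := by
  have hm : MeasurableSet {x : ℕ → S | returnTime B x < returnTime A x} :=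
    measurableSet_lt (measurable_returnTime B) (measurable_returnTime A)
  rw [← lintegral_indicator_one hm]
  change ∫⁻ x, {x | returnTime B x < returnTime A x}.indicator (fun _ => (1 : ℝ≥0∞)) x ∂_ = _
  simp_rw [indicator_escape_eq_tsum A B hAB]
  have hU : Measurable ((A ∪ B)ᶜ.indicator (fun _ => (1 : ℝ≥0∞))) := measurable_of_finite _
  have hB : Measurable (B.indicator (fun _ => (1 : ℝ≥0∞))) := measurable_of_finite _
  rw [lintegral_tsum fun n => by fun_prop]
  simp_rw [lintegral_killed p (Measure.dirac σ) (A ∪ B)ᶜ, lintegral_dirac]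
  rw [← avg_tsum]
  rfl

theorem lintegral_returnTime (p : S → PMF S) (ν : Measure S) [IsProbabilityMeasure ν]
    (B : Set S) :
    ∫⁻ x, returnTime B x ∂(pathLaw p ν) = ∫⁻ σ, ∑' n, survive p B n σ ∂ν := by
  have hU : Measurable (Bᶜ.indicator (fun _ => (1 : ℝ≥0∞))) := measurable_of_finite _
  simp_rw [returnTime_eq_tsum]
  have hm : ∀ n, Measurable fun x : ℕ → S =>
      ∏ i ∈ Finset.range n, Bᶜ.indicator (fun _ => (1 : ℝ≥0∞)) (x (i + 1)) := fun n =>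
    Finset.measurable_prod _ fun i _ => hU.comp (measurable_pi_apply (i + 1))
  rw [lintegral_tsum fun n => (hm n).aemeasurable,
    lintegral_tsum fun n => (measurable_of_finite _).aemeasurable]
  refine tsum_congr fun n => ?_
  cases n with
  | zero =>
    have := lintegral_zero_coord p ν (fun _ => 1)
    simpa [survive] using this
  | succ n =>
    rw [survive_succ_eq, ← lintegral_killed p ν Bᶜ n]
    refine lintegral_congr fun x => ?_
    rw [Finset.prod_range_succ]

end Chain

/-! ### Potential theory: Dirichlet and Thomson principles -/

section Dirichlet

variable {S : Type} [Fintype S]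

/-- The Dirichlet form with conductances `c`. -/
def dirichlet (c : S → S → ℝ) (f g : S → ℝ) : ℝ :=
  (1 / 2) * ∑ σ, ∑ η, c σ η * ((f σ - f η) * (g σ - g η))

/-- The action of a matrix of transition probabilities on functions. -/
def act (P : S → S → ℝ) (f : S → ℝ) (σ : S) : ℝ := ∑ η, P σ η * f η

/-- `P` is a matrix with row sums `1`, reversible with respect to the weights `w`. -/
structure Reversible (w : S → ℝ) (P : S → S → ℝ) : Prop where
  pos : ∀ σ, 0 < w σ
  nonneg : ∀ σ η, 0 ≤ P σ η
  sum_eq_one : ∀ σ, ∑ η, P σ η = 1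
  symm : ∀ σ η, w σ * P σ η = w η * P η σ

/-- The conductances of a reversible matrix. -/
def conductance (w : S → ℝ) (P : S → S → ℝ) (σ η : S) : ℝ := w σ * P σ η

theorem dirichlet_comm (c : S → S → ℝ) (f g : S → ℝ) : dirichlet c f g = dirichlet c g f := by
  unfold dirichlet
  simp_rw [mul_comm (f _ - f _)]

theorem dirichlet_nonneg (c : S → S → ℝ) (hc : ∀ σ η, 0 ≤ c σ η) (f : S → ℝ) :
    0 ≤ dirichlet c f f :=
  mul_nonneg (by norm_num) (Finset.sum_nonneg fun σ _ => Finset.sum_nonneg fun η _ =>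
    mul_nonneg (hc σ η) (mul_self_nonneg _))

theorem dirichlet_one_sub (c : S → S → ℝ) (f g : S → ℝ) :
    dirichlet c (fun σ => 1 - f σ) g = - dirichlet c f g := by
  unfold dirichlet
  rw [← mul_neg, ← Finset.sum_neg_distrib]
  simp_rw [← Finset.sum_neg_distrib]
  congr 1
  refine Finset.sum_congr rfl fun σ _ => Finset.sum_congr rfl fun η _ => ?_
  ring

/-- Diagonal terms vanish in the Dirichlet form, so holding probabilities, for which no comparison
is available, never have to be compared. -/
theorem dirichlet_le_of_le {c c' : S → S → ℝ} {K : ℝ} (h : ∀ σ η, σ ≠ η → c σ η ≤ K * c' σ η)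
    (f : S → ℝ) : dirichlet c f f ≤ K * dirichlet c' f f := by
  have : ∑ σ, ∑ η, c σ η * ((f σ - f η) * (f σ - f η)) ≤
      K * ∑ σ, ∑ η, c' σ η * ((f σ - f η) * (f σ - f η)) := by
    rw [Finset.mul_sum]
    refine Finset.sum_le_sum fun σ _ => ?_
    rw [Finset.mul_sum]
    refine Finset.sum_le_sum fun η _ => ?_
    rcases eq_or_ne σ η with rfl | hne
    · simp
    · rw [← mul_assoc K]
      exact mul_le_mul_of_nonneg_right (h σ η hne) (mul_self_nonneg _)
  unfold dirichlet
  linarith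

/-- `h` is the equilibrium potential of the pair `(A, B)`. -/
structure IsPotential (P : S → S → ℝ) (A B : Set S) (h : S → ℝ) : Prop where
  one : ∀ σ ∈ A, h σ = 1
  zero : ∀ σ ∈ B, h σ = 0
  harmonic : ∀ σ, σ ∉ A → σ ∉ B → act P h σ = h σ
  nonneg : ∀ σ, 0 ≤ h σ
  le_one : ∀ σ, h σ ≤ 1

variable {w : S → ℝ} {P : S → S → ℝ}

theorem act_one_sub (hP : Reversible w P) (f : S → ℝ) (σ : S) :
    act P (fun η => 1 - f η) σ = 1 - act P f σ := by
  unfold act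
  simp_rw [mul_sub, mul_one]
  rw [Finset.sum_sub_distrib, hP.sum_eq_one]

theorem IsPotential.one_sub (hP : Reversible w P) {A B : Set S} {h : S → ℝ}
    (hh : IsPotential P A B h) : IsPotential P B A (fun σ => 1 - h σ) where
  one σ hσ := by simp [hh.zero σ hσ]
  zero σ hσ := by simp [hh.one σ hσ]
  harmonic σ h1 h2 := by rw [act_one_sub hP, hh.harmonic σ h2 h1]
  nonneg σ := by linarith [hh.le_one σ]
  le_one σ := by linarith [hh.nonneg σ]

theorem Reversible.conductance_symm (hP : Reversible w P) (σ η : S) :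
    conductance w P σ η = conductance w P η σ := hP.symm σ η

theorem Reversible.conductance_nonneg (hP : Reversible w P) (σ η : S) :
    0 ≤ conductance w P σ η := mul_nonneg (hP.pos σ).le (hP.nonneg σ η)

/-- Summation by parts; symmetry of the conductances makes the two halves equal. -/
theorem dirichlet_eq_sum (hP : Reversible w P) (f g : S → ℝ) :
    dirichlet (conductance w P) f g = ∑ σ, w σ * ((f σ - act P f σ) * g σ) := by
  have h1 : ∑ σ, ∑ η, conductance w P σ η * ((f σ - f η) * (g σ - g η)) =
      ∑ σ, ∑ η, conductance w P σ η * ((f σ - f η) * g σ) +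
        ∑ σ, ∑ η, conductance w P σ η * ((f η - f σ) * g η) := by
    simp_rw [← Finset.sum_add_distrib]
    refine Finset.sum_congr rfl fun σ _ => Finset.sum_congr rfl fun η _ => ?_
    ring
  have h2 : ∑ σ, ∑ η, conductance w P σ η * ((f η - f σ) * g η) =
      ∑ σ, ∑ η, conductance w P σ η * ((f σ - f η) * g σ) := by
    rw [Finset.sum_comm]
    refine Finset.sum_congr rfl fun σ _ => Finset.sum_congr rfl fun η _ => ?_
    rw [hP.conductance_symm]
  have h3 : ∀ σ, ∑ η, conductance w P σ η * ((f σ - f η) * g σ) =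
      w σ * ((f σ - act P f σ) * g σ) := by
    intro σ
    have : f σ - act P f σ = ∑ η, P σ η * (f σ - f η) := by
      simp_rw [mul_sub]
      rw [Finset.sum_sub_distrib, ← Finset.sum_mul, hP.sum_eq_one, one_mul]
      rfl
    rw [this, Finset.sum_mul, Finset.mul_sum]
    refine Finset.sum_congr rfl fun η _ => ?_
    unfold conductance
    ring
  unfold dirichlet
  rw [h1, h2, Finset.sum_congr rfl fun σ _ => h3 σ]
  ring

/-- The energy of the potential against a function that vanishes on `B` and is constant on `A`. -/
theorem IsPotential.dirichlet_eq_mul (hP : Reversible w P) {A B : Set S} {h : S → ℝ}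
    (hh : IsPotential P A B h) (g : S → ℝ) (t : ℝ) (hgA : ∀ σ ∈ A, g σ = t)
    (hgB : ∀ σ ∈ B, g σ = 0) :
    dirichlet (conductance w P) h g = t * dirichlet (conductance w P) h h := by
  rw [dirichlet_eq_sum hP, dirichlet_eq_sum hP, Finset.mul_sum]
  -- On `A` and on `B` the function `g` coincides with `t * h`, and elsewhere `h - act P h`
  -- vanishes.
  refine Finset.sum_congr rfl fun σ _ => ?_
  by_cases hA : σ ∈ A
  · rw [hgA σ hA, hh.one σ hA]; ring
  · by_cases hB : σ ∈ B
    · rw [hgB σ hB, hh.zero σ hB]; ring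
    · rw [hh.harmonic σ hA hB]; ring

/-- Dirichlet principle. -/
theorem IsPotential.dirichlet_le (hP : Reversible w P) {A B : Set S} {h : S → ℝ}
    (hh : IsPotential P A B h) (g : S → ℝ) (hgA : ∀ σ ∈ A, g σ = 1) (hgB : ∀ σ ∈ B, g σ = 0) :
    dirichlet (conductance w P) h h ≤ dirichlet (conductance w P) g g := by
  have h1 := hh.dirichlet_eq_mul hP g 1 hgA hgB
  -- The energy of `g - h` is nonnegative, and its cross term equals the energy of `h`.
  have h2 := dirichlet_nonneg (conductance w P) hP.conductance_nonneg (fun σ => g σ - h σ)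
  have h3 : dirichlet (conductance w P) (fun σ => g σ - h σ) (fun σ => g σ - h σ) =
      dirichlet (conductance w P) g g - 2 * dirichlet (conductance w P) h g +
        dirichlet (conductance w P) h h := by
    unfold dirichlet
    simp only [Finset.mul_sum]
    rw [← Finset.sum_sub_distrib, ← Finset.sum_add_distrib]
    refine Finset.sum_congr rfl fun σ _ => ?_
    rw [← Finset.sum_sub_distrib, ← Finset.sum_add_distrib]
    refine Finset.sum_congr rfl fun η _ => ?_
    ring
  linarith

/-- The energy of a truncated potential. -/
theorem IsPotential.dirichlet_min_le (hP : Reversible w P) {A B : Set S} {h : S → ℝ}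
    (hh : IsPotential P A B h) {t : ℝ} (ht0 : 0 ≤ t) (ht1 : t ≤ 1) :
    dirichlet (conductance w P) (fun σ => min (h σ) t) (fun σ => min (h σ) t) ≤
      t * dirichlet (conductance w P) h h := by
  rw [← hh.dirichlet_eq_mul hP (fun σ => min (h σ) t) t
    (fun σ hσ => by simp [hh.one σ hσ, ht1]) (fun σ hσ => by simp [hh.zero σ hσ, ht0])]
  unfold dirichlet
  refine mul_le_mul_of_nonneg_left ?_ (by norm_num)
  refine Finset.sum_le_sum fun σ _ => Finset.sum_le_sum fun η _ => ?_
  refine mul_le_mul_of_nonneg_left ?_ (hP.conductance_nonneg σ η)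
  -- Truncation is monotone and 1-Lipschitz, so the square of a truncated increment is at most its
  -- product with the full increment.
  rcases le_total (h σ) t with h1 | h1 <;> rcases le_total (h η) t with h2 | h2 <;>
    simp only [min_eq_left h1, min_eq_left h2, min_eq_right h1, min_eq_right h2] <;> nlinarith

/-- Thomson principle: comparison of the energies of the potentials of two chains. -/
theorem IsPotential.sq_dirichlet_le {w' : S → ℝ} {P' : S → S → ℝ} (hP : Reversible w P)
    (hP' : Reversible w' P') {A B : Set S} {h h' : S → ℝ} (hh : IsPotential P A B h)
    (hh' : IsPotential P' A B h') (K : S → S → ℝ) (hK0 : ∀ σ η, 0 ≤ K σ η)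
    (hK : ∀ σ η, σ ≠ η → conductance w P σ η ≤ K σ η * conductance w' P' σ η) :
    dirichlet (conductance w P) h h ^ 2 ≤
      dirichlet (fun σ η => conductance w P σ η * K σ η) h h *
        dirichlet (conductance w' P') h' h' := by
  -- The mutual energy of `h` and any function with the same boundary values is the energy of `h`;
  -- it is then estimated by Cauchy-Schwarz against `h'`.
  have h1 := hh.dirichlet_eq_mul hP h' 1 hh'.one hh'.zero
  rw [one_mul] at h1
  rw [← h1]
  unfold dirichlet
  have key := Finset.sum_mul_sq_le_sq_mul_sq (Finset.univ : Finset (S × S))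
    (fun x => √(conductance w P x.1 x.2 * K x.1 x.2) * (h x.1 - h x.2))
    (fun x => √(conductance w' P' x.1 x.2) * (h' x.1 - h' x.2))
  have e1 : ∑ x : S × S, (√(conductance w P x.1 x.2 * K x.1 x.2) * (h x.1 - h x.2)) ^ 2 =
      ∑ σ, ∑ η, conductance w P σ η * K σ η * ((h σ - h η) * (h σ - h η)) := by
    rw [Fintype.sum_prod_type]
    refine Finset.sum_congr rfl fun σ _ => Finset.sum_congr rfl fun η _ => ?_
    rw [mul_pow, Real.sq_sqrt (mul_nonneg (hP.conductance_nonneg _ _) (hK0 _ _)), sq]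
  have e2 : ∑ x : S × S, (√(conductance w' P' x.1 x.2) * (h' x.1 - h' x.2)) ^ 2 =
      ∑ σ, ∑ η, conductance w' P' σ η * ((h' σ - h' η) * (h' σ - h' η)) := by
    rw [Fintype.sum_prod_type]
    refine Finset.sum_congr rfl fun σ _ => Finset.sum_congr rfl fun η _ => ?_
    rw [mul_pow, Real.sq_sqrt (hP'.conductance_nonneg _ _), sq]
  rw [e1, e2] at key
  have h2 : |∑ σ, ∑ η, conductance w P σ η * ((h σ - h η) * (h' σ - h' η))| ≤
      ∑ x : S × S, √(conductance w P x.1 x.2 * K x.1 x.2) * |h x.1 - h x.2| *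
        (√(conductance w' P' x.1 x.2) * |h' x.1 - h' x.2|) := by
    rw [Fintype.sum_prod_type]
    refine (Finset.abs_sum_le_sum_abs _ _).trans (Finset.sum_le_sum fun σ _ => ?_)
    refine (Finset.abs_sum_le_sum_abs _ _).trans (Finset.sum_le_sum fun η _ => ?_)
    rw [abs_mul, abs_mul, abs_of_nonneg (hP.conductance_nonneg σ η)]
    rcases eq_or_ne σ η with rfl | hne
    · simp
    have : conductance w P σ η ≤
        √(conductance w P σ η * K σ η) * √(conductance w' P' σ η) := by
      rw [← Real.sqrt_mul (mul_nonneg (hP.conductance_nonneg _ _) (hK0 _ _))]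
      refine Real.le_sqrt_of_sq_le ?_
      rw [sq, mul_assoc]
      exact mul_le_mul_of_nonneg_left (hK σ η hne) (hP.conductance_nonneg σ η)
    calc _ ≤ √(conductance w P σ η * K σ η) * √(conductance w' P' σ η) *
          (|h σ - h η| * |h' σ - h' η|) := mul_le_mul_of_nonneg_right this (by positivity)
      _ = _ := by ring
  -- The conductance is only bounded above by the product of the square roots, so absolute values of
  -- the increments are used.
  have key' := Finset.sum_mul_sq_le_sq_mul_sq (Finset.univ : Finset (S × S))
    (fun x => √(conductance w P x.1 x.2 * K x.1 x.2) * |h x.1 - h x.2|)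
    (fun x => √(conductance w' P' x.1 x.2) * |h' x.1 - h' x.2|)
  simp only [mul_pow, sq_abs] at key'
  simp only [mul_pow] at e1 e2
  rw [e1, e2] at key'
  have h3 := pow_le_pow_left₀ (abs_nonneg _) h2 2
  rw [sq_abs] at h3
  nlinarith [h3.trans key']

/-- The graph of positive conductances is connected. -/
def IsConnectedNet (c : S → S → ℝ) : Prop :=
  ∀ f : S → ℝ, (∀ σ η, 0 < c σ η → f σ = f η) → ∀ σ η, f σ = f η

/-- Zero energy would make `h` constant on a connected network, although it takes the values `1` and
`0`. -/
theorem IsPotential.dirichlet_pos (hP : Reversible w P)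
    (hc : IsConnectedNet (conductance w P)) {A B : Set S} (hA : A.Nonempty) (hB : B.Nonempty)
    {h : S → ℝ} (hh : IsPotential P A B h) : 0 < dirichlet (conductance w P) h h := by
  refine lt_of_le_of_ne (dirichlet_nonneg _ hP.conductance_nonneg h) fun h0 => ?_
  obtain ⟨a, ha⟩ := hA
  obtain ⟨b, hb⟩ := hB
  have hz : ∑ σ, ∑ η, conductance w P σ η * ((h σ - h η) * (h σ - h η)) = 0 := by
    unfold dirichlet at h0; linarith
  have hn : ∀ σ η, 0 ≤ conductance w P σ η * ((h σ - h η) * (h σ - h η)) := fun σ η =>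
    mul_nonneg (hP.conductance_nonneg σ η) (mul_self_nonneg _)
  have h1 := (Finset.sum_eq_zero_iff_of_nonneg fun σ _ => Finset.sum_nonneg fun η _ => hn σ η).1 hz
  have h2 : h a = h b := hc h (fun σ η hpos => by
    have h3 := (Finset.sum_eq_zero_iff_of_nonneg fun η _ => hn σ η).1
      (h1 σ (Finset.mem_univ _)) η (Finset.mem_univ _)
    rcases mul_eq_zero.1 h3 with h4 | h4
    · exact absurd h4 hpos.ne'
    · have := mul_self_eq_zero.1 h4
      linarith) a b
  rw [hh.one a ha, hh.zero b hb] at h2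
  exact one_ne_zero h2

end Dirichlet

/-! ### Survival probabilities and truncated mean hitting times -/

section Survival

variable {S : Type} [Fintype S]

theorem avg_mono (p : S → PMF S) {f g : S → ℝ≥0∞} (h : ∀ σ, f σ ≤ g σ) (σ : S) :
    avg p f σ ≤ avg p g σ :=
  Finset.sum_le_sum fun η _ => mul_le_mul_right (h η) _

theorem avg_one (p : S → PMF S) (σ : S) : avg p (fun _ => 1) σ = 1 := by
  unfold avg
  simp only [mul_one]
  rw [← tsum_fintype (L := .unconditional S), (p σ).tsum_coe]

theorem toReal_avg (p : S → PMF S) {f : S → ℝ≥0∞} (hf : ∀ σ, f σ ≠ ⊤) (σ : S) :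
    (avg p f σ).toReal = act (fun σ η => (p σ η).toReal) (fun η => (f η).toReal) σ := by
  unfold avg act
  rw [ENNReal.toReal_sum fun η _ => ENNReal.mul_ne_top ((p σ).apply_ne_top η) (hf η)]
  simp [ENNReal.toReal_mul]

theorem survive_le_one (p : S → PMF S) (B : Set S) (n : ℕ) (σ : S) : survive p B n σ ≤ 1 := by
  induction n generalizing σ with
  | zero => exact le_rfl
  | succ n ih =>
    refine (avg_mono p (g := fun _ => 1) (fun η => ?_) σ).trans (avg_one p σ).le
    by_cases h : η ∈ Bᶜ
    · simpa [h] using ih η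
    · simp [h]

/-- The real-valued sums of survival probabilities. -/
def surviveSum (p : S → PMF S) (B : Set S) (n : ℕ) (σ : S) : ℝ :=
  ∑ k ∈ Finset.range n, (survive p B k σ).toReal

/-- First-step analysis for `E[min(τ_B, n)]`. The truncation keeps everything real-valued before the
mean hitting time is known to be finite. -/
theorem surviveSum_succ (p : S → PMF S) (B : Set S) (n : ℕ) (σ : S) :
    surviveSum p B (n + 1) σ =
      1 + act (fun σ η => (p σ η).toReal) (Bᶜ.indicator (surviveSum p B n)) σ := by
  have hf : ∀ k, ∀ η, Bᶜ.indicator (survive p B k) η ≠ ⊤ := by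
    intro k η
    by_cases h : η ∈ Bᶜ
    · simpa [h] using ((survive_le_one p B k η).trans_lt ENNReal.one_lt_top).ne
    · simp [h]
  unfold surviveSum
  rw [Finset.sum_range_succ', add_comm]
  congr 1
  have h1 : ∀ k, (survive p B (k + 1) σ).toReal = act (fun σ η => (p σ η).toReal)
      (fun η => (Bᶜ.indicator (survive p B k) η).toReal) σ := fun k => by
    rw [← toReal_avg p (hf k)]; rfl
  simp_rw [h1]
  unfold act
  rw [Finset.sum_comm]
  refine Finset.sum_congr rfl fun η _ => ?_
  rw [← Finset.mul_sum]
  congr 1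
  by_cases h : η ∈ Bᶜ <;> simp [h]

end Survival

/-! ### The mean hitting time formula for reversible chains -/

section MeanHitting

variable {S : Type} [Fintype S] [MeasurableSpace S] [MeasurableSingletonClass S]
variable {w : S → ℝ} {p : S → PMF S}

theorem hitBefore_le_one (p : S → PMF S) {A B : Set S} (hAB : Disjoint A B) (σ : S) :
    hitBefore p A B σ ≤ 1 := by
  rw [hitBefore_eq]
  by_cases h : σ ∈ A ∪ B
  · rw [Set.indicator_of_notMem (s := (A ∪ B)ᶜ) (fun hc => hc h), add_zero]
    exact Set.indicator_le_self' (fun _ _ => zero_le) σ |>.trans le_rfl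
  · have hB : σ ∉ B := fun hc => h (Or.inr hc)
    rw [Set.indicator_of_notMem hB, zero_add, Set.indicator_of_mem (by exact h),
      ← escape_eq p A B hAB]
    have : IsProbabilityMeasure (pathLaw p (Measure.dirac σ)) := by
      unfold pathLaw; infer_instance
    exact prob_le_one

theorem isPotential_hitBefore (p : S → PMF S) {A B : Set S} (hAB : Disjoint A B) :
    IsPotential (fun σ η => (p σ η).toReal) B A (fun σ => (hitBefore p A B σ).toReal) where
  one σ hσ := by
    rw [hitBefore_eq]
    simp [hσ]
  zero σ hσ := by
    rw [hitBefore_eq]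
    simp [hσ, Set.disjoint_left.1 hAB hσ]
  harmonic σ h1 h2 := by
    rw [← toReal_avg p fun σ => ((hitBefore_le_one p hAB σ).trans_lt ENNReal.one_lt_top).ne]
    conv_rhs => rw [hitBefore_eq]
    simp [h1, h2]
  nonneg σ := ENNReal.toReal_nonneg
  le_one σ := ENNReal.toReal_mono ENNReal.one_ne_top (hitBefore_le_one p hAB σ)

/-- Escape probabilities weighted by the truncated mean hitting times. -/
theorem sum_escape_mul_surviveSum (hP : Reversible w fun σ η => (p σ η).toReal) {A B : Set S}
    (hAB : Disjoint A B) {h : S → ℝ}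
    (hh : h = fun σ => 1 - (hitBefore p A B σ).toReal) (n : ℕ) :
    ∑ σ, w σ * A.indicator (fun σ => (avg p (hitBefore p A B) σ).toReal * surviveSum p B n σ) σ =
      ∑ σ, w σ * (h σ * (1 - (survive p B n σ).toReal)) := by
  have hu := isPotential_hitBefore p hAB
  -- The formula is the symmetry of the Dirichlet form for the pair consisting of the potential and
  -- the truncated mean hitting time set to zero on `B`: each side is evaluated by summation by
  -- parts in a different argument.
  have e := dirichlet_one_sub (conductance w fun σ η => (p σ η).toReal)
    (fun σ => (hitBefore p A B σ).toReal) (Bᶜ.indicator (surviveSum p B n))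
  rw [dirichlet_comm, dirichlet_eq_sum hP, dirichlet_eq_sum hP] at e
  have l : ∀ σ, w σ * ((Bᶜ.indicator (surviveSum p B n) σ -
      act (fun σ η => (p σ η).toReal) (Bᶜ.indicator (surviveSum p B n)) σ) *
        (1 - (hitBefore p A B σ).toReal)) = w σ * (h σ * (1 - (survive p B n σ).toReal)) := by
    intro σ
    subst hh
    by_cases hB : σ ∈ B
    · simp [hu.one σ hB]
    · have := surviveSum_succ p B n σ
      have h2 : surviveSum p B (n + 1) σ = surviveSum p B n σ + (survive p B n σ).toReal :=
        Finset.sum_range_succ _ _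
      rw [Set.indicator_of_mem (show σ ∈ Bᶜ from hB)]
      have h3 : surviveSum p B n σ - act (fun σ η => (p σ η).toReal)
        (Bᶜ.indicator (surviveSum p B n)) σ = 1 - (survive p B n σ).toReal := by linarith
      rw [h3]
      ring
  rw [Finset.sum_congr rfl fun σ _ => l σ] at e
  rw [e, ← Finset.sum_neg_distrib]
  refine Finset.sum_congr rfl fun σ _ => ?_
  by_cases hA : σ ∈ A
  · have hB : σ ∈ Bᶜ := Set.disjoint_left.1 hAB hA
    rw [Set.indicator_of_mem hA, Set.indicator_of_mem hB, hu.zero σ hA,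
      toReal_avg p fun σ => ((hitBefore_le_one p hAB σ).trans_lt ENNReal.one_lt_top).ne]
    ring
  · rw [Set.indicator_of_notMem hA]
    by_cases hB : σ ∈ B
    · simp [hB]
    · rw [hu.harmonic σ hB hA]
      ring

theorem sum_escape_eq (hP : Reversible w fun σ η => (p σ η).toReal) {A B : Set S}
    (hAB : Disjoint A B) {h : S → ℝ}
    (hh : h = fun σ => 1 - (hitBefore p A B σ).toReal) :
    ∑ σ, w σ * A.indicator (fun σ => (avg p (hitBefore p A B) σ).toReal) σ =
      dirichlet (conductance w fun σ η => (p σ η).toReal) h h := by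
  have hu := isPotential_hitBefore p hAB
  have hhP : IsPotential (fun σ η => (p σ η).toReal) A B h := by
    subst hh; exact hu.one_sub hP
  rw [dirichlet_eq_sum hP]
  refine Finset.sum_congr rfl fun σ _ => ?_
  by_cases hA : σ ∈ A
  · rw [Set.indicator_of_mem hA, hhP.one σ hA, hh, act_one_sub hP,
      toReal_avg p fun σ => ((hitBefore_le_one p hAB σ).trans_lt ENNReal.one_lt_top).ne]
    ring
  · rw [Set.indicator_of_notMem hA]
    by_cases hB : σ ∈ B
    · rw [hhP.zero σ hB]; ring
    · rw [hhP.harmonic σ hA hB]; ring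

/-- With `A = {σ}` the truncated identity bounds the escape probability times `E_σ[min(τ_B, n)]` by
the total weight over `w σ`, uniformly in `n`; the escape probability is positive because the
network is connected. -/
theorem tsum_survive_ne_top (hP : Reversible w fun σ η => (p σ η).toReal)
    (hc : IsConnectedNet (conductance w fun σ η => (p σ η).toReal)) {B : Set S}
    (hB : B.Nonempty) {σ : S} (hσ : σ ∉ B) : ∑' n, survive p B n σ ≠ ⊤ := by
  classical
  have hd : Disjoint {σ} B := Set.disjoint_singleton_left.2 hσ
  have hpot := (isPotential_hitBefore p hd).one_sub hP
  have hpos := hpot.dirichlet_pos hP hc (Set.singleton_nonempty σ) hB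
  rw [← sum_escape_eq hP hd rfl] at hpos
  have hbound : ∀ n, surviveSum p B n σ ≤
      (∑ η, w η) / (w σ * (avg p (hitBefore p {σ} B) σ).toReal) := by
    intro n
    have e := sum_escape_mul_surviveSum hP hd rfl n
    have e1 : ∀ g : S → ℝ, ∑ η, w η * Set.indicator {σ} g η = w σ * g σ := by
      intro g
      rw [Finset.sum_eq_single σ]
      · simp
      · intro η _ hη; simp [hη]
      · simp
    rw [e1] at e hpos
    rw [le_div_iff₀ hpos]
    calc surviveSum p B n σ * (w σ * (avg p (hitBefore p {σ} B) σ).toReal)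
        = w σ * ((avg p (hitBefore p {σ} B) σ).toReal * surviveSum p B n σ) := by ring
      _ = _ := e
      _ ≤ ∑ η, w η := Finset.sum_le_sum fun η _ => by
        have h1 := hpot.nonneg η
        have h2 := hpot.le_one η
        have h3 : (survive p B n η).toReal ≤ 1 :=
          ENNReal.toReal_mono ENNReal.one_ne_top (survive_le_one p B n η)
        have h4 : 0 ≤ (survive p B n η).toReal := ENNReal.toReal_nonneg
        exact mul_le_of_le_one_right (hP.pos η).le (mul_le_one₀ h2 (by linarith) (by linarith))
  refine ne_top_of_le_ne_top (ENNReal.ofReal_ne_top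
    (r := (∑ η, w η) / (w σ * (avg p (hitBefore p {σ} B) σ).toReal))) ?_
  rw [ENNReal.tsum_eq_iSup_nat]
  refine iSup_le fun n => ?_
  have hfin : ∀ k ∈ Finset.range n, survive p B k σ ≠ ⊤ := fun k _ =>
    ((survive_le_one p B k σ).trans_lt ENNReal.one_lt_top).ne
  rw [← ENNReal.ofReal_toReal (ENNReal.sum_ne_top.2 hfin), ENNReal.toReal_sum hfin]
  exact ENNReal.ofReal_le_ofReal (hbound n)

/-- The mean hitting time of `B` averaged over escapes from `A`. -/
theorem sum_escape_mul_hitting (hP : Reversible w fun σ η => (p σ η).toReal)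
    (hc : IsConnectedNet (conductance w fun σ η => (p σ η).toReal)) {A B : Set S}
    (hAB : Disjoint A B) (hB : B.Nonempty) {h : S → ℝ}
    (hh : h = fun σ => 1 - (hitBefore p A B σ).toReal) :
    ∑ σ, w σ * A.indicator (fun σ => (avg p (hitBefore p A B) σ).toReal *
      (∑' n, survive p B n σ).toReal) σ = ∑ σ, w σ * h σ := by
  have hfin : ∀ k σ, survive p B k σ ≠ ⊤ := fun k σ =>
    ((survive_le_one p B k σ).trans_lt ENNReal.one_lt_top).ne
  have hsum : ∀ σ, σ ∉ B → Summable fun n => (survive p B n σ).toReal := fun σ hσ =>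
    ENNReal.summable_toReal (tsum_survive_ne_top hP hc hB hσ)
  have t1 : Filter.Tendsto (fun n => ∑ σ, w σ * A.indicator (fun σ =>
      (avg p (hitBefore p A B) σ).toReal * surviveSum p B n σ) σ) Filter.atTop
      (nhds (∑ σ, w σ * A.indicator (fun σ => (avg p (hitBefore p A B) σ).toReal *
      (∑' n, survive p B n σ).toReal) σ)) := by
    refine tendsto_finsetSum _ fun σ _ => Filter.Tendsto.const_mul _ ?_
    by_cases hA : σ ∈ A
    · simp only [Set.indicator_of_mem hA]
      refine Filter.Tendsto.const_mul _ ?_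
      rw [ENNReal.tsum_toReal_eq fun n => hfin n σ]
      exact (hsum σ (Set.disjoint_left.1 hAB hA)).hasSum.tendsto_sum_nat
    · simp only [Set.indicator_of_notMem hA]
      exact tendsto_const_nhds
  have t2 : Filter.Tendsto (fun n => ∑ σ, w σ * (h σ * (1 - (survive p B n σ).toReal)))
      Filter.atTop (nhds (∑ σ, w σ * h σ)) := by
    refine tendsto_finsetSum _ fun σ _ => Filter.Tendsto.const_mul _ ?_
    -- On `B` the potential vanishes, so convergence of the survival probability is not needed
    -- there.
    by_cases hσ : σ ∈ B
    · have h0 : h σ = 0 := by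
        rw [hh]; simp [(isPotential_hitBefore p hAB).one σ hσ]
      simp [h0]
    · have := (hsum σ hσ).tendsto_atTop_zero
      have h3 := (this.const_sub 1).const_mul (h σ)
      simpa using h3
  simp_rw [sum_escape_mul_surviveSum hP hAB hh] at t1
  exact tendsto_nhds_unique t1 t2

end MeanHitting

/-! ### The Metropolis chain as an electrical network -/

section Model

variable {N q : ℕ}

/-- The Boltzmann weights. -/
def weight (β : ℝ) (w : ℕ → ℕ → ℝ) (σ : Config N q) : ℝ := Real.exp (-β * hamiltonian w σ)

/-- The conductances of the Metropolis dynamics. -/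
abbrev cond (β : ℝ) (w : ℕ → ℕ → ℝ) : Config N q → Config N q → ℝ :=
  conductance (weight β w) (transProb β w)

theorem weight_pos (β : ℝ) (w : ℕ → ℕ → ℝ) (σ : Config N q) : 0 < weight β w σ := Real.exp_pos _

/-- `H(σ) + max(0, H(η) - H(σ)) = max(H(σ), H(η))`, so the Metropolis rule gives a symmetric
conductance; reversibility and all comparisons between models start from this. -/
theorem cond_eq (β : ℝ) (w : ℕ → ℕ → ℝ) {σ η : Config N q} (hne : σ ≠ η) :
    cond β w σ η = if hammingDist σ η = 1 then
      ((N : ℝ) * q)⁻¹ * Real.exp (-β * max (hamiltonian w σ) (hamiltonian w η)) else 0 := by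
  unfold cond conductance transProb offDiag weight
  rw [if_neg hne.symm]
  split_ifs
  · rw [mul_left_comm, ← Real.exp_add]
    congr 2
    rcases le_total (hamiltonian w σ) (hamiltonian w η) with h | h
    · rw [max_eq_right (by linarith), max_eq_right h]; ring
    · rw [max_eq_left (by linarith), max_eq_left h]; ring
  · exact mul_zero _

theorem reversible {β : ℝ} (hβ : 0 ≤ β) (w : ℕ → ℕ → ℝ) :
    Reversible (weight (N := N) (q := q) β w) (transProb β w) where
  pos := weight_pos β w
  nonneg := transProb_nonneg β hβ w
  sum_eq_one := sum_transProb β w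
  symm σ η := by
    rcases eq_or_ne σ η with rfl | hne
    · rfl
    have h1 := cond_eq β w hne
    have h2 := cond_eq β w hne.symm
    unfold cond conductance at h1 h2
    rw [h1, h2, hammingDist_comm, max_comm]

theorem cond_pos (β : ℝ) (w : ℕ → ℕ → ℝ) {σ η : Config N q}
    (h : hammingDist σ η = 1) : 0 < cond β w σ η := by
  have hne : σ ≠ η := by rintro rfl; simp at h
  have hN : 0 < N := by
    rcases Nat.eq_zero_or_pos N with rfl | hN
    · exact absurd (Subsingleton.elim σ η) hne
    · exact hN
  have hq : 0 < q := (Nat.zero_le _).trans_lt (σ ⟨0, hN⟩).2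
  rw [cond_eq β w hne, if_pos h]
  positivity

/-- Differing coordinates are corrected one at a time, each correction being an edge of positive
conductance. -/
theorem isConnectedNet (β : ℝ) (w : ℕ → ℕ → ℝ) :
    IsConnectedNet (cond (N := N) (q := q) β w) := by
  intro f hf σ η
  induction h : hammingDist σ η generalizing σ with
  | zero => rw [hammingDist_eq_zero.1 h]
  | succ d ih =>
    have hne : σ ≠ η := by rintro rfl; simp at h
    obtain ⟨i, hi⟩ := Function.ne_iff.1 hne
    have h1 : hammingDist σ (Function.update σ i (η i)) = 1 := by
      unfold hammingDist
      rw [Finset.card_eq_one]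
      refine ⟨i, ?_⟩
      ext j
      by_cases hj : j = i
      · subst hj; simp [hi]
      · simp [hj]
    have h2 : hammingDist (Function.update σ i (η i)) η = d := by
      have : (Finset.univ.filter fun j => Function.update σ i (η i) j ≠ η j) =
          (Finset.univ.filter fun j => σ j ≠ η j).erase i := by
        ext j
        by_cases hj : j = i
        · subst hj; simp
        · simp [hj]
      unfold hammingDist at h ⊢
      rw [this, Finset.card_erase_of_mem (by simpa using hi), h]
      rfl
    rw [hf _ _ (cond_pos β w h1)]
    exact ih _ h2

theorem row_toReal (β : ℝ) (hβ : 0 ≤ β) (w : ℕ → ℕ → ℝ) :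
    (fun σ η : Config N q => (row β hβ w σ η).toReal) = transProb β w := by
  funext σ η
  exact ENNReal.toReal_ofReal (transProb_nonneg β hβ w σ η)

open Classical in
/-- The mean hitting time is the mass of the equilibrium potential divided by the capacity. -/
theorem exists_meanHit_eq {β : ℝ} (hβ : 0 ≤ β) (w : ℕ → ℕ → ℝ) {A B : Set (Config N q)}
    (hAB : Disjoint A B) (hA : A.Nonempty) (hB : B.Nonempty) :
    ∃ h, IsPotential (transProb β w) A B h ∧ 0 < dirichlet (cond β w) h h ∧
      meanHit β hβ w A B =
        ENNReal.ofReal ((∑ σ, weight β w σ * h σ) / dirichlet (cond β w) h h) := by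
  set p := row (N := N) (q := q) β hβ w with hp
  have hP : Reversible (weight β w) fun σ η : Config N q => (p σ η).toReal := by
    rw [hp, row_toReal]; exact reversible hβ w
  have hc : IsConnectedNet (conductance (weight β w) fun σ η : Config N q => (p σ η).toReal) := by
    rw [hp, row_toReal]; exact isConnectedNet β w
  obtain ⟨h, hh⟩ : ∃ h, h = fun σ => 1 - (hitBefore p A B σ).toReal := ⟨_, rfl⟩
  have hpot : IsPotential (fun σ η => (p σ η).toReal) A B h := by
    subst hh; exact (isPotential_hitBefore p hAB).one_sub hP
  have hpos := hpot.dirichlet_pos hP hc hA hB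
  have e1 := sum_escape_eq hP hAB hh
  have e2 := sum_escape_mul_hitting hP hc hAB hB hh
  have hrow := row_toReal (N := N) (q := q) β hβ w
  rw [hp, hrow] at hpot hpos e1
  refine ⟨h, hpot, hpos, ?_⟩
  set C := dirichlet (cond β w) h h with hC
  set e : Config N q → ℝ := fun σ => (avg p (hitBefore p A B) σ).toReal with he
  set Z := ∑ η : Config N q, Real.exp (-β * hamiltonian w η) with hZ
  obtain ⟨a, ha⟩ := hA
  have hZpos : 0 < Z := Finset.sum_pos (fun η _ => Real.exp_pos _) ⟨a, Finset.mem_univ a⟩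
  have hterm : ∀ σ, ENNReal.ofReal (gibbs β w σ) * escapeProb β hβ w A B σ =
      ENNReal.ofReal (weight β w σ * e σ / Z) := by
    intro σ
    have h1 : escapeProb β hβ w A B σ = ENNReal.ofReal (e σ) := by
      unfold escapeProb
      rw [he, ENNReal.ofReal_toReal]
      · exact escape_eq p A B hAB σ
      · rw [← escape_eq p A B hAB]
        have : IsProbabilityMeasure (pathLaw p (Measure.dirac σ)) := by
          unfold pathLaw; infer_instance
        exact measure_ne_top _ _
    rw [h1, ← ENNReal.ofReal_mul (by unfold gibbs; positivity)]
    congr 1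
    unfold gibbs weight
    ring
  have hnn : ∀ σ, 0 ≤ weight β w σ * e σ / Z := fun σ =>
    div_nonneg (mul_nonneg (weight_pos β w σ).le ENNReal.toReal_nonneg) hZpos.le
  have hden : (∑ η : Config N q, if η ∈ A then ENNReal.ofReal (gibbs β w η) *
      escapeProb β hβ w A B η else 0) = ENNReal.ofReal (C / Z) := by
    rw [← e1, Finset.sum_div, ENNReal.ofReal_sum_of_nonneg]
    · refine Finset.sum_congr rfl fun σ _ => ?_
      by_cases hσ : σ ∈ A
      · rw [if_pos hσ, hterm, Set.indicator_of_mem hσ]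
      · rw [if_neg hσ, Set.indicator_of_notMem hσ]; simp
    · intro σ _
      by_cases hσ : σ ∈ A
      · rw [Set.indicator_of_mem hσ]; exact hnn σ
      · rw [Set.indicator_of_notMem hσ]; simp
  -- The partition function cancels between the numerator and the denominator of the last-exit
  -- weights, so only the Boltzmann weights and the capacity remain.
  have hlast : ∀ g : Config N q → ℝ≥0∞, ∫⁻ σ, g σ ∂(lastExit β hβ w A B) =
      ∑ σ, if σ ∈ A then ENNReal.ofReal (weight β w σ * e σ / C) * g σ else 0 := by
    intro g
    unfold lastExit
    rw [lintegral_finsetSum_measure]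
    refine Finset.sum_congr rfl fun σ _ => ?_
    by_cases hσ : σ ∈ A
    · rw [if_pos hσ, if_pos hσ, hden, hterm, lintegral_smul_measure, lintegral_dirac,
        ← ENNReal.ofReal_div_of_pos (by positivity), smul_eq_mul]
      congr 2
      field_simp
    · simp [hσ]
  -- The weighted escape probabilities sum to the capacity, which is positive; normalization is
  -- needed before any statement about path laws applies.
  have hprob : IsProbabilityMeasure (lastExit β hβ w A B) := by
    constructor
    rw [← lintegral_one, hlast]
    have : ∀ σ, (if σ ∈ A then ENNReal.ofReal (weight β w σ * e σ / C) * 1 else 0) =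
        ENNReal.ofReal (weight β w σ * A.indicator e σ / C) := by
      intro σ
      by_cases hσ : σ ∈ A <;> simp [hσ]
    rw [Finset.sum_congr rfl fun σ _ => this σ, ← ENNReal.ofReal_sum_of_nonneg,
      ← Finset.sum_div, e1, div_self hpos.ne', ENNReal.ofReal_one]
    intro σ _
    refine div_nonneg (mul_nonneg (weight_pos β w σ).le ?_) hpos.le
    exact Set.indicator_nonneg (fun _ _ => ENNReal.toReal_nonneg) σ
  unfold meanHit
  rw [lintegral_returnTime, hlast, ← e2, Finset.sum_div, ENNReal.ofReal_sum_of_nonneg]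
  · refine Finset.sum_congr rfl fun σ _ => ?_
    by_cases hσ : σ ∈ A
    · rw [if_pos hσ, Set.indicator_of_mem hσ]
      have h1 : (∑' n, survive p B n σ) = ENNReal.ofReal (∑' n, survive p B n σ).toReal :=
        (ENNReal.ofReal_toReal (tsum_survive_ne_top hP hc hB (Set.disjoint_left.1 hAB hσ))).symm
      rw [h1, ← ENNReal.ofReal_mul
        (div_nonneg (mul_nonneg (weight_pos β w σ).le ENNReal.toReal_nonneg) hpos.le),
        ENNReal.toReal_ofReal ENNReal.toReal_nonneg]
      congr 1
      ring
    · simp [hσ]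
  · intro σ _
    refine div_nonneg (mul_nonneg (weight_pos β w σ).le ?_) hpos.le
    exact Set.indicator_nonneg (fun _ _ => mul_nonneg ENNReal.toReal_nonneg
      ENNReal.toReal_nonneg) σ

end Model

/-! ### Level sets of the colour counts and a Poincare inequality between them -/

section Levels

variable {N q : ℕ}

/-- The number of vertices of each colour. -/
def count (σ : Config N q) (k : Fin q) : ℕ := ∑ i, if σ i = k then 1 else 0

theorem sum_count (σ : Config N q) : ∑ k, count σ k = N := by
  unfold count
  rw [Finset.sum_comm]
  simp

/-- The configurations with prescribed numbers of vertices of each colour. -/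
def level (N : ℕ) {q : ℕ} (n : Fin q → ℕ) : Finset (Config N q) :=
  Finset.univ.filter fun σ => count σ = n

@[simp] theorem mem_level {n : Fin q → ℕ} {σ : Config N q} : σ ∈ level N n ↔ count σ = n := by
  simp [level]

theorem count_cons (k : Fin q) (σ : Config N q) :
    count (Fin.cons k σ : Config (N + 1) q) = count σ + Pi.single k 1 := by
  funext l
  unfold count
  rw [Fin.sum_univ_succ]
  simp only [Fin.cons_zero, Fin.cons_succ, Pi.add_apply]
  rw [add_comm]
  congr 1
  by_cases h : k = l
  · subst h; simp
  · simp [h, Ne.symm h]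

/-- The multinomial formula for the size of a level. -/
theorem card_level_mul_prod_factorial (N : ℕ) {q : ℕ} (n : Fin q → ℕ) (hn : ∑ k, n k = N) :
    (level N n).card * ∏ k, (n k).factorial = N.factorial := by
  induction N generalizing n with
  | zero =>
    have h0 : n = 0 := by
      funext k
      exact (Finset.sum_eq_zero_iff.1 hn) k (Finset.mem_univ k)
    have : level 0 n = Finset.univ := by
      ext σ
      simp only [mem_level, Finset.mem_univ, iff_true]
      subst h0
      funext k
      simp [count]
    rw [this]
    subst h0
    simp
  | succ N ih =>
    -- Configurations are sorted by the colour of the first vertex, which yields the multinomial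
    -- recursion.
    have h1 : (level (N + 1) n).card = ∑ k, if 1 ≤ n k then
        (level N (Function.update n k (n k - 1))).card else 0 := by
      unfold level
      rw [Finset.card_filter, ← (Fin.consEquiv fun _ : Fin (N + 1) => Fin q).sum_comp,
        Fintype.sum_prod_type]
      refine Finset.sum_congr rfl fun k _ => ?_
      change ∑ σ : Config N q, (if count (Fin.cons k σ : Config (N + 1) q) = n then 1 else 0) = _
      split_ifs with hk
      · rw [Finset.card_filter]
        refine Finset.sum_congr rfl fun σ _ => ?_
        refine if_congr ?_ rfl rfl
        rw [count_cons]
        constructor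
        · rintro rfl
          funext l
          by_cases h : l = k
          · subst h; simp
          · simp [h]
        · intro h
          rw [h]
          funext l
          by_cases h : l = k
          · subst h; simp; omega
          · simp [h]
      · refine Finset.sum_eq_zero fun σ _ => if_neg ?_
        rintro rfl
        rw [count_cons] at hk
        simp at hk
    rw [h1, Finset.sum_mul, Nat.factorial_succ, ← hn, Finset.sum_mul]
    refine Finset.sum_congr rfl fun k _ => ?_
    split_ifs with hk
    · have hs : ∑ l, Function.update n k (n k - 1) l = N := by
        rw [Finset.sum_update_of_mem (Finset.mem_univ k)]
        rw [← Finset.add_sum_erase _ _ (Finset.mem_univ k), Finset.erase_eq] at hn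
        omega
      rw [← ih _ hs, ← Finset.mul_prod_erase _ _ (Finset.mem_univ k),
        ← Finset.mul_prod_erase _ (fun l => (Function.update n k (n k - 1) l).factorial)
          (Finset.mem_univ k)]
      have h2 : ∏ l ∈ Finset.univ.erase k, (Function.update n k (n k - 1) l).factorial =
          ∏ l ∈ Finset.univ.erase k, (n l).factorial :=
        Finset.prod_congr rfl fun l hl => by rw [Function.update_of_ne (Finset.ne_of_mem_erase hl)]
      rw [h2, Function.update_self, ← Nat.mul_factorial_pred (show n k ≠ 0 by omega)]
      ring
    · have : n k = 0 := by omega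
      simp [this]

theorem card_level_pos {n : Fin q → ℕ} (hn : ∑ k, n k = N) : 0 < (level N n).card := by
  rcases Nat.eq_zero_or_pos (level N n).card with h | h
  · have := card_level_mul_prod_factorial N n hn
    rw [h, zero_mul] at this
    exact absurd this.symm N.factorial_ne_zero
  · exact h

/-- The Curie-Weiss-Potts energy on a level. -/
def levelEnergy (N : ℕ) {q : ℕ} (n : Fin q → ℕ) : ℝ :=
  -(1 / (2 * (N : ℝ))) * (∑ k, (n k : ℝ) ^ 2 - N)

/-- Ordered pairs of vertices of equal colour number `∑ n_k²`; the diagonal accounts for `N` of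
them, and the rest is twice the sum over `i < j`. -/
theorem hamiltonian_one (σ : Config N q) :
    hamiltonian (fun _ _ => 1) σ = levelEnergy N (count σ) := by
  have h1 : ∑ i : Fin N, ∑ j : Fin N, (if σ i = σ j then (1 : ℝ) else 0) =
      ∑ k, (count σ k : ℝ) ^ 2 := by
    have : ∀ i j : Fin N, (if σ i = σ j then (1 : ℝ) else 0) =
        ∑ k, (if σ i = k then (1 : ℝ) else 0) * (if σ j = k then 1 else 0) := by
      intro i j
      simp [eq_comm]
    simp_rw [this, sq]
    rw [Finset.sum_congr rfl fun i _ => Finset.sum_comm, Finset.sum_comm]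
    refine Finset.sum_congr rfl fun k _ => ?_
    unfold count
    push_cast
    rw [Finset.sum_mul_sum]
  have h2 : ∑ i : Fin N, ∑ j : Fin N, (if σ i = σ j then (1 : ℝ) else 0) =
      ∑ i : Fin N, ∑ j : Fin N, (if i < j ∧ σ i = σ j then (1 : ℝ) else 0) +
      ∑ i : Fin N, ∑ j : Fin N, (if j < i ∧ σ j = σ i then (1 : ℝ) else 0) + N := by
    have h3 : (N : ℝ) = ∑ i : Fin N, ∑ j : Fin N, if i = j then (1 : ℝ) else 0 := by simp
    rw [h3]
    simp_rw [← Finset.sum_add_distrib]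
    refine Finset.sum_congr rfl fun i _ => Finset.sum_congr rfl fun j _ => ?_
    rcases lt_trichotomy i j with h | h | h
    · simp [h, h.ne, h.not_gt]
    · subst h; simp
    · simp [h, h.ne', h.not_gt, eq_comm]
  have h4 : ∑ i : Fin N, ∑ j : Fin N, (if j < i ∧ σ j = σ i then (1 : ℝ) else 0) =
      ∑ i : Fin N, ∑ j : Fin N, (if i < j ∧ σ i = σ j then (1 : ℝ) else 0) := Finset.sum_comm
  rw [h4, h1] at h2
  unfold hamiltonian levelEnergy
  rw [h2]
  ring_nf

/-- The total Curie-Weiss-Potts weight of a level. -/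
def levelWeight (β : ℝ) (N : ℕ) {q : ℕ} (n : Fin q → ℕ) : ℝ :=
  (level N n).card * Real.exp (-β * levelEnergy N n)

theorem weight_one (β : ℝ) {n : Fin q → ℕ} {σ : Config N q} (hσ : σ ∈ level N n) :
    weight β (fun _ _ => 1) σ = Real.exp (-β * levelEnergy N n) := by
  unfold weight
  rw [hamiltonian_one, mem_level.1 hσ]

theorem sum_weight_level (β : ℝ) (n : Fin q → ℕ) :
    ∑ σ ∈ level N n, weight β (fun _ _ => 1) σ = levelWeight β N n := by
  rw [Finset.sum_congr rfl fun σ hσ => weight_one β hσ, Finset.sum_const, nsmul_eq_mul]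
  rfl

theorem levelWeight_pos (β : ℝ) {n : Fin q → ℕ} (hn : ∑ k, n k = N) : 0 < levelWeight β N n :=
  mul_pos (by exact_mod_cast card_level_pos hn) (Real.exp_pos _)

/-- Transfer of one unit from `j` to `i`. -/
def transfer (n : Fin q → ℕ) (i j : Fin q) : Fin q → ℕ := fun k =>
  if k = i then n i + 1 else if k = j then n j - 1 else n k

/-- Two colour counts differ by the transfer of one unit. -/
def Step (n n' : Fin q → ℕ) : Prop := ∃ i j, i ≠ j ∧ 1 ≤ n j ∧ n' = transfer n i j

theorem transfer_transfer {n : Fin q → ℕ} {i j : Fin q} (hij : i ≠ j) (hj : 1 ≤ n j) :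
    transfer (transfer n i j) j i = n := by
  funext k
  unfold transfer
  by_cases h1 : k = j
  · subst h1; simp [hij.symm]; omega
  · by_cases h2 : k = i
    · subst h2; simp [hij]
    · simp [h1, h2]

theorem Step.symm {n n' : Fin q → ℕ} (h : Step n n') : Step n' n := by
  obtain ⟨i, j, hij, hj, rfl⟩ := h
  exact ⟨j, i, hij.symm, by simp [transfer], (transfer_transfer hij hj).symm⟩

theorem count_update {σ : Config N q} {v : Fin N} {i j : Fin q} (hij : i ≠ j) (hv : σ v = j) :
    count (Function.update σ v i) = transfer (count σ) i j := by
  have key : ∀ (τ : Config N q) (k : Fin q),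
      count τ k = (if τ v = k then 1 else 0) + ∑ u ∈ Finset.univ.erase v,
        if τ u = k then 1 else 0 := fun τ k =>
    (Finset.add_sum_erase _ (fun u => if τ u = k then 1 else 0) (Finset.mem_univ v)).symm
  funext k
  have h1 : ∑ u ∈ Finset.univ.erase v, (if Function.update σ v i u = k then 1 else 0) =
      ∑ u ∈ Finset.univ.erase v, (if σ u = k then 1 else 0) :=
    Finset.sum_congr rfl fun u hu => by rw [Function.update_of_ne (Finset.ne_of_mem_erase hu)]
  have h2 := key (Function.update σ v i) k
  rw [h1, Function.update_self] at h2
  unfold transfer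
  by_cases hi : k = i
  · subst hi
    rw [if_pos rfl, h2, key σ k, hv, if_pos rfl, if_neg hij.symm]; ring
  · rw [if_neg hi]
    by_cases hj : k = j
    · subst hj
      rw [if_pos rfl, h2, key σ k, hv, if_pos rfl, if_neg (Ne.symm hi)]; simp
    · rw [if_neg hj, h2, key σ k, hv, if_neg (Ne.symm hi), if_neg (Ne.symm hj)]

theorem hammingDist_update {σ : Config N q} {v : Fin N} {i : Fin q} (hv : σ v ≠ i) :
    hammingDist σ (Function.update σ v i) = 1 := by
  unfold hammingDist
  rw [Finset.card_eq_one]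
  refine ⟨v, ?_⟩
  ext u
  by_cases hu : u = v
  · subst hu; simp [hv]
  · simp [hu]

/-- Configurations of a level together with a vertex of a given colour. -/
def marked (N : ℕ) {q : ℕ} (n : Fin q → ℕ) (j : Fin q) : Finset (Config N q × Fin N) :=
  Finset.univ.filter fun x => x.1 ∈ level N n ∧ x.1 x.2 = j

theorem mem_marked {n : Fin q → ℕ} {j : Fin q} {x : Config N q × Fin N} :
    x ∈ marked N n j ↔ count x.1 = n ∧ x.1 x.2 = j := by simp [marked]

/-- Every configuration of the level carries exactly `n j` marks. -/
theorem sum_marked (n : Fin q → ℕ) (j : Fin q) (g : Config N q → ℝ) :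
    ∑ x ∈ marked N n j, g x.1 = n j * ∑ σ ∈ level N n, g σ := by
  unfold marked
  rw [Finset.sum_filter, Fintype.sum_prod_type, Finset.mul_sum]
  conv_rhs => rw [level, Finset.sum_filter]
  refine Finset.sum_congr rfl fun σ _ => ?_
  by_cases hσ : count σ = n
  · simp only [mem_level, hσ, true_and, if_true]
    rw [← hσ]
    unfold count
    push_cast
    rw [Finset.sum_mul]
    refine Finset.sum_congr rfl fun v _ => ?_
    split_ifs <;> simp
  · simp [hσ]

/-- Recolouring the marked vertex from `j` to `i` is a bijection between the marked configurations
of two adjacent levels, with recolouring back as its inverse. -/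
theorem sum_marked_update (n : Fin q → ℕ) {i j : Fin q} (hij : i ≠ j) (hj : 1 ≤ n j)
    (g : Config N q → ℝ) :
    ∑ x ∈ marked N n j, g (Function.update x.1 x.2 i) =
      ∑ x ∈ marked N (transfer n i j) i, g x.1 := by
  refine Finset.sum_bij' (fun x _ => (Function.update x.1 x.2 i, x.2))
    (fun x _ => (Function.update x.1 x.2 j, x.2)) ?_ ?_ ?_ ?_ ?_
  · intro x hx
    obtain ⟨h1, h2⟩ := mem_marked.1 hx
    exact mem_marked.2 ⟨by rw [count_update hij h2, h1], by simp⟩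
  · intro x hx
    obtain ⟨h1, h2⟩ := mem_marked.1 hx
    exact mem_marked.2 ⟨by rw [count_update hij.symm h2, h1, transfer_transfer hij hj], by simp⟩
  · intro x hx
    obtain ⟨h1, h2⟩ := mem_marked.1 hx
    ext1
    · simp [← h2]
    · rfl
  · intro x hx
    obtain ⟨h1, h2⟩ := mem_marked.1 hx
    ext1
    · simp [← h2]
    · rfl
  · intro x _
    rfl

theorem card_marked (n : Fin q → ℕ) (j : Fin q) :
    ((marked N n j).card : ℝ) = n j * (level N n).card := by
  have := sum_marked (N := N) n j (fun _ => 1)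
  simpa using this

/-- Root mean square of a function over a level. -/
def levelNorm (N : ℕ) {q : ℕ} (f : Config N q → ℝ) (n : Fin q → ℕ) : ℝ :=
  √((∑ σ ∈ level N n, f σ ^ 2) / (level N n).card)

theorem sqrt_sum_sq_le {ι : Type*} (s : Finset ι) (a b : ι → ℝ) :
    √(∑ x ∈ s, a x ^ 2) ≤ √(∑ x ∈ s, b x ^ 2) + √(∑ x ∈ s, (a x - b x) ^ 2) := by
  refine Real.sqrt_le_iff.2 ⟨by positivity, ?_⟩
  have hb : 0 ≤ ∑ x ∈ s, b x ^ 2 := Finset.sum_nonneg fun _ _ => sq_nonneg _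
  have hd : 0 ≤ ∑ x ∈ s, (a x - b x) ^ 2 := Finset.sum_nonneg fun _ _ => sq_nonneg _
  have h1 := Real.sum_mul_le_sqrt_mul_sqrt s b (fun x => a x - b x)
  have h2 : ∑ x ∈ s, a x ^ 2 = ∑ x ∈ s, b x ^ 2 + 2 * ∑ x ∈ s, b x * (a x - b x) +
      ∑ x ∈ s, (a x - b x) ^ 2 := by
    rw [Finset.mul_sum, ← Finset.sum_add_distrib, ← Finset.sum_add_distrib]
    exact Finset.sum_congr rfl fun x _ => by ring
  rw [h2, add_sq, Real.sq_sqrt hb, Real.sq_sqrt hd]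
  linarith

theorem sum_transfer {n : Fin q → ℕ} {i j : Fin q} (hij : i ≠ j) (hj : 1 ≤ n j) :
    ∑ k, transfer n i j k = ∑ k, n k := by
  have hi : i ∈ Finset.univ.erase j := Finset.mem_erase.2 ⟨hij, Finset.mem_univ i⟩
  rw [← Finset.add_sum_erase _ _ (Finset.mem_univ j), ← Finset.add_sum_erase _ _ hi,
    ← Finset.add_sum_erase _ n (Finset.mem_univ j), ← Finset.add_sum_erase _ n hi]
  have : ∑ k ∈ (Finset.univ.erase j).erase i, transfer n i j k =
      ∑ k ∈ (Finset.univ.erase j).erase i, n k := Finset.sum_congr rfl fun k hk => by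
    have h1 := Finset.ne_of_mem_erase hk
    have h2 := Finset.ne_of_mem_erase (Finset.mem_of_mem_erase hk)
    simp [transfer, h1, h2]
  rw [this]
  simp [transfer, hij.symm]
  omega

/-- Distinct marked configurations give distinct edges, and all these edges have the same CWP
conductance, since energies are constant on levels. The factor `2` undoes the `1/2` in the Dirichlet
form. -/
theorem sum_marked_sq_le (β : ℝ) (n : Fin q → ℕ) {i j : Fin q} (hij : i ≠ j)
    (f : Config N q → ℝ) :
    ((N : ℝ) * q)⁻¹ *
      Real.exp (-β * max (levelEnergy N n) (levelEnergy N (transfer n i j))) *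
      ∑ x ∈ marked N n j, (f x.1 - f (Function.update x.1 x.2 i)) ^ 2 ≤
      2 * dirichlet (cond β fun _ _ => 1) f f := by
  have hc0 : ∀ σ η : Config N q, σ ≠ η → 0 ≤ cond β (fun _ _ => 1) σ η := by
    intro σ η hne
    rw [cond_eq β _ hne]
    split_ifs <;> positivity
  have h1 : ∑ x ∈ marked N n j, cond β (fun _ _ => 1) x.1 (Function.update x.1 x.2 i) *
      ((f x.1 - f (Function.update x.1 x.2 i)) * (f x.1 - f (Function.update x.1 x.2 i))) ≤
      ∑ x : Config N q × Config N q, cond β (fun _ _ => 1) x.1 x.2 *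
        ((f x.1 - f x.2) * (f x.1 - f x.2)) := by
    have hinj : Set.InjOn (fun x : Config N q × Fin N => (x.1, Function.update x.1 x.2 i))
        (marked N n j) := by
      rintro ⟨σ, v⟩ hx ⟨σ', v'⟩ hx' heq
      have h2 := (mem_marked.1 hx).2
      simp only [Prod.mk.injEq] at heq
      obtain ⟨rfl, h3⟩ := heq
      simp only [Prod.mk.injEq, true_and]
      by_contra hne
      have := congrFun h3 v
      rw [Function.update_self, Function.update_of_ne hne] at this
      exact hij (this.trans h2)
    rw [← Finset.sum_image (f := fun x : Config N q × Config N q =>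
      cond β (fun _ _ => 1) x.1 x.2 * ((f x.1 - f x.2) * (f x.1 - f x.2))) hinj]
    refine Finset.sum_le_sum_of_subset_of_nonneg (Finset.subset_univ _) fun x _ _ => ?_
    rcases eq_or_ne x.1 x.2 with h | h
    · rw [h]; simp
    · exact mul_nonneg (hc0 _ _ h) (mul_self_nonneg _)
  rw [Fintype.sum_prod_type] at h1
  unfold dirichlet
  rw [← mul_assoc, show (2 : ℝ) * (1 / 2) = 1 by norm_num, one_mul]
  refine le_trans (le_of_eq ?_) h1
  rw [Finset.mul_sum]
  refine Finset.sum_congr rfl fun x hx => ?_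
  obtain ⟨h2, h3⟩ := mem_marked.1 hx
  have h4 : x.1 x.2 ≠ i := by rw [h3]; exact hij.symm
  have h5 : x.1 ≠ Function.update x.1 x.2 i := by
    intro hc
    have := congrFun hc x.2
    rw [Function.update_self] at this
    exact h4 this
  rw [cond_eq β _ h5, if_pos (hammingDist_update h4), hamiltonian_one, hamiltonian_one,
    count_update hij h3, h2, sq]

/-- Averages over the two levels become averages over one common set of marked configurations, where
Minkowski's inequality compares them; the `ℓ²` norm of the difference is an edge sum inside the
Dirichlet form. -/
theorem levelNorm_transfer_le (β : ℝ) (n : Fin q → ℕ) {i j : Fin q} (hij : i ≠ j)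
    (hj : 1 ≤ n j) (hn : ∑ k, n k = N) (f : Config N q → ℝ) {ω : ℝ} (hω : 0 < ω)
    (h1 : ω ≤ levelWeight β N n) (h2 : ω ≤ levelWeight β N (transfer n i j)) :
    levelNorm N f n ≤ levelNorm N f (transfer n i j) +
      √(2 * (N * q) * dirichlet (cond β fun _ _ => 1) f f / ω) := by
  set E := marked N n j with hE
  have hn' : ∑ k, transfer n i j k = N := (sum_transfer hij hj).trans hn
  have c1 : 0 < ((level N n).card : ℝ) := by exact_mod_cast card_level_pos hn
  have c2 : 0 < ((level N (transfer n i j)).card : ℝ) := by exact_mod_cast card_level_pos hn'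
  have hjr : (1 : ℝ) ≤ n j := by exact_mod_cast hj
  have hir : (1 : ℝ) ≤ transfer n i j i := by simp [transfer]
  have hEc : (E.card : ℝ) = n j * (level N n).card := card_marked n j
  have hEc' : (E.card : ℝ) = transfer n i j i * (level N (transfer n i j)).card := by
    rw [← card_marked]
    have := sum_marked_update n hij hj (fun _ : Config N q => (1 : ℝ))
    simpa using this
  have hEpos : 0 < (E.card : ℝ) := by rw [hEc]; positivity
  have e1 : levelNorm N f n = √(∑ x ∈ E, f x.1 ^ 2) / √E.card := by
    unfold levelNorm
    rw [← Real.sqrt_div (Finset.sum_nonneg fun _ _ => sq_nonneg _),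
      sum_marked n j (fun σ => f σ ^ 2), hEc]
    congr 1
    field_simp
  have e2 : levelNorm N f (transfer n i j) =
      √(∑ x ∈ E, f (Function.update x.1 x.2 i) ^ 2) / √E.card := by
    unfold levelNorm
    rw [← Real.sqrt_div (Finset.sum_nonneg fun _ _ => sq_nonneg _),
      sum_marked_update n hij hj (fun σ => f σ ^ 2), sum_marked _ i (fun σ => f σ ^ 2), hEc']
    congr 1
    field_simp
  have h3 := sqrt_sum_sq_le E (fun x => f x.1) (fun x => f (Function.update x.1 x.2 i))
  have hN : 0 < (N : ℝ) := by
    have : n j ≤ N := hn ▸ Finset.single_le_sum (fun _ _ => Nat.zero_le _) (Finset.mem_univ j)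
    exact_mod_cast lt_of_lt_of_le hj this
  have hq : 0 < (q : ℝ) := by exact_mod_cast (Nat.zero_le _).trans_lt j.2
  have h4 : √(∑ x ∈ E, (f x.1 - f (Function.update x.1 x.2 i)) ^ 2) / √E.card ≤
      √(2 * (N * q) * dirichlet (cond β fun _ _ => 1) f f / ω) := by
    rw [← Real.sqrt_div (Finset.sum_nonneg fun _ _ => sq_nonneg _)]
    refine Real.sqrt_le_sqrt ?_
    have h5 := sum_marked_sq_le β n hij f
    set X := ∑ x ∈ E, (f x.1 - f (Function.update x.1 x.2 i)) ^ 2 with hX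
    set Dn := dirichlet (cond β fun _ _ => 1) f f with hD
    have hX0 : 0 ≤ X := Finset.sum_nonneg fun _ _ => sq_nonneg _
    -- The maximum selects the level of larger energy. Its cardinality is at most that of `E`, so
    -- its weight bound applies; both hypotheses on `ω` are needed because either level can be
    -- selected.
    have h6 : ω ≤ E.card *
        Real.exp (-β * max (levelEnergy N n) (levelEnergy N (transfer n i j))) := by
      rcases le_total (levelEnergy N n) (levelEnergy N (transfer n i j)) with h | h
      · rw [max_eq_right h]
        refine h2.trans (mul_le_mul_of_nonneg_right ?_ (Real.exp_pos _).le)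
        rw [hEc']
        nlinarith
      · rw [max_eq_left h]
        refine h1.trans (mul_le_mul_of_nonneg_right ?_ (Real.exp_pos _).le)
        rw [hEc]
        nlinarith
    rw [div_le_div_iff₀ hEpos hω]
    calc X * ω ≤ X * (E.card *
        Real.exp (-β * max (levelEnergy N n) (levelEnergy N (transfer n i j)))) :=
          mul_le_mul_of_nonneg_left h6 hX0
      _ = (N * q) * (((N : ℝ) * q)⁻¹ *
          Real.exp (-β * max (levelEnergy N n) (levelEnergy N (transfer n i j))) * X) *
            E.card := by field_simp
      _ ≤ (N * q) * (2 * Dn) * E.card := by gcongr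
      _ = _ := by ring
  rw [e1, e2]
  refine le_trans ?_ (add_le_add_right h4 _)
  rw [← add_div]
  exact div_le_div_of_nonneg_right h3 (Real.sqrt_nonneg _)

/-- A function that varies by at most `d` along each edge varies by at most `d` times the number
of vertices between two connected points. -/
theorem abs_sub_le_card_mul {α : Type*} (s : Finset α) (r : α → α → Prop)
    (g : α → ℝ) {d : ℝ} (hd : 0 ≤ d) (hg : ∀ a ∈ s, ∀ b ∈ s, r a b → |g a - g b| ≤ d) {x y : α}
    (h : Relation.ReflTransGen (fun a b => a ∈ s ∧ b ∈ s ∧ r a b) x y) :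
    |g x - g y| ≤ s.card * d := by
  classical
  rcases h.cases_head with rfl | ⟨z, hz, _⟩
  · simp; positivity
  let G : SimpleGraph s := SimpleGraph.fromRel fun a b => r a b
  have hwalk : ∀ {a b : s} (p : G.Walk a b), |g a - g b| ≤ p.length * d := by
    intro a b p
    induction p with
    | nil => simp
    | @cons u v w hadj p ih =>
      have h1 : |g u - g v| ≤ d := by
        rcases hadj.2 with h | h
        · exact hg _ u.2 _ v.2 h
        · rw [abs_sub_comm]; exact hg _ v.2 _ u.2 h
      rw [SimpleGraph.Walk.length_cons]
      push_cast
      calc |g u - g w| ≤ |g u - g v| + |g v - g w| := abs_sub_le _ _ _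
        _ ≤ d + p.length * d := add_le_add h1 ih
        _ = _ := by ring
  have hreach : ∀ y, Relation.ReflTransGen (fun a b => a ∈ s ∧ b ∈ s ∧ r a b) x y →
      ∃ hy : y ∈ s, G.Reachable ⟨x, hz.1⟩ ⟨y, hy⟩ := by
    intro y hy
    induction hy with
    | refl => exact ⟨hz.1, SimpleGraph.Reachable.refl _⟩
    | @tail b c _ hbc ih =>
      obtain ⟨hb, ih⟩ := ih
      refine ⟨hbc.2.1, ?_⟩
      by_cases hbc' : b = c
      · subst hbc'; exact ih
      · exact ih.trans (SimpleGraph.Adj.reachable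
          ⟨fun hc => hbc' (congrArg Subtype.val hc), Or.inl hbc.2.2⟩)
  obtain ⟨hy, ⟨p⟩⟩ := hreach y h
  -- Removing repetitions from the walk bounds its length by the number of vertices.
  have h1 := hwalk p.toPath.1
  have h2 := p.toPath.2.length_lt
  rw [Fintype.card_coe] at h2
  refine h1.trans (mul_le_mul_of_nonneg_right ?_ hd)
  exact_mod_cast h2.le

/-- Poincare type bound along a path of levels, for functions vanishing on the last level. -/
theorem sum_level_sq_le {β : ℝ} (hβ : 0 ≤ β) (s : Finset (Fin q → ℕ))
    (hs : ∀ n ∈ s, ∑ k, n k = N) {ω : ℝ} (hω : 0 < ω) (hsω : ∀ n ∈ s, ω ≤ levelWeight β N n)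
    {n t : Fin q → ℕ} (hn : ∑ k, n k = N)
    (hpath : Relation.ReflTransGen (fun a b => a ∈ s ∧ b ∈ s ∧ Step a b) n t)
    (f : Config N q → ℝ) (hf : ∀ σ ∈ level N t, f σ = 0) :
    ∑ σ ∈ level N n, weight β (fun _ _ => 1) σ * f σ ^ 2 ≤
      levelWeight β N n * ((s.card : ℝ) ^ 2 *
        (2 * (N * q) * dirichlet (cond β fun _ _ => 1) f f / ω)) := by
  set Dn := 2 * (N * q) * dirichlet (cond β fun _ _ => 1) f f / ω with hDn
  have hD0 : 0 ≤ Dn := by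
    have := dirichlet_nonneg (cond β fun _ _ => 1)
      (reversible (N := N) (q := q) hβ fun _ _ => 1).conductance_nonneg f
    positivity
  have h1 := abs_sub_le_card_mul s Step (levelNorm N f) (Real.sqrt_nonneg Dn) (by
    intro a ha b hb hab
    have key : ∀ a ∈ s, ∀ b ∈ s, Step a b → levelNorm N f a ≤ levelNorm N f b + √Dn := by
      rintro a ha b hb ⟨i, j, hij, hj, rfl⟩
      exact levelNorm_transfer_le β a hij hj (hs a ha) f hω (hsω a ha) (hsω _ hb)
    rw [abs_le]
    constructor
    · linarith [key b hb a ha hab.symm]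
    · linarith [key a ha b hb hab]) hpath
  have h2 : levelNorm N f t = 0 := by
    unfold levelNorm
    rw [Finset.sum_eq_zero fun σ hσ => by rw [hf σ hσ]; ring]
    simp
  rw [h2, sub_zero, abs_of_nonneg (show 0 ≤ levelNorm N f n from Real.sqrt_nonneg _)] at h1
  have h3 := pow_le_pow_left₀ (show 0 ≤ levelNorm N f n from Real.sqrt_nonneg _) h1 2
  unfold levelNorm at h3
  have c1 : 0 < ((level N n).card : ℝ) := by exact_mod_cast card_level_pos hn
  rw [Real.sq_sqrt (div_nonneg (Finset.sum_nonneg fun _ _ => sq_nonneg _) c1.le), mul_pow,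
    Real.sq_sqrt hD0, div_le_iff₀ c1] at h3
  rw [Finset.sum_congr rfl fun σ hσ => by rw [weight_one β hσ], ← Finset.mul_sum]
  unfold levelWeight
  calc _ ≤ Real.exp (-β * levelEnergy N n) * ((s.card : ℝ) ^ 2 * Dn * (level N n).card) :=
        mul_le_mul_of_nonneg_left h3 (Real.exp_pos _).le
    _ = _ := by ring

end Levels

/-! ### Exponential size of level weights -/

section LevelAsymptotics

variable {N q : ℕ}

/-- A single term of the exponential series: `n^n / n! ≤ e^n`. -/
theorem log_factorial_ge (n : ℕ) : n * Real.log n - n ≤ Real.log n.factorial := by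
  rcases Nat.eq_zero_or_pos n with rfl | hn
  · simp
  have h := Real.pow_div_factorial_le_exp (n : ℝ) (Nat.cast_nonneg' n) n
  have hf : (0 : ℝ) < n.factorial := by exact_mod_cast n.factorial_pos
  have hn' : (0 : ℝ) < n := by exact_mod_cast hn
  have h2 := Real.log_le_log (by positivity) h
  rw [Real.log_exp, Real.log_div (by positivity) hf.ne', Real.log_pow] at h2
  linarith

/-- The correction `2 log(n+1)` is generous enough for a plain induction: its increment, at least
`2/(n+2)`, covers the loss `1/(n+1)` in `n (log(n+1) - log n) ≥ 1 - 1/(n+1)`. -/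
theorem log_factorial_le (n : ℕ) :
    Real.log n.factorial ≤ n * Real.log n - n + 2 * Real.log (n + 1) := by
  induction n with
  | zero => simp
  | succ n ih =>
    rw [Nat.factorial_succ]
    push_cast
    have hf : (0 : ℝ) < n.factorial := by exact_mod_cast n.factorial_pos
    rw [Real.log_mul (by positivity) hf.ne']
    have h1 : Real.log ((n : ℝ) + 1) - Real.log (n + 1 + 1) ≤ -(1 / (n + 2)) := by
      rw [← Real.log_div (by positivity) (by positivity)]
      refine (Real.log_le_sub_one_of_pos (by positivity)).trans (le_of_eq ?_)
      field_simp
      ring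
    have h2 : 1 - 1 / ((n : ℝ) + 1) ≤ n * (Real.log (n + 1) - Real.log n) := by
      rcases Nat.eq_zero_or_pos n with rfl | hn
      · simp
      have hn' : (0 : ℝ) < n := by exact_mod_cast hn
      have h3 : Real.log (n / (n + 1)) ≤ n / (n + 1) - 1 :=
        Real.log_le_sub_one_of_pos (by positivity)
      rw [Real.log_div hn'.ne' (by positivity)] at h3
      have h4 : 1 / ((n : ℝ) + 1) ≤ Real.log (n + 1) - Real.log n := by
        have : (n : ℝ) / (n + 1) - 1 = -(1 / (n + 1)) := by field_simp; ring
        linarith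
      calc 1 - 1 / ((n : ℝ) + 1) = n * (1 / (n + 1)) := by field_simp; ring
        _ ≤ _ := mul_le_mul_of_nonneg_left h4 hn'.le
    have h3 : 1 / ((n : ℝ) + 1) ≤ 2 * (1 / (n + 2)) := by
      rw [mul_one_div, div_le_div_iff₀ (by positivity) (by positivity)]
      linarith [(Nat.cast_nonneg' n : (0 : ℝ) ≤ n)]
    nlinarith

/-- The colour frequencies of a level. -/
def freq (N : ℕ) {q : ℕ} (n : Fin q → ℕ) : Fin q → ℝ := fun k => (n k : ℝ) / N

/-- The admissible colour counts. -/
def lattice (N q : ℕ) : Finset (Fin q → ℕ) := Finset.piAntidiag Finset.univ N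

@[simp] theorem mem_lattice {n : Fin q → ℕ} : n ∈ lattice N q ↔ ∑ k, n k = N := by
  simp [lattice, Finset.mem_piAntidiag]

theorem le_of_mem_lattice {n : Fin q → ℕ} (hn : n ∈ lattice N q) (k : Fin q) : n k ≤ N :=
  (mem_lattice.1 hn) ▸ Finset.single_le_sum (fun _ _ => Nat.zero_le _) (Finset.mem_univ k)

theorem card_lattice_le (N q : ℕ) : (lattice N q).card ≤ (N + 1) ^ q := by
  have : lattice N q ⊆ Fintype.piFinset fun _ => Finset.range (N + 1) := by
    intro n hn
    rw [Fintype.mem_piFinset]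
    intro k
    exact Finset.mem_range.2 (Nat.lt_succ_of_le (le_of_mem_lattice hn k))
  refine (Finset.card_le_card this).trans ?_
  simp

theorem freq_mem_stdSimplex (hN : 0 < N) {n : Fin q → ℕ} (hn : n ∈ lattice N q) :
    freq N n ∈ stdSimplex ℝ (Fin q) := by
  refine ⟨fun k => by unfold freq; positivity, ?_⟩
  unfold freq
  rw [← Finset.sum_div]
  have : (∑ k, (n k : ℝ)) = N := by exact_mod_cast mem_lattice.1 hn
  rw [this]
  have : (N : ℝ) ≠ 0 := by exact_mod_cast hN.ne'
  field_simp

/-- In the multinomial coefficient the linear terms of Stirling's formula cancel because `∑ n_k =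
N`, leaving the entropy; `β/2` is the contribution of the diagonal to the energy. -/
theorem log_levelWeight (β : ℝ) (hβ : 0 < β) (hN : 0 < N) {n : Fin q → ℕ}
    (hn : n ∈ lattice N q) :
    |Real.log (levelWeight β N n) + β * N * freeEnergy β (freq N n)| ≤
      2 * (q + 1) * Real.log (N + 1) + β / 2 := by
  have hs := mem_lattice.1 hn
  have hsr : (∑ k, (n k : ℝ)) = N := by exact_mod_cast hs
  have hNr : (0 : ℝ) < N := by exact_mod_cast hN
  have c1 : 0 < ((level N n).card : ℝ) := by exact_mod_cast card_level_pos hs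
  have hcard := card_level_mul_prod_factorial N n hs
  have hlog : Real.log (level N n).card =
      Real.log N.factorial - ∑ k, Real.log (n k).factorial := by
    have : ((level N n).card : ℝ) * ∏ k, ((n k).factorial : ℝ) = N.factorial := by
      exact_mod_cast hcard
    have hp : ∀ k ∈ Finset.univ, ((n k).factorial : ℝ) ≠ 0 := fun k _ => by
      exact_mod_cast (n k).factorial_ne_zero
    rw [← this, Real.log_mul c1.ne' (Finset.prod_ne_zero_iff.2 hp), Real.log_prod hp]
    ring
  have hent : N * ∑ k, freq N n k * Real.log (freq N n k) =
      ∑ k, (n k : ℝ) * Real.log (n k) - N * Real.log N := by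
    have h0 : (N : ℝ) * Real.log N = ∑ k, (n k : ℝ) * Real.log N := by rw [← Finset.sum_mul, hsr]
    rw [h0, ← Finset.sum_sub_distrib, Finset.mul_sum]
    refine Finset.sum_congr rfl fun k _ => ?_
    unfold freq
    rcases Nat.eq_zero_or_pos (n k) with h | h
    · simp [h]
    · have : (0 : ℝ) < n k := by exact_mod_cast h
      rw [Real.log_div this.ne' hNr.ne']
      field_simp
  have hE : -β * levelEnergy N n = β * N / 2 * ∑ k, freq N n k ^ 2 - β / 2 := by
    unfold levelEnergy freq
    simp_rw [div_pow]
    rw [← Finset.sum_div]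
    field_simp
  have hW : Real.log (levelWeight β N n) = Real.log (level N n).card + -β * levelEnergy N n := by
    unfold levelWeight
    rw [Real.log_mul c1.ne' (Real.exp_pos _).ne', Real.log_exp]
  have hF : β * N * freeEnergy β (freq N n) = -(β * N / 2 * ∑ k, freq N n k ^ 2) +
      N * ∑ k, freq N n k * Real.log (freq N n k) := by
    unfold freeEnergy
    field_simp
  rw [hW, hF, hE, hlog, hent]
  have l1 := log_factorial_ge N
  have l2 := log_factorial_le N
  have l3 : ∑ k, ((n k : ℝ) * Real.log (n k) - n k) ≤ ∑ k, Real.log (n k).factorial :=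
    Finset.sum_le_sum fun k _ => log_factorial_ge (n k)
  have l4 : ∑ k, Real.log (n k).factorial ≤
      ∑ k, ((n k : ℝ) * Real.log (n k) - n k + 2 * Real.log (N + 1)) :=
    Finset.sum_le_sum fun k _ => (log_factorial_le (n k)).trans <| by
      have : (n k : ℝ) ≤ N := by exact_mod_cast le_of_mem_lattice hn k
      gcongr
  rw [Finset.sum_sub_distrib, hsr] at l3
  rw [Finset.sum_add_distrib, Finset.sum_sub_distrib, hsr] at l4
  simp only [Finset.sum_const, Finset.card_univ, Fintype.card_fin, nsmul_eq_mul] at l4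
  have l5 : 0 ≤ Real.log ((N : ℝ) + 1) := Real.log_nonneg (by linarith)
  have l6 : 0 ≤ (q : ℝ) * Real.log ((N : ℝ) + 1) := by positivity
  rw [abs_le]
  constructor <;> nlinarith

theorem eventually_log_le (a b κ : ℝ) (hκ : 0 < κ) :
    ∀ᶠ N : ℕ in Filter.atTop, a * Real.log (N + 1) + b ≤ κ * N := by
  have h1 : Filter.Tendsto (fun N : ℕ => (a * Real.log ((N : ℝ) + 1) + b) / N)
      Filter.atTop (nhds 0) := by
    have h2 : Filter.Tendsto (fun x : ℝ => Real.log x / x) Filter.atTop (nhds 0) := by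
      have := Real.isLittleO_log_id_atTop.tendsto_div_nhds_zero
      simpa using this
    have h3 : Filter.Tendsto (fun N : ℕ => ((N : ℝ) + 1)) Filter.atTop Filter.atTop :=
      Filter.tendsto_atTop_add_const_right _ _ tendsto_natCast_atTop_atTop
    have h4 := h2.comp h3
    have h5 : Filter.Tendsto (fun N : ℕ => ((N : ℝ) + 1) / N) Filter.atTop (nhds 1) := by
      have h6 : Filter.Tendsto (fun N : ℕ => 1 + (1 : ℝ) / N) Filter.atTop (nhds (1 + 0)) :=
        (tendsto_const_nhds).add tendsto_one_div_atTop_nhds_zero_nat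
      rw [add_zero] at h6
      refine h6.congr' ?_
      filter_upwards [Filter.eventually_gt_atTop 0] with N hN
      have : (N : ℝ) ≠ 0 := by exact_mod_cast hN.ne'
      field_simp
    have h7 := ((h4.mul h5).const_mul a).add (tendsto_const_div_atTop_nhds_zero_nat b)
    simp only [zero_mul, mul_zero, add_zero] at h7
    refine h7.congr' ?_
    filter_upwards [Filter.eventually_gt_atTop 0] with N hN
    have : (N : ℝ) ≠ 0 := by exact_mod_cast hN.ne'
    simp only [Function.comp]
    field_simp
  filter_upwards [h1.eventually (gt_mem_nhds hκ), Filter.eventually_gt_atTop 0] with N h hN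
  have : (0 : ℝ) < N := by exact_mod_cast hN
  rw [div_lt_iff₀ this] at h
  exact h.le

/-- The weight of a level is `exp (-β N F)` up to a subexponential factor. -/
theorem eventually_levelWeight_bounds (q : ℕ) {β : ℝ} (hβ : 0 < β) {κ : ℝ} (hκ : 0 < κ) :
    ∀ᶠ N : ℕ in Filter.atTop, ∀ n ∈ lattice N q,
      Real.exp (-(β * N * freeEnergy β (freq N n)) - κ * N) ≤ levelWeight β N n ∧
        levelWeight β N n ≤ Real.exp (-(β * N * freeEnergy β (freq N n)) + κ * N) := by
  filter_upwards [eventually_log_le (2 * (q + 1)) (β / 2) κ hκ, Filter.eventually_gt_atTop 0]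
    with N h hN n hn
  have h1 := abs_le.1 (log_levelWeight β hβ hN hn)
  have hpos := levelWeight_pos β (mem_lattice.1 hn)
  constructor
  · rw [← Real.le_log_iff_exp_le hpos]; linarith
  · rw [← Real.log_le_iff_le_exp hpos]; linarith

theorem eventually_pow_le_exp (a b : ℕ) {κ : ℝ} (hκ : 0 < κ) :
    ∀ᶠ N : ℕ in Filter.atTop, (a : ℝ) * ((N : ℝ) + 1) ^ b ≤ Real.exp (κ * N) := by
  rcases Nat.eq_zero_or_pos a with rfl | ha
  · exact Filter.Eventually.of_forall fun N => by simpa using (Real.exp_pos _).le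
  filter_upwards [eventually_log_le b (Real.log a) κ hκ] with N h
  have ha' : (0 : ℝ) < a := by exact_mod_cast ha
  have h1 : (0 : ℝ) < (N : ℝ) + 1 := by positivity
  rw [← Real.log_le_iff_le_exp (by positivity), Real.log_mul ha'.ne' (by positivity),
    Real.log_pow]
  linarith

end LevelAsymptotics

/-! ### One coordinate of the free energy -/

section SingleSite

/-- The contribution of one coordinate to the free energy. -/
def siteEnergy (β t : ℝ) : ℝ := -(1 / 2) * t ^ 2 + (1 / β) * (t * Real.log t)

/-- The derivative of `siteEnergy`. -/
def siteSlope (β t : ℝ) : ℝ := (1 / β) * (Real.log t + 1) - t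

theorem freeEnergy_eq_sum (β : ℝ) {q : ℕ} (x : Fin q → ℝ) :
    freeEnergy β x = ∑ k, siteEnergy β (x k) := by
  unfold freeEnergy siteEnergy
  rw [Finset.sum_add_distrib, Finset.mul_sum, Finset.mul_sum]

theorem continuous_siteEnergy (β : ℝ) : Continuous (siteEnergy β) := by
  unfold siteEnergy
  have := Real.continuous_mul_log
  fun_prop

theorem continuous_freeEnergy (β : ℝ) (q : ℕ) :
    Continuous (freeEnergy β : (Fin q → ℝ) → ℝ) := by
  have : (freeEnergy β : (Fin q → ℝ) → ℝ) = fun x => ∑ k, siteEnergy β (x k) :=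
    funext (freeEnergy_eq_sum β)
  rw [this]
  have := continuous_siteEnergy β
  fun_prop

theorem hasDerivAt_siteEnergy (β : ℝ) {t : ℝ} (ht : 0 < t) :
    HasDerivAt (siteEnergy β) (siteSlope β t) t := by
  have h1 := ((hasDerivAt_pow 2 t).const_mul (-(1 / 2 : ℝ))).add
    ((Real.hasDerivAt_mul_log ht.ne').const_mul (1 / β))
  convert! h1 using 1
  unfold siteSlope
  push_cast
  ring

theorem exists_siteSlope_eq (β : ℝ) {a b : ℝ} (ha : 0 ≤ a) (hab : a < b) :
    ∃ ξ ∈ Set.Ioo a b, siteEnergy β b - siteEnergy β a = siteSlope β ξ * (b - a) := by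
  obtain ⟨ξ, hξ, h⟩ := exists_hasDerivAt_eq_slope (siteEnergy β) (siteSlope β) hab
    (continuous_siteEnergy β).continuousOn
    fun x hx => hasDerivAt_siteEnergy β (lt_of_le_of_lt ha hx.1)
  refine ⟨ξ, hξ, ?_⟩
  rw [h, div_mul_cancel₀ _ (sub_ne_zero.2 hab.ne')]

theorem hasDerivAt_siteSlope (β : ℝ) {t : ℝ} (ht : 0 < t) :
    HasDerivAt (siteSlope β) ((1 / β) * t⁻¹ - 1) t :=
  (((Real.hasDerivAt_log ht.ne').add_const 1).const_mul (1 / β)).sub (hasDerivAt_id t)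

/-- The slope increases up to `1/β` and decreases afterwards, so a given slope is attained at most
twice, once on each side of `1/β`. The classification of critical points and the wall estimate both
rest on this. -/
theorem siteSlope_strictMonoOn (β : ℝ) :
    StrictMonoOn (siteSlope β) (Set.Ioc 0 (1 / β)) := by
  refine strictMonoOn_of_deriv_pos (convex_Ioc _ _)
    (fun t ht => (hasDerivAt_siteSlope β ht.1).continuousAt.continuousWithinAt) ?_
  intro t ht
  rw [interior_Ioc] at ht
  rw [(hasDerivAt_siteSlope β ht.1).deriv, sub_pos]
  have := ht.2
  rw [← div_eq_mul_inv, one_lt_div ht.1]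
  exact this

theorem siteSlope_strictAntiOn {β : ℝ} (hβ : 0 < β) :
    StrictAntiOn (siteSlope β) (Set.Ici (1 / β)) := by
  have hb : 0 < 1 / β := by positivity
  refine strictAntiOn_of_deriv_neg (convex_Ici _)
    (fun t ht => (hasDerivAt_siteSlope β (hb.trans_le ht)).continuousAt.continuousWithinAt) ?_
  intro t ht
  rw [interior_Ici] at ht
  have ht0 : 0 < t := hb.trans ht
  rw [(hasDerivAt_siteSlope β ht0).deriv, sub_neg, ← div_eq_mul_inv, div_lt_one ht0]
  exact ht

/-- Moving mass `t` from `j` to `i`. -/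
def shift {q : ℕ} (x : Fin q → ℝ) (i j : Fin q) (t : ℝ) : Fin q → ℝ := fun k =>
  if k = i then x i + t else if k = j then x j - t else x k

theorem sum_shift {q : ℕ} (φ : ℝ → ℝ) (x : Fin q → ℝ) {i j : Fin q} (hij : i ≠ j) (t : ℝ) :
    ∑ k, φ (shift x i j t k) =
      ∑ k, φ (x k) + (φ (x i + t) - φ (x i)) + (φ (x j - t) - φ (x j)) := by
  have hi : i ∈ Finset.univ.erase j := Finset.mem_erase.2 ⟨hij, Finset.mem_univ i⟩
  rw [← Finset.add_sum_erase _ _ (Finset.mem_univ j), ← Finset.add_sum_erase _ _ hi,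
    ← Finset.add_sum_erase _ (fun k => φ (x k)) (Finset.mem_univ j),
    ← Finset.add_sum_erase _ (fun k => φ (x k)) hi]
  have : ∑ k ∈ (Finset.univ.erase j).erase i, φ (shift x i j t k) =
      ∑ k ∈ (Finset.univ.erase j).erase i, φ (x k) := Finset.sum_congr rfl fun k hk => by
    have h1 := Finset.ne_of_mem_erase hk
    have h2 := Finset.ne_of_mem_erase (Finset.mem_of_mem_erase hk)
    simp [shift, h1, h2]
  rw [this]
  simp [shift, hij.symm]
  ring

end SingleSite

/-! ### The free energy along the rays through the uniform point -/

section Ray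

/-- The points with one distinguished coordinate. -/
def ray (q : ℕ) (k : Fin q) (s : ℝ) : Fin q → ℝ := fun l =>
  if l = k then (1 + ((q : ℝ) - 1) * s) / q else (1 - s) / q

/-- The derivative of the free energy along the rays, up to a positive factor. -/
def raySlope (β : ℝ) (q : ℕ) (s : ℝ) : ℝ :=
  Real.log (1 + ((q : ℝ) - 1) * s) - Real.log (1 - s) - β * s

/-- The free energy along the rays. -/
def rayEnergy (β : ℝ) (q : ℕ) (s : ℝ) : ℝ :=
  siteEnergy β ((1 + ((q : ℝ) - 1) * s) / q) + ((q : ℝ) - 1) * siteEnergy β ((1 - s) / q)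

variable {q : ℕ}

theorem ray_zero (k : Fin q) : ray q k 0 = uniformPoint q := by
  funext l
  simp [ray, uniformPoint]

theorem minPoint_some (β : ℝ) (k : Fin q) : minPoint β q (some k) = ray q k (largestSol β q) := rfl

theorem sum_ray (φ : ℝ → ℝ) (k : Fin q) (s : ℝ) :
    ∑ l, φ (ray q k s l) =
      φ ((1 + ((q : ℝ) - 1) * s) / q) + ((q : ℝ) - 1) * φ ((1 - s) / q) := by
  rw [← Finset.add_sum_erase _ _ (Finset.mem_univ k)]
  have : ∑ l ∈ Finset.univ.erase k, φ (ray q k s l) =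
      ∑ l ∈ Finset.univ.erase k, φ ((1 - s) / q) := Finset.sum_congr rfl fun l hl => by
    simp [ray, Finset.ne_of_mem_erase hl]
  rw [this, Finset.sum_const, Finset.card_erase_of_mem (Finset.mem_univ k), nsmul_eq_mul,
    Finset.card_univ, Fintype.card_fin, Nat.cast_sub (Nat.succ_le_of_lt (by
      exact (Nat.zero_le _).trans_lt k.2))]
  simp [ray]

theorem freeEnergy_ray (β : ℝ) (k : Fin q) (s : ℝ) :
    freeEnergy β (ray q k s) = rayEnergy β q s := by
  rw [freeEnergy_eq_sum, sum_ray]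
  rfl

theorem ray_mem_stdSimplex (k : Fin q) {s : ℝ} (h0 : 0 ≤ s) (h1 : s ≤ 1) :
    ray q k s ∈ stdSimplex ℝ (Fin q) := by
  have hq : (1 : ℝ) ≤ q := by exact_mod_cast (Nat.zero_le _).trans_lt k.2
  refine ⟨fun l => ?_, ?_⟩
  · unfold ray
    split_ifs
    · have : 0 ≤ ((q : ℝ) - 1) * s := mul_nonneg (by linarith) h0
      positivity
    · exact div_nonneg (by linarith) (by linarith)
  · have := sum_ray (q := q) id k s
    simp only [id] at this
    rw [this]
    field_simp
    ring

theorem one_add_pos (hq : 2 ≤ q) {s : ℝ} (h0 : 0 ≤ s) : 0 < 1 + ((q : ℝ) - 1) * s := by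
  have hq' : (2 : ℝ) ≤ q := by exact_mod_cast hq
  have : 0 ≤ ((q : ℝ) - 1) * s := mul_nonneg (by linarith) h0
  linarith

theorem siteSlope_sub_eq {β : ℝ} (hβ : 0 < β) (hq : 2 ≤ q) {s : ℝ} (h0 : 0 ≤ s) (h1 : s < 1) :
    siteSlope β ((1 + ((q : ℝ) - 1) * s) / q) - siteSlope β ((1 - s) / q) =
      (1 / β) * raySlope β q s := by
  have hq' : (0 : ℝ) < q := by exact_mod_cast (by omega : 0 < q)
  unfold siteSlope raySlope
  rw [Real.log_div (one_add_pos hq h0).ne' hq'.ne', Real.log_div (by linarith) hq'.ne']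
  field_simp
  ring

theorem hasDerivAt_rayEnergy {β : ℝ} (hβ : 0 < β) (hq : 2 ≤ q) {s : ℝ} (h0 : 0 ≤ s)
    (h1 : s < 1) :
    HasDerivAt (rayEnergy β q) (((q : ℝ) - 1) / (q * β) * raySlope β q s) s := by
  have hq' : (0 : ℝ) < q := by exact_mod_cast (by omega : 0 < q)
  have hp := one_add_pos hq h0
  have e1 : HasDerivAt (fun s : ℝ => (1 + ((q : ℝ) - 1) * s) / q) (((q : ℝ) - 1) / q) s := by
    have := (((hasDerivAt_id s).const_mul ((q : ℝ) - 1)).const_add 1).div_const (q : ℝ)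
    simpa using this
  have e2 : HasDerivAt (fun s : ℝ => (1 - s) / q) (-1 / (q : ℝ)) s :=
    ((hasDerivAt_id s).const_sub 1).div_const (q : ℝ)
  have d1 := (hasDerivAt_siteEnergy β (t := (1 + ((q : ℝ) - 1) * s) / q) (by positivity)).comp s e1
  have d2 := (hasDerivAt_siteEnergy β (t := (1 - s) / q)
    (div_pos (by linarith) hq')).comp s e2
  have := d1.add (d2.const_mul ((q : ℝ) - 1))
  refine this.congr_deriv ?_
  have h2 := siteSlope_sub_eq hβ hq h0 h1
  calc _ = ((q : ℝ) - 1) / q * (siteSlope β ((1 + ((q : ℝ) - 1) * s) / q) -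
        siteSlope β ((1 - s) / q)) := by ring
    _ = _ := by rw [h2]; field_simp

theorem hasDerivAt_raySlope (β : ℝ) (hq : 2 ≤ q) {s : ℝ} (h0 : 0 ≤ s) (h1 : s < 1) :
    HasDerivAt (raySlope β q) (q / ((1 + ((q : ℝ) - 1) * s) * (1 - s)) - β) s := by
  have hp := one_add_pos hq h0
  have hm : 0 < 1 - s := by linarith
  have e1 : HasDerivAt (fun s : ℝ => 1 + ((q : ℝ) - 1) * s) ((q : ℝ) - 1) s := by
    simpa using ((hasDerivAt_id s).const_mul ((q : ℝ) - 1)).const_add 1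
  have e2 : HasDerivAt (fun s : ℝ => 1 - s) (-1) s := (hasDerivAt_id s).const_sub 1
  have e3 : HasDerivAt (fun s : ℝ => β * s) β s := by
    simpa using (hasDerivAt_id s).const_mul β
  refine (((e1.log hp.ne').sub (e2.log hm.ne')).sub e3).congr_deriv ?_
  field_simp
  ring

theorem continuousOn_raySlope (β : ℝ) (hq : 2 ≤ q) : ContinuousOn (raySlope β q) (Set.Ico 0 1) :=
  fun _ hs => (hasDerivAt_raySlope β hq hs.1 hs.2).continuousAt.continuousWithinAt

theorem raySlope_zero (β : ℝ) : raySlope β q 0 = 0 := by simp [raySlope]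

/-- Monotonicity pattern of `raySlope` on `[0, 1)`. -/
theorem exists_raySlope_turning {β : ℝ} (hβ : 0 < β) (hq : 2 ≤ q) {s₀ : ℝ} (h0 : 0 < s₀)
    (h1 : s₀ < 1) (hs : raySlope β q s₀ < 0) :
    ∃ u₁ u₂ : ℝ, u₁ < u₂ ∧ 0 < u₂ ∧ u₂ < 1 ∧
      StrictMonoOn (raySlope β q) (Set.Icc 0 u₁) ∧
      StrictAntiOn (raySlope β q) (Set.Icc (max 0 u₁) u₂) ∧
      StrictMonoOn (raySlope β q) (Set.Ico u₂ 1) := by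
  have hq' : (2 : ℝ) ≤ q := by exact_mod_cast hq
  -- The slope goes from zero to a negative value, so its derivative is negative somewhere; this
  -- makes the quadratic below exceed `q / β`.
  obtain ⟨s', hs', hd⟩ := exists_hasDerivAt_eq_slope (raySlope β q)
    (fun s => q / ((1 + ((q : ℝ) - 1) * s) * (1 - s)) - β) h0
    ((continuousOn_raySlope β hq).mono fun x hx => ⟨hx.1, lt_of_le_of_lt hx.2 h1⟩)
    fun x hx => hasDerivAt_raySlope β hq hx.1.le (hx.2.trans h1)
  rw [raySlope_zero, sub_zero, sub_zero] at hd
  have hneg : q / ((1 + ((q : ℝ) - 1) * s') * (1 - s')) - β < 0 := by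
    rw [hd]; exact div_neg_of_neg_of_pos hs h0
  -- The derivative of the slope is negative exactly where the concave quadratic `p` exceeds `q /
  -- β`. The root `u₂` lies in `(0, 1)` because `p 1 = 0`, and `u₁` is its mirror image about the
  -- vertex of `p`; it may be negative.
  set p : ℝ → ℝ := fun s => (1 + ((q : ℝ) - 1) * s) * (1 - s) with hp
  have hppos : ∀ s, 0 ≤ s → s < 1 → 0 < p s := fun s h h' =>
    mul_pos (one_add_pos hq h) (by linarith)
  have hps' : q / β < p s' := by
    have h2 := hppos s' hs'.1.le (hs'.2.trans h1)
    rw [sub_neg, div_lt_iff₀ h2] at hneg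
    rw [div_lt_iff₀ hβ]
    linarith
  have hpc : Continuous p := by fun_prop
  have hq0 : 0 < (q : ℝ) / β := by positivity
  obtain ⟨u₂, hu₂, hpu⟩ := intermediate_value_Ioo' (hs'.2.trans h1).le hpc.continuousOn
    (show (q : ℝ) / β ∈ Set.Ioo (p 1) (p s') by simp [hp]; exact ⟨hq0, hps'⟩)
  have hu0 : 0 < u₂ := hs'.1.trans hu₂.1
  have hfac : ∀ s, p s - q / β =
      ((q : ℝ) - 1) * ((u₂ - s) * (s - (((q : ℝ) - 2) / (q - 1) - u₂))) := by
    intro s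
    rw [← hpu]
    have : ((q : ℝ) - 1) ≠ 0 := by linarith
    simp only [hp]
    field_simp
    ring
  set u₁ := ((q : ℝ) - 2) / (q - 1) - u₂ with hu₁
  have h12 : u₁ < s' := by
    have h3 := hfac s'
    have h4 : 0 < ((q : ℝ) - 1) * ((u₂ - s') * (s' - u₁)) := by rw [← h3]; linarith
    have h5 := pos_of_mul_pos_right h4 (by linarith)
    have h6 := pos_of_mul_pos_right h5 (by linarith [hu₂.1])
    linarith
  have hderiv : ∀ s, 0 ≤ s → s < 1 → deriv (raySlope β q) s = -(β / p s) * (p s - q / β) := by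
    intro s h h'
    rw [(hasDerivAt_raySlope β hq h h').deriv]
    have := (hppos s h h').ne'
    change (q : ℝ) / p s - β = _
    field_simp
    ring
  have hcont := continuousOn_raySlope β hq
  refine ⟨u₁, u₂, h12.trans hu₂.1, hu0, hu₂.2, ?_, ?_, ?_⟩
  · refine strictMonoOn_of_deriv_pos (convex_Icc _ _) (hcont.mono fun x hx =>
      ⟨hx.1, by linarith [hx.2, hu₂.1, hu₂.2]⟩) fun s hs => ?_
    rw [interior_Icc] at hs
    have hlt : s < 1 := by linarith [hs.2, hu₂.1, hu₂.2]
    rw [hderiv s hs.1.le hlt, hfac]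
    have := hppos s hs.1.le hlt
    have h7 : (u₂ - s) * (s - u₁) < 0 := mul_neg_of_pos_of_neg (by linarith [hs.2, hu₂.1])
      (by linarith [hs.2])
    have h8 : ((q : ℝ) - 1) * ((u₂ - s) * (s - u₁)) < 0 := mul_neg_of_pos_of_neg (by linarith) h7
    have h9 : 0 < β / p s := by positivity
    nlinarith
  · refine strictAntiOn_of_deriv_neg (convex_Icc _ _) (hcont.mono fun x hx =>
      ⟨(le_max_left _ _).trans hx.1, lt_of_le_of_lt hx.2 hu₂.2⟩) fun s hs => ?_
    rw [interior_Icc] at hs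
    have hlt : s < 1 := hs.2.trans hu₂.2
    have hge : 0 < s := lt_of_le_of_lt (le_max_left _ _) hs.1
    have hgu : u₁ < s := lt_of_le_of_lt (le_max_right _ _) hs.1
    rw [hderiv s hge.le hlt, hfac]
    have := hppos s hge.le hlt
    have h7 : 0 < (u₂ - s) * (s - u₁) := mul_pos (by linarith [hs.2]) (by linarith)
    have h8 : 0 < ((q : ℝ) - 1) * ((u₂ - s) * (s - u₁)) := mul_pos (by linarith) h7
    have h9 : 0 < β / p s := by positivity
    nlinarith
  · refine strictMonoOn_of_deriv_pos (convex_Ico _ _) (hcont.mono fun x hx =>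
      ⟨hu0.le.trans hx.1, hx.2⟩) fun s hs => ?_
    rw [interior_Ico] at hs
    have hge : 0 < s := hu0.trans hs.1
    rw [hderiv s hge.le hs.2, hfac]
    have := hppos s hge.le hs.2
    have h7 : (u₂ - s) * (s - u₁) < 0 := mul_neg_of_neg_of_pos (by linarith [hs.1])
      (by linarith [hs.1, hu₂.1])
    have h8 : ((q : ℝ) - 1) * ((u₂ - s) * (s - u₁)) < 0 := mul_neg_of_pos_of_neg (by linarith) h7
    have h9 : 0 < β / p s := by positivity
    nlinarith

/-- Near `1` the term `-log(1 - c)` is at least `β + log 2` and dominates `β c`. -/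
theorem raySlope_pos_of_close_one {β : ℝ} (hβ : 0 < β) (hq : 2 ≤ q) {c : ℝ} (h0 : 0 ≤ c)
    (h1 : c < 1) (hc : 1 - Real.exp (-β) / 2 ≤ c) : 0 < raySlope β q c := by
  have hq' : (2 : ℝ) ≤ q := by exact_mod_cast hq
  have h2 : Real.log (1 - c) ≤ -β - Real.log 2 := by
    have : 1 - c ≤ Real.exp (-β) / 2 := by linarith
    have h3 := Real.log_le_log (by linarith) this
    rwa [Real.log_div (Real.exp_pos _).ne' (by norm_num), Real.log_exp] at h3
  have h3 : 0 ≤ Real.log (1 + ((q : ℝ) - 1) * c) := Real.log_nonneg (by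
    have : 0 ≤ ((q : ℝ) - 1) * c := mul_nonneg (by linarith) h0
    linarith)
  have h4 : 0 < Real.log 2 := Real.log_pos (by norm_num)
  unfold raySlope
  nlinarith

/-- Sign pattern of `raySlope`. -/
structure RayShape (β : ℝ) (q : ℕ) (s₁ s₂ : ℝ) : Prop where
  nonneg : 0 ≤ s₁
  lt : s₁ < s₂
  lt_one : s₂ < 1
  zero₁ : raySlope β q s₁ = 0
  zero₂ : raySlope β q s₂ = 0
  pos₁ : ∀ s, 0 < s → s < s₁ → 0 < raySlope β q s
  neg : ∀ s, s₁ < s → s < s₂ → raySlope β q s < 0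
  pos₂ : ∀ s, s₂ < s → s < 1 → 0 < raySlope β q s

/-- Each monotone piece has at most one zero beyond the origin, found by the intermediate value
theorem. When the first increasing piece is absent (`u₁ ≤ 0`), the saddle parameter `s₁` degenerates
to `0`. -/
theorem exists_rayShape {β : ℝ} (hβ : 0 < β) (hq : 2 ≤ q) {s₀ : ℝ} (h0 : 0 < s₀)
    (h1 : s₀ < 1) (hs : raySlope β q s₀ < 0) :
    ∃ s₁, RayShape β q s₁ (largestSol β q) := by
  obtain ⟨u₁, u₂, h12, hu0, hu1, hm1, ha, hm2⟩ := exists_raySlope_turning hβ hq h0 h1 hs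
  have hcont := continuousOn_raySlope (q := q) β hq
  have hz := raySlope_zero (q := q) β
  have hmax : max 0 u₁ < u₂ := max_lt hu0 h12
  have hu2neg : raySlope β q u₂ < 0 := by
    rcases le_total u₂ s₀ with h | h
    · exact lt_of_le_of_lt (hm2.monotoneOn ⟨le_rfl, hu1⟩ ⟨h, h1⟩ h) hs
    · rcases le_total (max 0 u₁) s₀ with h' | h'
      · exact lt_of_le_of_lt (ha.antitoneOn ⟨h', h⟩ ⟨hmax.le, le_rfl⟩ h) hs
      · have h3 : s₀ ≤ u₁ := by
          rcases le_total 0 u₁ with h4 | h4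
          · rwa [max_eq_right h4] at h'
          · rw [max_eq_left h4] at h'; linarith
        have := hm1.monotoneOn ⟨le_rfl, h0.le.trans h3⟩ ⟨h0.le, h3⟩ h0.le
        linarith
  have hroot2 : ∃ s₂, u₂ < s₂ ∧ s₂ < 1 ∧ raySlope β q s₂ = 0 := by
    set c := max u₂ (1 - Real.exp (-β) / 2) with hc
    have he := Real.exp_pos (-β)
    have hc1 : c < 1 := max_lt hu1 (by linarith)
    have hcp : 0 < raySlope β q c := raySlope_pos_of_close_one hβ hq
      (hu0.le.trans (le_max_left _ _)) hc1 (le_max_right _ _)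
    obtain ⟨s, hs, hs'⟩ := intermediate_value_Ioo (le_max_left u₂ (1 - Real.exp (-β) / 2))
      (hcont.mono fun x hx => ⟨hu0.le.trans hx.1, lt_of_le_of_lt hx.2 hc1⟩)
      (show (0 : ℝ) ∈ Set.Ioo _ _ from ⟨hu2neg, hcp⟩)
    exact ⟨s, hs.1, hs.2.trans hc1, hs'⟩
  obtain ⟨s₂, hs2, hs21, hs2z⟩ := hroot2
  have hpos2 : ∀ s, s₂ < s → s < 1 → 0 < raySlope β q s := fun s h h' => by
    rw [← hs2z]
    exact hm2 ⟨hs2.le, hs21⟩ ⟨(hs2.trans h).le, h'⟩ h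
  have hneg2 : ∀ s, u₂ ≤ s → s < s₂ → raySlope β q s < 0 := fun s h h' => by
    rw [← hs2z]
    exact hm2 ⟨h, h'.trans hs21⟩ ⟨hs2.le, hs21⟩ h'
  have hlarge : largestSol β q = s₂ := by
    refine IsGreatest.csSup_eq ⟨⟨one_add_pos hq (hu0.trans hs2).le, hs21, ?_⟩, ?_⟩
    · unfold raySlope at hs2z; linarith
    · rintro s ⟨_, h4, h5⟩
      by_contra hcon
      have := hpos2 s (not_le.1 hcon) h4
      unfold raySlope at this
      linarith
  rw [hlarge]
  rcases le_or_gt u₁ 0 with hu | hu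
  · rw [max_eq_left hu] at ha
    refine ⟨0, le_rfl, hu0.trans hs2, hs21, hz, hs2z, fun s h h' => absurd h h'.not_gt,
      fun s h h' => ?_, hpos2⟩
    rcases le_total u₂ s with h3 | h3
    · exact hneg2 s h3 h'
    · rw [← hz]
      exact ha ⟨le_rfl, hu0.le⟩ ⟨h.le, h3⟩ h
  · rw [max_eq_right hu.le] at ha
    have hu1pos : 0 < raySlope β q u₁ := by
      rw [← hz]; exact hm1 ⟨le_rfl, hu.le⟩ ⟨hu.le, le_rfl⟩ hu
    obtain ⟨s₁, hs1, hs1z⟩ := intermediate_value_Ioo' h12.le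
      (hcont.mono fun x hx => ⟨hu.le.trans hx.1, lt_of_le_of_lt hx.2 hu1⟩)
      (show (0 : ℝ) ∈ Set.Ioo _ _ from ⟨hu2neg, hu1pos⟩)
    refine ⟨s₁, (hu.trans hs1.1).le, hs1.2.trans hs2, hs21, hs1z, hs2z, fun s h h' => ?_,
      fun s h h' => ?_, hpos2⟩
    · rcases le_total s u₁ with h3 | h3
      · rw [← hz]; exact hm1 ⟨le_rfl, hu.le⟩ ⟨h.le, h3⟩ h
      · rw [← hs1z]; exact ha ⟨h3, (h'.trans hs1.2).le⟩ ⟨hs1.1.le, hs1.2.le⟩ h'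
    · rcases le_total u₂ s with h3 | h3
      · exact hneg2 s h3 h'
      · rw [← hs1z]; exact ha ⟨hs1.1.le, hs1.2.le⟩ ⟨(hs1.1.trans h).le, h3⟩ h

variable {β s₁ s₂ : ℝ}

theorem continuous_rayEnergy (β : ℝ) (q : ℕ) : Continuous (rayEnergy β q) := by
  unfold rayEnergy
  have := continuous_siteEnergy β
  fun_prop

theorem RayShape.energy_lt (h : RayShape β q s₁ s₂) (hβ : 0 < β) (hq : 2 ≤ q) :
    rayEnergy β q s₂ < rayEnergy β q s₁ := by
  have hq' : (2 : ℝ) ≤ q := by exact_mod_cast hq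
  have hanti : StrictAntiOn (rayEnergy β q) (Set.Icc s₁ s₂) := by
    refine strictAntiOn_of_deriv_neg (convex_Icc _ _) (continuous_rayEnergy β q).continuousOn
      fun s hs => ?_
    rw [interior_Icc] at hs
    rw [(hasDerivAt_rayEnergy hβ hq (h.nonneg.trans hs.1.le) (hs.2.trans h.lt_one)).deriv]
    exact mul_neg_of_pos_of_neg (div_pos (by linarith) (by positivity)) (h.neg s hs.1 hs.2)
  exact hanti ⟨le_rfl, h.lt.le⟩ ⟨h.lt.le, le_rfl⟩ h.lt

theorem RayShape.energy_zero_lt (h : RayShape β q s₁ s₂) (hβ : 0 < β) (hq : 2 ≤ q)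
    (hs₁ : 0 < s₁) : rayEnergy β q 0 < rayEnergy β q s₁ := by
  have hq' : (2 : ℝ) ≤ q := by exact_mod_cast hq
  have hmono : StrictMonoOn (rayEnergy β q) (Set.Icc 0 s₁) := by
    refine strictMonoOn_of_deriv_pos (convex_Icc _ _) (continuous_rayEnergy β q).continuousOn
      fun s hs => ?_
    rw [interior_Icc] at hs
    rw [(hasDerivAt_rayEnergy hβ hq hs.1.le (hs.2.trans (h.lt.trans h.lt_one))).deriv]
    exact mul_pos (div_pos (by linarith) (by positivity)) (h.pos₁ s hs.1 hs.2)
  exact hmono ⟨le_rfl, hs₁.le⟩ ⟨hs₁.le, le_rfl⟩ hs₁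

/-- At the origin the slope has derivative `q - β > 0`, so it cannot be negative immediately to the
right. -/
theorem RayShape.pos_of_lt (h : RayShape β q s₁ s₂) (hq : 2 ≤ q) (hβq : β < q) : 0 < s₁ := by
  rcases h.nonneg.eq_or_lt with h0 | h0
  · exfalso
    have hd := hasDerivAt_raySlope β hq le_rfl (zero_lt_one (α := ℝ))
    simp only [mul_zero, add_zero, sub_zero, mul_one, div_one] at hd
    have h1 := hd.tendsto_slope_zero_right
    have h2 : ∀ᶠ t in nhdsWithin (0 : ℝ) (Set.Ioi 0), 0 < t⁻¹ • (raySlope β q (0 + t) -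
        raySlope β q 0) := h1.eventually (lt_mem_nhds (by linarith))
    have h3 : ∀ᶠ t in nhdsWithin (0 : ℝ) (Set.Ioi 0), t ∈ Set.Ioo 0 s₂ :=
      Ioo_mem_nhdsGT (h0 ▸ h.lt)
    obtain ⟨t, ht, ht'⟩ := (h2.and h3).exists
    rw [raySlope_zero, zero_add, sub_zero, smul_eq_mul] at ht
    have h4 := h.neg t (h0 ▸ ht'.1) ht'.2
    have h5 : t⁻¹ * raySlope β q t < 0 := mul_neg_of_pos_of_neg (inv_pos.2 ht'.1) h4
    linarith
  · exact h0

theorem RayShape.eq_of_zero (h : RayShape β q s₁ s₂) {s : ℝ} (h0 : 0 < s) (h1 : s < 1)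
    (hs : raySlope β q s = 0) : s = s₁ ∨ s = s₂ := by
  rcases lt_trichotomy s s₁ with h2 | h2 | h2
  · linarith [h.pos₁ s h0 h2]
  · exact Or.inl h2
  · rcases lt_trichotomy s s₂ with h3 | h3 | h3
    · linarith [h.neg s h2 h3]
    · exact Or.inr h3
    · linarith [h.pos₂ s h3 h1]

end Ray

/-! ### Classification of critical points -/

section Critical

open Filter Topology

variable {q : ℕ} {β : ℝ}

/-- `x` is a limit of points at which the transfer of a vanishing amount of mass between two
coordinates does not decrease the free energy. -/
def IsStuckLimit (β : ℝ) (x : Fin q → ℝ) : Prop :=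
  ∃ (y : ℕ → Fin q → ℝ) (t : ℕ → ℝ), (∀ l, y l ∈ stdSimplex ℝ (Fin q)) ∧ (∀ l, 0 < t l) ∧
    Tendsto y atTop (𝓝 x) ∧ Tendsto t atTop (𝓝 0) ∧
    ∀ l i j, i ≠ j → t l ≤ y l j → freeEnergy β (y l) ≤ freeEnergy β (shift (y l) i j (t l))

/-- A transfer changes only two coordinates; the mean value theorem applied to each turns the energy
comparison into one of slopes at nearby points. -/
theorem exists_siteSlope_le (y : Fin q → ℝ) {i j : Fin q} (hij : i ≠ j) {t : ℝ} (ht : 0 < t)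
    (hi : 0 ≤ y i) (hj : t ≤ y j) (h : freeEnergy β y ≤ freeEnergy β (shift y i j t)) :
    ∃ ξ ∈ Set.Ioo (y i) (y i + t), ∃ ζ ∈ Set.Ioo (y j - t) (y j),
      siteSlope β ζ ≤ siteSlope β ξ := by
  obtain ⟨ξ, hξ, e1⟩ := exists_siteSlope_eq β hi (show y i < y i + t by linarith)
  obtain ⟨ζ, hζ, e2⟩ := exists_siteSlope_eq β (sub_nonneg.2 hj) (show y j - t < y j by linarith)
  refine ⟨ξ, hξ, ζ, hζ, ?_⟩
  rw [freeEnergy_eq_sum, freeEnergy_eq_sum, sum_shift _ _ hij] at h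
  have h1 : siteSlope β ζ * t ≤ siteSlope β ξ * t := by
    rw [show y i + t - y i = t by ring] at e1
    rw [show y j - (y j - t) = t by ring] at e2
    linarith
  exact le_of_mul_le_mul_right h1 ht

theorem tendsto_siteSlope_zero (hβ : 0 < β) :
    Tendsto (siteSlope β) (𝓝[>] 0) atBot := by
  unfold siteSlope
  have h1 : Tendsto (fun t : ℝ => (1 / β) * (Real.log t + 1)) (𝓝[>] 0) atBot :=
    (tendsto_atBot_add_const_right _ 1 Real.tendsto_log_nhdsGT_zero).const_mul_atBot
      (by positivity)
  have h2 : Tendsto (fun t : ℝ => -t) (𝓝[>] 0) (𝓝 (-0)) :=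
    (continuous_neg.tendsto 0).mono_left nhdsWithin_le_nhds
  simpa only [sub_eq_add_neg] using h1.atBot_add h2

theorem IsStuckLimit.exists_seq {x : Fin q → ℝ} (h : IsStuckLimit β x) {i j : Fin q}
    (hij : i ≠ j) (hj : 0 < x j) :
    ∃ ξ ζ : ℕ → ℝ, (∀ᶠ l in atTop, 0 < ξ l) ∧ Tendsto ξ atTop (𝓝 (x i)) ∧
      Tendsto ζ atTop (𝓝 (x j)) ∧ ∀ᶠ l in atTop, siteSlope β (ζ l) ≤ siteSlope β (ξ l) := by
  obtain ⟨y, t, hy, ht, hyx, ht0, hs⟩ := h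
  have hyi := (tendsto_pi_nhds.1 hyx) i
  have hyj := (tendsto_pi_nhds.1 hyx) j
  have hev : ∀ᶠ l in atTop, t l ≤ y l j := by
    filter_upwards [ht0.eventually (gt_mem_nhds (half_pos hj)),
      hyj.eventually (lt_mem_nhds (half_lt_self hj))] with l h1 h2
    exact (h1.trans h2).le
  have hex : ∀ l, ∃ ξ ζ : ℝ, t l ≤ y l j → (y l i < ξ ∧ ξ < y l i + t l) ∧
      (y l j - t l < ζ ∧ ζ < y l j) ∧ siteSlope β ζ ≤ siteSlope β ξ := by
    intro l
    by_cases hl : t l ≤ y l j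
    · obtain ⟨ξ, hξ, ζ, hζ, h⟩ := exists_siteSlope_le (y l) hij (ht l) ((hy l).1 i) hl
        (hs l i j hij hl)
      exact ⟨ξ, ζ, fun _ => ⟨hξ, hζ, h⟩⟩
    · exact ⟨0, 0, fun hc => absurd hc hl⟩
  choose ξ ζ hξζ using hex
  refine ⟨ξ, ζ, ?_, ?_, ?_, ?_⟩
  · filter_upwards [hev] with l hl
    exact lt_of_le_of_lt ((hy l).1 i) (hξζ l hl).1.1
  · refine tendsto_of_tendsto_of_tendsto_of_le_of_le' hyi
      (by simpa using hyi.add ht0) ?_ ?_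
    · filter_upwards [hev] with l hl using (hξζ l hl).1.1.le
    · filter_upwards [hev] with l hl using (hξζ l hl).1.2.le
  · refine tendsto_of_tendsto_of_tendsto_of_le_of_le' (by simpa using hyj.sub ht0) hyj ?_ ?_
    · filter_upwards [hev] with l hl using (hξζ l hl).2.1.1.le
    · filter_upwards [hev] with l hl using (hξζ l hl).2.1.2.le
  · filter_upwards [hev] with l hl using (hξζ l hl).2.2

theorem continuousAt_siteSlope {t : ℝ} (ht : 0 < t) : ContinuousAt (siteSlope β) t :=
  (hasDerivAt_siteSlope β ht).continuousAt

theorem IsStuckLimit.mem_stdSimplex {x : Fin q → ℝ} (h : IsStuckLimit β x) :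
    x ∈ stdSimplex ℝ (Fin q) := by
  obtain ⟨y, t, hy, -, hyx, -, -⟩ := h
  exact (isClosed_stdSimplex ℝ (Fin q)).mem_of_tendsto hyx (Eventually.of_forall hy)

/-- The slope tends to `-∞` at zero. Near a vanishing coordinate, moving mass into it from a
positive one would lower the energy. -/
theorem IsStuckLimit.pos {x : Fin q → ℝ} (h : IsStuckLimit β x) (hβ : 0 < β) (i : Fin q) :
    0 < x i := by
  have hx := h.mem_stdSimplex
  rcases (hx.1 i).eq_or_lt with h0 | h0
  · exfalso
    obtain ⟨j, -, hj⟩ : ∃ j ∈ Finset.univ, 0 < x j :=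
      Finset.exists_lt_of_sum_lt (by rw [hx.2]; simp)
    have hij : i ≠ j := by rintro rfl; linarith
    obtain ⟨ξ, ζ, hpos, hξ, hζ, hle⟩ := h.exists_seq hij hj
    have h1 : Tendsto ξ atTop (𝓝[>] 0) := by
      rw [← h0] at hξ
      exact tendsto_nhdsWithin_iff.2 ⟨hξ, hpos⟩
    have h2 := (tendsto_siteSlope_zero hβ).comp h1
    have h3 := (continuousAt_siteSlope (β := β) hj).tendsto.comp hζ
    have h4 := tendsto_atBot_mono' atTop hle h2
    exact not_tendsto_nhds_of_tendsto_atBot h4 _ h3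
  · exact h0

/-- Lagrange condition: transfers in both directions give both inequalities in the limit. -/
theorem IsStuckLimit.siteSlope_eq {x : Fin q → ℝ} (h : IsStuckLimit β x) (hβ : 0 < β)
    (i j : Fin q) : siteSlope β (x i) = siteSlope β (x j) := by
  have key : ∀ i j, siteSlope β (x j) ≤ siteSlope β (x i) := by
    intro i j
    rcases eq_or_ne i j with rfl | hij
    · exact le_rfl
    obtain ⟨ξ, ζ, -, hξ, hζ, hle⟩ := h.exists_seq hij (h.pos hβ j)
    exact le_of_tendsto_of_tendsto ((continuousAt_siteSlope (h.pos hβ j)).tendsto.comp hζ)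
      ((continuousAt_siteSlope (h.pos hβ i)).tendsto.comp hξ) hle
  exact le_antisymm (key j i) (key i j)

/-- Beyond `1/β` the site energy is strictly concave, so moving mass from the smaller (or equal) to
the larger of two such coordinates lowers the energy. This is a second-order effect and is therefore
used at the approximating points, not at the limit. -/
theorem IsStuckLimit.eq_of_lt {x : Fin q → ℝ} (h : IsStuckLimit β x) (hβ : 0 < β)
    {i j : Fin q} (hi : 1 / β < x i) (hj : 1 / β < x j) : i = j := by
  by_contra hij
  obtain ⟨y, t, hy, ht, hyx, ht0, hs⟩ := h
  have hyi := (tendsto_pi_nhds.1 hyx) i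
  have hyj := (tendsto_pi_nhds.1 hyx) j
  have hb : 0 < 1 / β := by positivity
  obtain ⟨l, h1, h2⟩ := (((hyi.sub ht0).eventually (lt_mem_nhds (a := 1 / β) (by simpa using hi))).and
    ((hyj.sub ht0).eventually (lt_mem_nhds (a := 1 / β) (by simpa using hj)))).exists
  have key : ∀ i j, i ≠ j → 1 / β < y l i - t l → 1 / β < y l j - t l → y l i < y l j := by
    intro i j hij h1 h2
    by_contra hle
    rw [not_lt] at hle
    obtain ⟨ξ, hξ, ζ, hζ, h3⟩ := exists_siteSlope_le (y l) hij (ht l) ((hy l).1 i)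
      (by linarith) (hs l i j hij (by linarith))
    have h4 := siteSlope_strictAntiOn hβ (show ζ ∈ Set.Ici (1 / β) from (h2.trans hζ.1).le)
      (show ξ ∈ Set.Ici (1 / β) from by
        have := hξ.1; have := ht l; simp only [Set.mem_Ici]; linarith)
      (show ζ < ξ by linarith [hζ.2, hξ.1])
    linarith
  exact lt_asymm (key i j hij h1 h2) (key j i (Ne.symm hij) h2 h1)

/-- Classification of the possible limits of points stuck under transfers. -/
theorem IsStuckLimit.eq_ray {x : Fin q → ℝ} (h : IsStuckLimit β x) (hβ : 0 < β) (hq : 2 ≤ q) :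
    x = uniformPoint q ∨ ∃ k s, 0 < s ∧ s < 1 ∧ raySlope β q s = 0 ∧ x = ray q k s := by
  have hx := h.mem_stdSimplex
  have hq0 : (0 : ℝ) < q := by exact_mod_cast (by omega : 0 < q)
  have hsmall : ∀ i j, x i ≤ 1 / β → x j ≤ 1 / β → x i = x j := fun i j hi hj =>
    (siteSlope_strictMonoOn β).injOn ⟨h.pos hβ i, hi⟩ ⟨h.pos hβ j, hj⟩ (h.siteSlope_eq hβ i j)
  -- At most one coordinate exceeds `1/β`, and all the others agree because the slope is injective
  -- below `1/β`.
  by_cases hbig : ∃ k, 1 / β < x k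
  · obtain ⟨k, hk⟩ := hbig
    have hle : ∀ l, l ≠ k → x l ≤ 1 / β := fun l hl => by
      by_contra hc
      exact hl (h.eq_of_lt hβ (not_le.1 hc) hk)
    have : Nontrivial (Fin q) := Fin.nontrivial_iff_two_le.2 hq
    obtain ⟨j, hj⟩ := exists_ne k
    have hsum : x k + ((q : ℝ) - 1) * x j = 1 := by
      refine Eq.trans ?_ hx.2
      rw [← Finset.add_sum_erase _ _ (Finset.mem_univ k)]
      congr 1
      rw [Finset.sum_congr rfl fun l hl => hsmall l j (hle l (Finset.ne_of_mem_erase hl))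
        (hle j hj), Finset.sum_const, Finset.card_erase_of_mem (Finset.mem_univ k), nsmul_eq_mul,
        Finset.card_univ, Fintype.card_fin, Nat.cast_sub (by omega)]
      simp
    have hjpos := h.pos hβ j
    have hlt : x j < x k := lt_of_le_of_lt (hle j hj) hk
    have hs1 : 1 - (q : ℝ) * x j < 1 := by have := mul_pos hq0 hjpos; linarith
    have hs0 : 0 < 1 - (q : ℝ) * x j := by linarith
    have hxk : x k = (1 + ((q : ℝ) - 1) * (1 - q * x j)) / q := by
      field_simp
      linear_combination (q : ℝ) * hsum
    have hxj : x j = (1 - (1 - (q : ℝ) * x j)) / q := by field_simp; ring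
    refine Or.inr ⟨k, 1 - q * x j, hs0, hs1, ?_, ?_⟩
    · have h1 := siteSlope_sub_eq hβ hq hs0.le hs1
      rw [← hxk, ← hxj, h.siteSlope_eq hβ k j, sub_self] at h1
      rcases mul_eq_zero.1 h1.symm with h2 | h2
      · exact absurd h2 (by positivity)
      · exact h2
    · funext l
      unfold ray
      split_ifs with hl
      · rw [hl, hxk]
      · rw [← hxj]; exact hsmall l j (hle l hl) (hle j hj)
  · push Not at hbig
    left
    funext i
    have : ∑ j, x j = (q : ℝ) * x i := by
      rw [Finset.sum_congr rfl fun j _ => hsmall j i (hbig j) (hbig i)]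
      simp
    rw [hx.2] at this
    unfold uniformPoint
    field_simp
    linarith

theorem shift_mem_stdSimplex {x : Fin q → ℝ} (hx : x ∈ stdSimplex ℝ (Fin q)) {i j : Fin q}
    (hij : i ≠ j) {t : ℝ} (ht : 0 ≤ t) (hj : t ≤ x j) :
    shift x i j t ∈ stdSimplex ℝ (Fin q) := by
  refine ⟨fun k => ?_, ?_⟩
  · unfold shift
    split_ifs
    · linarith [hx.1 i]
    · linarith
    · exact hx.1 k
  · have := sum_shift id x hij t
    simp only [id] at this
    rw [this, hx.2]
    ring

theorem dist_shift_le (x : Fin q → ℝ) {i j : Fin q} {t : ℝ} (ht : 0 ≤ t) :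
    dist (shift x i j t) x ≤ t := by
  refine (dist_pi_le_iff ht).2 fun k => ?_
  unfold shift
  split_ifs with h1 h2
  · subst h1; simp [abs_of_nonneg ht]
  · subst h2; simp [abs_of_nonneg ht]
  · simpa using ht

/-- The constant sequence with shrinking transfers serves as approximation, so one classification
covers both continuum minima and limits of lattice minima. -/
theorem isStuckLimit_of_isLocalMinOn {x : Fin q → ℝ} (hx : x ∈ stdSimplex ℝ (Fin q))
    (h : IsLocalMinOn (freeEnergy β) (stdSimplex ℝ (Fin q)) x) : IsStuckLimit β x := by
  obtain ⟨δ, hδ, hball⟩ := Metric.mem_nhdsWithin_iff.1 h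
  refine ⟨fun _ => x, fun l => δ / 2 * (1 / ((l : ℝ) + 1)), fun _ => hx, fun l => by positivity,
    tendsto_const_nhds, ?_, ?_⟩
  · simpa using tendsto_one_div_add_atTop_nhds_zero_nat.const_mul (δ / 2)
  · intro l i j hij hl
    have ht : 0 ≤ δ / 2 * (1 / ((l : ℝ) + 1)) := by positivity
    have hlt : δ / 2 * (1 / ((l : ℝ) + 1)) < δ := by
      have : 1 / ((l : ℝ) + 1) ≤ 1 := by
        rw [div_le_one (by positivity)]
        linarith [(Nat.cast_nonneg' l : (0 : ℝ) ≤ l)]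
      nlinarith
    exact hball ⟨lt_of_le_of_lt (dist_shift_le x ht) hlt, shift_mem_stdSimplex hx hij ht hl⟩

theorem exists_isMinOn_freeEnergy (β : ℝ) (hq : 2 ≤ q) :
    ∃ x ∈ stdSimplex ℝ (Fin q), IsMinOn (freeEnergy β) (stdSimplex ℝ (Fin q)) x := by
  have : Nonempty (Fin q) := ⟨⟨0, by omega⟩⟩
  exact (isCompact_stdSimplex ℝ (Fin q)).exists_isMinOn
    ⟨_, single_mem_stdSimplex ℝ (⟨0, by omega⟩ : Fin q)⟩ (continuous_freeEnergy β q).continuousOn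

theorem freeEnergy_uniformPoint (β : ℝ) (hq : 2 ≤ q) :
    freeEnergy β (uniformPoint q) = -(1 / (2 * q)) - (1 / β) * Real.log q := by
  have hq0 : (0 : ℝ) < q := by exact_mod_cast (by omega : 0 < q)
  unfold freeEnergy uniformPoint
  simp only [Finset.sum_const, Finset.card_univ, Fintype.card_fin, nsmul_eq_mul, one_div,
    Real.log_inv]
  field_simp
  ring

theorem freeEnergy_single (β : ℝ) (k : Fin q) :
    freeEnergy β (Pi.single k 1) = -(1 / 2) := by
  unfold freeEnergy
  have h1 : ∀ l, (Pi.single k 1 : Fin q → ℝ) l ^ 2 = if l = k then 1 else 0 := fun l => by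
    by_cases h : l = k
    · subst h; simp
    · simp [h]
  have h2 : ∀ l, (Pi.single k 1 : Fin q → ℝ) l * Real.log ((Pi.single k 1 : Fin q → ℝ) l) = 0 :=
    fun l => by
      by_cases h : l = k
      · subst h; simp
      · simp [h]
  simp [h1, h2]

/-- A vertex of the simplex has energy `-1/2`, while the uniform point stays at or above `-1/4 -
1/8` for such `β`. -/
theorem not_isMinOn_uniformPoint (hq : 2 ≤ q) (hβ : 8 * Real.log q ≤ β) :
    ¬ IsMinOn (freeEnergy β) (stdSimplex ℝ (Fin q)) (uniformPoint q) := by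
  intro h
  have hq' : (2 : ℝ) ≤ q := by exact_mod_cast hq
  have hl : 0 < Real.log q := Real.log_pos (by linarith)
  have h1 := h (single_mem_stdSimplex ℝ (⟨0, by omega⟩ : Fin q))
  simp only [Set.mem_ofPred_eq] at h1
  rw [freeEnergy_uniformPoint β hq, freeEnergy_single] at h1
  have h2 : (1 / β) * Real.log q ≤ 1 / 8 := by
    rw [one_div, inv_mul_le_iff₀ (by linarith)]
    linarith
  have h3 : 1 / (2 * (q : ℝ)) ≤ 1 / 4 := by
    apply one_div_le_one_div_of_le <;> linarith
  linarith

theorem beta1_nonneg (q : ℕ) : 0 ≤ beta1 q := Real.sInf_nonneg fun _ hb => hb.1.le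

/-- Some `b < β` has a local minimum away from the uniform point, hence a zero of the slope on a
ray; raising the parameter from `b` to `β` lowers the slope there by `(β - b) s`. -/
theorem exists_raySlope_neg (hq : 2 ≤ q) (hβ : beta1 q < β) :
    ∃ s, 0 < s ∧ s < 1 ∧ raySlope β q s < 0 := by
  have hq' : (2 : ℝ) ≤ q := by exact_mod_cast hq
  have hl : 0 < Real.log q := Real.log_pos (by linarith)
  have hne : {β : ℝ | 0 < β ∧ ∃ x ∈ stdSimplex ℝ (Fin q), x ≠ uniformPoint q ∧
      IsLocalMinOn (freeEnergy β) (stdSimplex ℝ (Fin q)) x}.Nonempty := by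
    obtain ⟨x, hx, hmin⟩ := exists_isMinOn_freeEnergy (8 * Real.log q) hq
    refine ⟨8 * Real.log q, by positivity, x, hx, ?_, hmin.localize⟩
    rintro rfl
    exact not_isMinOn_uniformPoint hq le_rfl hmin
  obtain ⟨b, ⟨hb, x, hx, hxu, hmin⟩, hbβ⟩ := exists_lt_of_csInf_lt hne hβ
  rcases (isStuckLimit_of_isLocalMinOn hx hmin).eq_ray hb hq with h | ⟨k, s, h0, h1, h2, -⟩
  · exact absurd h hxu
  · refine ⟨s, h0, h1, ?_⟩
    have : raySlope β q s = raySlope b q s - (β - b) * s := by unfold raySlope; ring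
    rw [this, h2]
    nlinarith

/-- The entropy deficit `log q + ∑ x log x` is nonnegative and enters the energy difference with the
factor `1/b`, so lowering the parameter favours the uniform point. -/
theorem freeEnergy_sub_uniformPoint_mono (hq : 2 ≤ q) {b b' : ℝ} (hb : 0 < b) (hbb : b ≤ b')
    {x : Fin q → ℝ} (hx : x ∈ stdSimplex ℝ (Fin q))
    (h : freeEnergy b' (uniformPoint q) ≤ freeEnergy b' x) :
    freeEnergy b (uniformPoint q) ≤ freeEnergy b x := by
  have hq0 : (0 : ℝ) < q := by exact_mod_cast (by omega : 0 < q)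
  have hent : 0 ≤ ∑ i, x i * Real.log (x i) + Real.log q := by
    have h1 : ∀ i, x i * Real.log (x i) + x i * Real.log q ≥ x i - 1 / q := by
      intro i
      rcases (hx.1 i).eq_or_lt with h0 | h0
      · rw [← h0]; simp
      · have h2 := Real.log_le_sub_one_of_pos (show 0 < 1 / (q * x i) by positivity)
        rw [one_div, Real.log_inv, Real.log_mul hq0.ne' h0.ne'] at h2
        have h3 : x i * ((q * x i)⁻¹ - 1) = 1 / q - x i := by field_simp
        have h4 := mul_le_mul_of_nonneg_left h2 h0.le
        rw [h3] at h4
        linarith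
    have h2 := Finset.sum_le_sum fun i (_ : i ∈ Finset.univ) => h1 i
    rw [Finset.sum_sub_distrib, Finset.sum_add_distrib, ← Finset.sum_mul, hx.2] at h2
    simp only [Finset.sum_const, Finset.card_univ, Fintype.card_fin, nsmul_eq_mul] at h2
    have h3 : (q : ℝ) * (1 / q) = 1 := by field_simp
    linarith
  rw [freeEnergy_uniformPoint _ hq] at h ⊢
  unfold freeEnergy at h ⊢
  have h1 : 1 / b' ≤ 1 / b := one_div_le_one_div_of_le hb hbb
  nlinarith [mul_le_mul_of_nonneg_right h1 hent]

theorem bddAbove_beta2 (hq : 2 ≤ q) : BddAbove {β : ℝ | 0 < β ∧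
    IsMinOn (freeEnergy β) (stdSimplex ℝ (Fin q)) (uniformPoint q)} :=
  ⟨8 * Real.log q, fun b hb => by
    by_contra hc
    exact not_isMinOn_uniformPoint hq (not_le.1 hc).le hb.2⟩

theorem not_isMinOn_of_beta2_lt (hq : 2 ≤ q) (hβ0 : 0 < β) (hβ : beta2 q < β) :
    ¬ IsMinOn (freeEnergy β) (stdSimplex ℝ (Fin q)) (uniformPoint q) := fun h =>
  absurd (le_csSup (bddAbove_beta2 hq) ⟨hβ0, h⟩) (not_le.2 hβ)

theorem isMinOn_of_le_beta2 (hq : 2 ≤ q) (hβ0 : 0 < β) (hβ : β ≤ beta2 q) :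
    IsMinOn (freeEnergy β) (stdSimplex ℝ (Fin q)) (uniformPoint q) := by
  have hne : {β : ℝ | 0 < β ∧
      IsMinOn (freeEnergy β) (stdSimplex ℝ (Fin q)) (uniformPoint q)}.Nonempty := by
    -- The supremum of the empty set is `0` by convention, which contradicts `0 < β ≤ beta2 q`.
    by_contra hc
    rw [Set.not_nonempty_iff_eq_empty] at hc
    unfold beta2 at hβ
    rw [hc, Real.sSup_empty] at hβ
    linarith
  intro x hx
  have hlt : ∀ b, 0 < b → b < β → freeEnergy b (uniformPoint q) ≤ freeEnergy b x := by
    intro b hb hbβ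
    obtain ⟨b', ⟨_, hb'⟩, hbb⟩ := exists_lt_of_lt_csSup hne (hbβ.trans_le hβ)
    exact freeEnergy_sub_uniformPoint_mono hq hb hbb.le hx (hb' hx)
  have hcont : ∀ y : Fin q → ℝ, Tendsto (fun b : ℝ => freeEnergy b y) (𝓝[<] β)
      (𝓝 (freeEnergy β y)) := by
    intro y
    refine Tendsto.mono_left ?_ nhdsWithin_le_nhds
    unfold freeEnergy
    have : ContinuousAt (fun b : ℝ => 1 / b) β := continuousAt_const.div continuousAt_id hβ0.ne'
    exact tendsto_const_nhds.add (this.tendsto.mul_const _)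
  refine le_of_tendsto_of_tendsto (hcont _) (hcont _) ?_
  filter_upwards [Ioo_mem_nhdsLT hβ0] with b hb
  exact hlt b hb.1 hb.2

/-- On the set where the largest coordinate is that of the saddle, the free energy is at least
that of the saddle. -/
theorem RayShape.energy_le_of_max {s₁ s₂ : ℝ} (h : RayShape β q s₁ s₂) (hβ : 0 < β) (hq : 2 ≤ q)
    (hs₁ : 0 < s₁) {x : Fin q → ℝ} (hx : x ∈ stdSimplex ℝ (Fin q)) (k : Fin q)
    (hk : x k = (1 + ((q : ℝ) - 1) * s₁) / q)
    (hmax : ∀ l, x l ≤ (1 + ((q : ℝ) - 1) * s₁) / q) :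
    rayEnergy β q s₁ ≤ freeEnergy β x := by
  have hq0 : (0 : ℝ) < q := by exact_mod_cast (by omega : 0 < q)
  have hlt1 : s₁ < 1 := h.lt.trans h.lt_one
  set a := (1 + ((q : ℝ) - 1) * s₁) / q with ha
  set b := (1 - s₁) / (q : ℝ) with hb
  have hb0 : 0 < b := div_pos (by linarith) hq0
  have hba : b < a := by
    rw [ha, hb, div_lt_div_iff_of_pos_right hq0]
    nlinarith [mul_pos hq0 hs₁]
  have heq : siteSlope β a = siteSlope β b := by
    have := siteSlope_sub_eq hβ hq h.nonneg hlt1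
    rw [h.zero₁, mul_zero] at this
    linarith
  have hb1 : b < 1 / β := by
    by_contra hc
    rw [not_lt] at hc
    have := siteSlope_strictAntiOn hβ (Set.mem_Ici.2 hc) (Set.mem_Ici.2 (hc.trans hba.le)) hba
    linarith
  have ha1 : 1 / β < a := by
    by_contra hc
    rw [not_lt] at hc
    have := siteSlope_strictMonoOn β ⟨hb0, hb1.le⟩ ⟨hb0.trans hba, hc⟩ hba
    linarith
  -- The tangent at `b` stays below the site energy on all of `[0, a]`: the slopes at `a` and `b`
  -- agree, and by unimodality the slope in between is at least this common value.
  have htan : ∀ t, 0 ≤ t → t ≤ a →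
      siteEnergy β b + siteSlope β b * (t - b) ≤ siteEnergy β t := by
    intro t ht0 hta
    rcases lt_trichotomy t b with h1 | h1 | h1
    · obtain ⟨ξ, hξ, e⟩ := exists_siteSlope_eq β ht0 h1
      have : siteSlope β ξ ≤ siteSlope β b := (siteSlope_strictMonoOn β).monotoneOn
        ⟨lt_of_le_of_lt ht0 hξ.1, (hξ.2.trans hb1).le⟩ ⟨hb0, hb1.le⟩ hξ.2.le
      nlinarith
    · subst h1; simp
    · obtain ⟨ξ, hξ, e⟩ := exists_siteSlope_eq β hb0.le h1
      have : siteSlope β b ≤ siteSlope β ξ := by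
        rcases le_total ξ (1 / β) with h2 | h2
        · exact (siteSlope_strictMonoOn β).monotoneOn ⟨hb0, hb1.le⟩ ⟨hb0.trans hξ.1, h2⟩ hξ.1.le
        · rw [← heq]
          exact (siteSlope_strictAntiOn hβ).antitoneOn (Set.mem_Ici.2 h2) (Set.mem_Ici.2 ha1.le)
            (hξ.2.le.trans hta)
      nlinarith
  rw [freeEnergy_eq_sum, ← Finset.add_sum_erase _ _ (Finset.mem_univ k), hk]
  unfold rayEnergy
  rw [← ha, ← hb]
  refine add_le_add_right ?_ _
  have h1 := Finset.sum_le_sum fun l (_ : l ∈ Finset.univ.erase k) => htan (x l) (hx.1 l) (hmax l)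
  refine le_trans (le_of_eq ?_) h1
  have hsum : ∑ l ∈ Finset.univ.erase k, x l = 1 - a := by
    have := Finset.add_sum_erase Finset.univ x (Finset.mem_univ k)
    rw [hx.2, hk] at this
    linarith
  rw [Finset.sum_add_distrib, ← Finset.mul_sum, Finset.sum_sub_distrib, hsum, Finset.sum_const,
    Finset.sum_const, Finset.card_erase_of_mem (Finset.mem_univ k), nsmul_eq_mul, nsmul_eq_mul,
    Finset.card_univ, Fintype.card_fin, Nat.cast_sub (by omega)]
  -- The remaining coordinates average to `b`, so the linear terms of the tangents cancel in the
  -- sum.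
  have : 1 - a - ((q : ℝ) - 1) * b = 0 := by
    rw [ha, hb]; field_simp; ring
  push_cast
  rw [this]
  ring

end Critical

/-! ### The landscape of each of the three transitions -/

section Landscape

variable {q : ℕ} {β : ℝ}

/-- The features of the free energy landscape that govern a transition from the minima with index
in `IA` to those with index in `IB`: the wall `Φ = 0` separates them and lies above the level `E`
of the starting points, and every other critical point is higher than `E`. -/
structure Landscape (β : ℝ) (q : ℕ) (IA IB : Set (Option (Fin q))) (E : ℝ)
    (Φ : (Fin q → ℝ) → ℝ) : Prop where
  cont : Continuous Φ
  nonemptyA : IA.Nonempty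
  nonemptyB : IB.Nonempty
  mem : ∀ i, minPoint β q i ∈ stdSimplex ℝ (Fin q)
  posA : ∀ i ∈ IA, 0 < Φ (minPoint β q i)
  negB : ∀ i ∈ IB, Φ (minPoint β q i) < 0
  level : ∀ i ∈ IA, freeEnergy β (minPoint β q i) = E
  wall : ∀ x ∈ stdSimplex ℝ (Fin q), Φ x = 0 → E < freeEnergy β x
  stuck : ∃ ε > 0, ∀ x, IsStuckLimit β x → freeEnergy β x ≤ E + ε →
    ∃ i ∈ IA ∪ IB, x = minPoint β q i

theorem RayShape.coord_lt {s₁ s₂ : ℝ} (h : RayShape β q s₁ s₂) (hq : 2 ≤ q) :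
    (1 + ((q : ℝ) - 1) * s₁) / q < (1 + ((q : ℝ) - 1) * s₂) / q := by
  have hq' : (2 : ℝ) ≤ q := by exact_mod_cast hq
  rw [div_lt_div_iff_of_pos_right (by linarith)]
  nlinarith [h.lt]

theorem RayShape.minPoint_mem {s₁ : ℝ} (h : RayShape β q s₁ (largestSol β q)) (hq : 2 ≤ q)
    (i : Option (Fin q)) : minPoint β q i ∈ stdSimplex ℝ (Fin q) := by
  have k : Fin q := ⟨0, by omega⟩
  cases i with
  | none =>
    rw [show minPoint β q none = ray q k 0 from (ray_zero k).symm]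
    exact ray_mem_stdSimplex k le_rfl zero_le_one
  | some i => exact ray_mem_stdSimplex i (h.nonneg.trans h.lt.le) h.lt_one.le

theorem RayShape.stuck_cases {s₁ : ℝ} (h : RayShape β q s₁ (largestSol β q)) (hβ : 0 < β)
    (hq : 2 ≤ q) {x : Fin q → ℝ} (hx : IsStuckLimit β x) :
    (∃ i, x = minPoint β q i) ∨ freeEnergy β x = rayEnergy β q s₁ := by
  rcases hx.eq_ray hβ hq with h1 | ⟨k, s, h0, h1, h2, h3⟩
  · exact Or.inl ⟨none, h1⟩
  · rcases h.eq_of_zero h0 h1 h2 with rfl | rfl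
    · right; rw [h3, freeEnergy_ray]
    · exact Or.inl ⟨some k, h3⟩

theorem norm_uniformPoint (hq : 2 ≤ q) : ‖uniformPoint q‖ = 1 / q := by
  have : Nonempty (Fin q) := ⟨⟨0, by omega⟩⟩
  unfold uniformPoint
  rw [pi_norm_const, Real.norm_of_nonneg (by positivity)]

theorem le_norm_ray (k : Fin q) (s : ℝ) : (1 + ((q : ℝ) - 1) * s) / q ≤ ‖ray q k s‖ := by
  refine le_trans ?_ (norm_le_pi_norm (ray q k s) k)
  rw [Real.norm_eq_abs]
  refine le_trans (le_of_eq ?_) (le_abs_self _)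
  simp [ray]

/-- On the simplex the supremum norm is the largest coordinate, so the wall is a level set of a
continuous function. -/
theorem RayShape.wall {s₁ s₂ : ℝ} (h : RayShape β q s₁ s₂) (hβ : 0 < β) (hq : 2 ≤ q)
    (hs₁ : 0 < s₁) {x : Fin q → ℝ} (hx : x ∈ stdSimplex ℝ (Fin q))
    (hn : ‖x‖ = (1 + ((q : ℝ) - 1) * s₁) / q) : rayEnergy β q s₁ ≤ freeEnergy β x := by
  have : Nonempty (Fin q) := ⟨⟨0, by omega⟩⟩
  have hnorm : ∀ l, ‖x l‖ = x l := fun l => Real.norm_of_nonneg (hx.1 l)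
  obtain ⟨k, hk⟩ : ∃ k, ‖x k‖ = ‖x‖ := by
    obtain ⟨k, hk⟩ := Finite.exists_max fun l => ‖x l‖
    exact ⟨k, le_antisymm (norm_le_pi_norm x k)
      ((pi_norm_le_iff_of_nonneg (norm_nonneg _)).2 hk)⟩
  refine h.energy_le_of_max hβ hq hs₁ hx k ?_ fun l => ?_
  · rw [← hnorm, hk, hn]
  · rw [← hnorm, ← hn]; exact norm_le_pi_norm x l

theorem coord_zero_lt {s₁ : ℝ} (hq : 2 ≤ q) (hs₁ : 0 < s₁) :
    1 / (q : ℝ) < (1 + ((q : ℝ) - 1) * s₁) / q := by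
  have hq' : (2 : ℝ) ≤ q := by exact_mod_cast hq
  rw [div_lt_div_iff_of_pos_right (by linarith)]
  nlinarith

theorem freeEnergy_minPoint_some (β : ℝ) (k : Fin q) :
    freeEnergy β (minPoint β q (some k)) = rayEnergy β q (largestSol β q) :=
  freeEnergy_ray β k _

theorem freeEnergy_minPoint_none (β : ℝ) (hq : 2 ≤ q) :
    freeEnergy β (minPoint β q none) = rayEnergy β q 0 := by
  rw [show minPoint β q none = ray q ⟨0, by omega⟩ 0 from (ray_zero _).symm, freeEnergy_ray]

theorem RayShape.landscape_to_uniform {s₁ : ℝ} (h : RayShape β q s₁ (largestSol β q))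
    (hβ : 0 < β) (hq : 2 ≤ q) (hs₁ : 0 < s₁) :
    Landscape β q (Set.range some) {none} (rayEnergy β q (largestSol β q))
      (fun x => ‖x‖ - (1 + ((q : ℝ) - 1) * s₁) / q) where
  cont := by fun_prop
  nonemptyA := ⟨some ⟨0, by omega⟩, by simp⟩
  nonemptyB := ⟨none, rfl⟩
  mem := h.minPoint_mem hq
  posA := by
    rintro _ ⟨k, rfl⟩
    have := le_norm_ray k (largestSol β q)
    have := h.coord_lt hq
    rw [minPoint_some]
    linarith
  negB := by
    rintro _ rfl
    have := coord_zero_lt hq hs₁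
    simp only [minPoint, norm_uniformPoint hq]
    linarith
  level := by
    rintro _ ⟨k, rfl⟩
    exact freeEnergy_minPoint_some β k
  wall x hx h0 := (h.energy_lt hβ hq).trans_le (h.wall hβ hq hs₁ hx (by linarith))
  stuck := by
    have hlt := h.energy_lt hβ hq
    -- Half of the barrier excludes the saddles; every other critical point is a minimum listed in
    -- one of the two index sets.
    refine ⟨(rayEnergy β q s₁ - rayEnergy β q (largestSol β q)) / 2, by linarith,
      fun x hx hle => ?_⟩
    rcases h.stuck_cases hβ hq hx with ⟨i, hi⟩ | h1
    · refine ⟨i, ?_, hi⟩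
      cases i <;> simp
    · linarith

theorem RayShape.landscape_from_uniform {s₁ : ℝ} (h : RayShape β q s₁ (largestSol β q))
    (hβ : 0 < β) (hq : 2 ≤ q) (hs₁ : 0 < s₁) :
    Landscape β q {none} (Set.range some) (rayEnergy β q 0)
      (fun x => (1 + ((q : ℝ) - 1) * s₁) / q - ‖x‖) where
  cont := by fun_prop
  nonemptyB := ⟨some ⟨0, by omega⟩, by simp⟩
  nonemptyA := ⟨none, rfl⟩
  mem := h.minPoint_mem hq
  negB := by
    rintro _ ⟨k, rfl⟩
    have := le_norm_ray k (largestSol β q)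
    have := h.coord_lt hq
    rw [minPoint_some]
    linarith
  posA := by
    rintro _ rfl
    have := coord_zero_lt hq hs₁
    simp only [minPoint, norm_uniformPoint hq]
    linarith
  level := by
    rintro _ rfl
    exact freeEnergy_minPoint_none β hq
  wall x hx h0 := (h.energy_zero_lt hβ hq hs₁).trans_le (h.wall hβ hq hs₁ hx (by linarith))
  stuck := by
    have hlt := h.energy_zero_lt hβ hq hs₁
    refine ⟨(rayEnergy β q s₁ - rayEnergy β q 0) / 2, by linarith, fun x hx hle => ?_⟩
    rcases h.stuck_cases hβ hq hx with ⟨i, hi⟩ | h1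
    · refine ⟨i, ?_, hi⟩
      cases i <;> simp
    · linarith

theorem RayShape.isMinOn_cases {s₁ : ℝ} (h : RayShape β q s₁ (largestSol β q)) (hβ : 0 < β)
    (hq : 2 ≤ q)
    (hu : ¬ IsMinOn (freeEnergy β) (stdSimplex ℝ (Fin q)) (uniformPoint q)) {x : Fin q → ℝ}
    (hx : x ∈ stdSimplex ℝ (Fin q))
    (hmin : IsMinOn (freeEnergy β) (stdSimplex ℝ (Fin q)) x) :
    ∃ k, x = minPoint β q (some k) := by
  rcases h.stuck_cases hβ hq (isStuckLimit_of_isLocalMinOn hx hmin.localize) with ⟨i, hi⟩ | h1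
  · cases i with
    | none =>
      rw [hi] at hmin
      exact absurd hmin hu
    | some k => exact ⟨k, hi⟩
  · have h2 : freeEnergy β x ≤ freeEnergy β (minPoint β q (some ⟨0, by omega⟩)) :=
      hmin (h.minPoint_mem hq _)
    rw [freeEnergy_minPoint_some] at h2
    linarith [h.energy_lt hβ hq]

/-- The wall is where coordinate `i` ties with the largest of the others. Every global minimizer is
some `m_k` and has a strictly largest coordinate, so none lies on the wall. The uniform point is not
a global minimum, hence it and the saddles lie strictly above the starting level; positivity of `s₁`
plays no role. -/
theorem RayShape.landscape_tunnelling {s₁ : ℝ} (h : RayShape β q s₁ (largestSol β q))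
    (hβ : 0 < β) (hq : 2 ≤ q)
    (hu : ¬ IsMinOn (freeEnergy β) (stdSimplex ℝ (Fin q)) (uniformPoint q)) (i : Fin q) :
    Landscape β q {some i} (some '' {j | j ≠ i}) (rayEnergy β q (largestSol β q))
      (fun x => x i - ‖Function.update x i 0‖) := by
  have hq' : (2 : ℝ) ≤ q := by exact_mod_cast hq
  obtain ⟨x₀, hx₀, hmin⟩ := exists_isMinOn_freeEnergy β hq
  obtain ⟨k₀, hk₀⟩ := h.isMinOn_cases hβ hq hu hx₀ hmin
  have hE : ∀ x ∈ stdSimplex ℝ (Fin q), rayEnergy β q (largestSol β q) ≤ freeEnergy β x := by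
    intro x hx
    have := hmin hx
    rwa [hk₀, Set.mem_ofPred_eq, freeEnergy_minPoint_some] at this
  have hEeq : ∀ x ∈ stdSimplex ℝ (Fin q), freeEnergy β x = rayEnergy β q (largestSol β q) →
      ∃ k, x = minPoint β q (some k) := by
    intro x hx hxe
    refine h.isMinOn_cases hβ hq hu hx fun y hy => ?_
    rw [Set.mem_ofPred_eq, hxe]
    exact hE y hy
  have hs2 : 0 < largestSol β q := lt_of_le_of_lt h.nonneg h.lt
  have hab : (1 - largestSol β q) / q < (1 + ((q : ℝ) - 1) * largestSol β q) / q := by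
    rw [div_lt_div_iff_of_pos_right (by linarith)]
    nlinarith
  have hb0 : 0 ≤ (1 - largestSol β q) / q := div_nonneg (by linarith [h.lt_one]) (by linarith)
  have hpos : 0 < minPoint β q (some i) i - ‖Function.update (minPoint β q (some i)) i 0‖ := by
    have h1 : ‖Function.update (minPoint β q (some i)) i 0‖ ≤ (1 - largestSol β q) / q := by
      refine (pi_norm_le_iff_of_nonneg hb0).2 fun l => ?_
      by_cases hl : l = i
      · subst hl; simpa using hb0
      · rw [Function.update_of_ne hl, minPoint_some]
        simp only [ray, if_neg hl]
        rw [Real.norm_of_nonneg hb0]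
    have h2 : minPoint β q (some i) i = (1 + ((q : ℝ) - 1) * largestSol β q) / q := by
      simp [minPoint]
    linarith
  have hneg : ∀ j, j ≠ i →
      minPoint β q (some j) i - ‖Function.update (minPoint β q (some j)) i 0‖ < 0 := by
    intro j hj
    have h1 := norm_le_pi_norm (Function.update (minPoint β q (some j)) i 0) j
    rw [Function.update_of_ne hj] at h1
    have h2 : minPoint β q (some j) j = (1 + ((q : ℝ) - 1) * largestSol β q) / q := by
      simp [minPoint]
    have h3 : minPoint β q (some j) i = (1 - largestSol β q) / q := by
      simp [minPoint, hj.symm]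
    have h4 := le_abs_self (minPoint β q (some j) j)
    rw [Real.norm_eq_abs] at h1
    linarith
  refine ⟨?_, ⟨some i, rfl⟩, ?_, h.minPoint_mem hq, ?_, ?_, ?_, ?_, ?_⟩
  · exact (continuous_apply i).sub (continuous_id.update i continuous_const).norm
  · have : Nontrivial (Fin q) := Fin.nontrivial_iff_two_le.2 hq
    obtain ⟨j, hj⟩ := exists_ne i
    exact ⟨some j, j, hj, rfl⟩
  · rintro _ rfl
    exact hpos
  · rintro _ ⟨j, hj, rfl⟩
    exact hneg j hj
  · rintro _ rfl
    exact freeEnergy_minPoint_some β i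
  · intro x hx h0
    refine lt_of_le_of_ne (hE x hx) fun heq => ?_
    obtain ⟨k, rfl⟩ := hEeq x hx heq.symm
    by_cases hk : k = i
    · subst hk; linarith
    · linarith [hneg k hk]
  · have h0 : rayEnergy β q (largestSol β q) < rayEnergy β q 0 := by
      refine lt_of_le_of_ne ?_ fun heq => ?_
      · have := hE _ (h.minPoint_mem hq none)
        rwa [freeEnergy_minPoint_none β hq] at this
      · refine hu fun y hy => ?_
        have := hE y hy
        rw [heq, ← freeEnergy_minPoint_none β hq] at this
        exact this
    have h1 := h.energy_lt hβ hq
    refine ⟨min (rayEnergy β q 0 - rayEnergy β q (largestSol β q))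
      (rayEnergy β q s₁ - rayEnergy β q (largestSol β q)) / 2,
      half_pos (lt_min (by linarith) (by linarith)), fun x hx hle => ?_⟩
    have m1 := min_le_left (rayEnergy β q 0 - rayEnergy β q (largestSol β q))
      (rayEnergy β q s₁ - rayEnergy β q (largestSol β q))
    have m2 := min_le_right (rayEnergy β q 0 - rayEnergy β q (largestSol β q))
      (rayEnergy β q s₁ - rayEnergy β q (largestSol β q))
    rcases h.stuck_cases hβ hq hx with ⟨k, hk⟩ | h2
    · cases k with
      | none =>
        rw [hk, freeEnergy_minPoint_none β hq] at hle
        linarith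
      | some k =>
        refine ⟨some k, ?_, hk⟩
        by_cases hki : k = i
        · left; rw [hki]; rfl
        · right; exact ⟨k, hki, rfl⟩
    · linarith

theorem IsTransition.exists_landscape (hq : 2 ≤ q) (hβ : beta1 q < β)
    {m : ℕ → Option (Fin q) → Fin q → ℝ} {A B : (N : ℕ) → Set (Config N q)}
    (hAB : IsTransition β q m A B) :
    ∃ IA IB E Φ, Landscape β q IA IB E Φ ∧ (∀ N, A N = ⋃ i ∈ IA, levelSet N (m N i)) ∧
      ∀ N, B N = ⋃ i ∈ IB, levelSet N (m N i) := by
  have hβ0 : 0 < β := (beta1_nonneg q).trans_lt hβ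
  obtain ⟨s₀, h0, h1, h2⟩ := exists_raySlope_neg hq hβ
  obtain ⟨s₁, h⟩ := exists_rayShape hβ0 hq h0 h1 h2
  rcases hAB with ⟨-, hle, hA, hB⟩ | ⟨-, hlt, hA, hB⟩ | ⟨hlt, i, hA, hB⟩
  -- If `s₁` were `0`, the energy would decrease strictly from the uniform point to `m_i`, against
  -- global minimality.
  · have hs : 0 < s₁ := by
      rcases h.nonneg.eq_or_lt with h3 | h3
      · have h4 : freeEnergy β (uniformPoint q) ≤
            freeEnergy β (minPoint β q (some ⟨0, by omega⟩)) :=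
          isMinOn_of_le_beta2 hq hβ0 hle (h.minPoint_mem hq _)
        rw [show uniformPoint q = minPoint β q none from rfl, freeEnergy_minPoint_none β hq,
          freeEnergy_minPoint_some, h3] at h4
        linarith [h.energy_lt hβ0 hq]
      · exact h3
    exact ⟨_, _, _, _, h.landscape_to_uniform hβ0 hq hs, fun N => by rw [hA]; simp,
      fun N => by rw [hB]; simp⟩
  · exact ⟨_, _, _, _, h.landscape_from_uniform hβ0 hq (h.pos_of_lt hq hlt),
      fun N => by rw [hA]; simp, fun N => by rw [hB]; simp⟩
  · refine ⟨_, _, _, _, h.landscape_tunnelling hβ0 hq (not_isMinOn_of_beta2_lt hq hβ0 hlt) i,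
      fun N => by rw [hA]; simp, fun N => ?_⟩
    rw [hB, Set.biUnion_image]
    ext σ
    simp

end Landscape

/-! ### Low-energy paths on the lattice of colour frequencies -/

section LatticePaths

open Filter Topology

variable {N q : ℕ} {β : ℝ}

theorem freq_transfer (hN : 0 < N) (n : Fin q → ℕ) {i j : Fin q} (hj : 1 ≤ n j) :
    freq N (transfer n i j) = shift (freq N n) i j (1 / N) := by
  have : (N : ℝ) ≠ 0 := by exact_mod_cast hN.ne'
  funext k
  unfold freq transfer shift
  split_ifs
  · push_cast; field_simp
  · rw [Nat.cast_sub hj]; push_cast; field_simp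
  · rfl

theorem transfer_mem_lattice {n : Fin q → ℕ} (hn : n ∈ lattice N q) {i j : Fin q} (hij : i ≠ j)
    (hj : 1 ≤ n j) : transfer n i j ∈ lattice N q :=
  mem_lattice.2 ((sum_transfer hij hj).trans (mem_lattice.1 hn))

/-- Lattice points at which no unit transfer decreases the free energy. -/
def IsLatticeMin (β : ℝ) (N : ℕ) (n : Fin q → ℕ) : Prop :=
  ∀ i j, i ≠ j → 1 ≤ n j → freeEnergy β (freq N n) ≤ freeEnergy β (freq N (transfer n i j))

/-- The lattice points of free energy at most `c`. -/
def sublevel (β : ℝ) (N q : ℕ) (c : ℝ) : Finset (Fin q → ℕ) :=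
  (lattice N q).filter fun a => freeEnergy β (freq N a) ≤ c

theorem mem_sublevel {c : ℝ} {a : Fin q → ℕ} :
    a ∈ sublevel β N q c ↔ a ∈ lattice N q ∧ freeEnergy β (freq N a) ≤ c := by
  simp [sublevel]

theorem sublevel_mono {c c' : ℝ} (h : c ≤ c') : sublevel β N q c ⊆ sublevel β N q c' :=
  fun _ ha => mem_sublevel.2 ⟨(mem_sublevel.1 ha).1, (mem_sublevel.1 ha).2.trans h⟩

/-- Connection by unit transfers inside a set of lattice points. -/
abbrev Joined (s : Finset (Fin q → ℕ)) : (Fin q → ℕ) → (Fin q → ℕ) → Prop :=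
  Relation.ReflTransGen fun a b => a ∈ s ∧ b ∈ s ∧ Step a b

theorem Joined.mono {s s' : Finset (Fin q → ℕ)} (h : s ⊆ s') {a b : Fin q → ℕ}
    (hab : Joined s a b) : Joined s' a b :=
  Relation.ReflTransGen.mono (fun _ _ h' => ⟨h h'.1, h h'.2.1, h'.2.2⟩) _ _ hab

/-- Greedy descent. -/
theorem exists_joined_isLatticeMin (β : ℝ) {n : Fin q → ℕ} (hn : n ∈ lattice N q) :
    ∃ n' ∈ sublevel β N q (freeEnergy β (freq N n)), IsLatticeMin β N n' ∧
      Joined (sublevel β N q (freeEnergy β (freq N n))) n n' := by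
  induction hc : ((lattice N q).filter fun a =>
      freeEnergy β (freq N a) < freeEnergy β (freq N n)).card using Nat.strong_induction_on
    generalizing n with
  | _ c ih =>
    have hself : n ∈ sublevel β N q (freeEnergy β (freq N n)) := mem_sublevel.2 ⟨hn, le_rfl⟩
    by_cases hmin : IsLatticeMin β N n
    · exact ⟨n, hself, hmin, Relation.ReflTransGen.refl⟩
    · unfold IsLatticeMin at hmin
      push Not at hmin
      obtain ⟨i, j, hij, hj, hlt⟩ := hmin
      have hn' := transfer_mem_lattice hn hij hj
      have hsub : sublevel β N q (freeEnergy β (freq N (transfer n i j))) ⊆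
          sublevel β N q (freeEnergy β (freq N n)) := sublevel_mono hlt.le
      obtain ⟨n'', h1, h2, h3⟩ := ih _ (by
        rw [← hc]
        refine Finset.card_lt_card ⟨fun a ha => ?_, fun hcon => ?_⟩
        · rw [Finset.mem_filter] at ha ⊢
          exact ⟨ha.1, ha.2.trans hlt⟩
        · have := hcon (Finset.mem_filter.2 ⟨hn', hlt⟩)
          exact lt_irrefl _ (Finset.mem_filter.1 this).2) hn' rfl
      refine ⟨n'', hsub h1, h2, Relation.ReflTransGen.head ⟨hself, ?_, i, j, hij, hj, rfl⟩
        (Joined.mono hsub h3)⟩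
      exact mem_sublevel.2 ⟨hn', hlt.le⟩

/-- The lattice points lying coordinatewise between `n` and `t`. -/
def latticeBox (N : ℕ) (n t : Fin q → ℕ) : Finset (Fin q → ℕ) :=
  (lattice N q).filter fun a => ∀ k, min (n k) (t k) ≤ a k ∧ a k ≤ max (n k) (t k)

/-- A unit is moved from a coordinate in excess to one in deficit; the `ℓ¹` distance to `t` drops
and the path never leaves the coordinatewise box. -/
theorem joined_latticeBox {n t : Fin q → ℕ} (hn : n ∈ lattice N q) (ht : t ∈ lattice N q) :
    Joined (latticeBox N n t) n t := by
  induction hd : ∑ k, Nat.dist (n k) (t k) using Nat.strong_induction_on generalizing n with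
  | _ d ih =>
    by_cases heq : n = t
    · rw [heq]
    have hsum : ∑ k, n k = ∑ k, t k := (mem_lattice.1 hn).trans (mem_lattice.1 ht).symm
    obtain ⟨i, hi⟩ : ∃ i, n i < t i := by
      by_contra hc
      push Not at hc
      exact heq (funext fun k => ((Finset.sum_eq_sum_iff_of_le fun k _ => hc k).1 hsum.symm k
        (Finset.mem_univ k)).symm)
    obtain ⟨j, hj⟩ : ∃ j, t j < n j := by
      by_contra hc
      push Not at hc
      exact heq (funext fun k => (Finset.sum_eq_sum_iff_of_le fun k _ => hc k).1 hsum k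
        (Finset.mem_univ k))
    have hij : i ≠ j := by rintro rfl; omega
    have hj1 : 1 ≤ n j := by omega
    have hn' := transfer_mem_lattice hn hij hj1
    have hlt : ∑ k, Nat.dist (transfer n i j k) (t k) < d := by
      rw [← hd]
      refine Finset.sum_lt_sum (fun k _ => ?_) ⟨i, Finset.mem_univ i, ?_⟩
      · unfold transfer Nat.dist
        split_ifs with h1 h2
        · subst h1; omega
        · subst h2; omega
        · exact le_rfl
      · unfold transfer Nat.dist
        rw [if_pos rfl]
        omega
    have hbox : ∀ k, min (n k) (t k) ≤ transfer n i j k ∧ transfer n i j k ≤ max (n k) (t k) := by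
      intro k
      unfold transfer
      split_ifs with h1 h2
      · subst h1; omega
      · subst h2; omega
      · omega
    have hsub : latticeBox N (transfer n i j) t ⊆ latticeBox N n t := by
      intro a ha
      obtain ⟨h1, h2⟩ := Finset.mem_filter.1 ha
      refine Finset.mem_filter.2 ⟨h1, fun k => ?_⟩
      have := h2 k
      have := hbox k
      omega
    refine Relation.ReflTransGen.head ⟨?_, ?_, i, j, hij, hj1, rfl⟩
      (Joined.mono hsub (ih _ hlt hn' rfl))
    · exact Finset.mem_filter.2 ⟨hn, fun k => ⟨min_le_left _ _, le_max_left _ _⟩⟩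
    · exact Finset.mem_filter.2 ⟨hn', hbox⟩

theorem dist_freq_of_mem_latticeBox {n t a : Fin q → ℕ} (ha : a ∈ latticeBox N n t)
    {x : Fin q → ℝ} {r : ℝ} (hr : 0 ≤ r) (hn : dist (freq N n) x ≤ r)
    (ht : dist (freq N t) x ≤ r) : dist (freq N a) x ≤ r := by
  rw [dist_pi_le_iff hr] at hn ht ⊢
  intro k
  have h := (Finset.mem_filter.1 ha).2 k
  have hn := hn k
  have ht := ht k
  rw [Real.dist_eq, abs_le] at hn ht ⊢
  unfold freq at hn ht ⊢
  have hNn : (0 : ℝ) ≤ N := Nat.cast_nonneg' N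
  rcases le_total (n k) (t k) with h1 | h1
  · rw [min_eq_left h1, max_eq_right h1] at h
    have e1 : (n k : ℝ) / N ≤ a k / N :=
      div_le_div_of_nonneg_right (by exact_mod_cast h.1) hNn
    have e2 : (a k : ℝ) / N ≤ t k / N :=
      div_le_div_of_nonneg_right (by exact_mod_cast h.2) hNn
    constructor <;> linarith
  · rw [min_eq_right h1, max_eq_left h1] at h
    have e1 : (t k : ℝ) / N ≤ a k / N :=
      div_le_div_of_nonneg_right (by exact_mod_cast h.1) hNn
    have e2 : (a k : ℝ) / N ≤ n k / N :=
      div_le_div_of_nonneg_right (by exact_mod_cast h.2) hNn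
    constructor <;> linarith

/-- Compactness: a sequence of counterexamples has a limit point, which is a stuck limit with
transfers of size `1/N` and of low energy, hence one of the listed minima. -/
theorem eventually_isLatticeMin_close {IA IB : Set (Option (Fin q))} {E : ℝ}
    {Φ : (Fin q → ℝ) → ℝ} (L : Landscape β q IA IB E Φ) :
    ∃ ε > 0, ∀ ζ > 0, ∀ᶠ N : ℕ in atTop, ∀ n ∈ sublevel β N q (E + ε), IsLatticeMin β N n →
      ∃ i ∈ IA ∪ IB, dist (freq N n) (minPoint β q i) < ζ := by
  obtain ⟨ε, hε, hstuck⟩ := L.stuck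
  refine ⟨ε, hε, fun ζ hζ => ?_⟩
  by_contra hcon
  rw [not_eventually] at hcon
  have hcon' := hcon.and_eventually (eventually_gt_atTop 0)
  obtain ⟨Ns, hNs, hP⟩ := exists_seq_forall_of_frequently hcon'
  have hex : ∀ l, ∃ n ∈ sublevel β (Ns l) q (E + ε), IsLatticeMin β (Ns l) n ∧
      ∀ i ∈ IA ∪ IB, ζ ≤ dist (freq (Ns l) n) (minPoint β q i) := by
    intro l
    have := (hP l).1
    push Not at this
    exact this
  choose ns h1 h2 h3 using hex
  have hmem : ∀ l, freq (Ns l) (ns l) ∈ stdSimplex ℝ (Fin q) := fun l =>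
    freq_mem_stdSimplex (hP l).2 (mem_sublevel.1 (h1 l)).1
  obtain ⟨x, hx, u, hu, hlim⟩ := (isCompact_stdSimplex ℝ (Fin q)).tendsto_subseq hmem
  have hFx : freeEnergy β x ≤ E + ε :=
    le_of_tendsto (((continuous_freeEnergy β q).tendsto x).comp hlim)
      (Eventually.of_forall fun l => (mem_sublevel.1 (h1 (u l))).2)
  have hst : IsStuckLimit β x := by
    refine ⟨fun l => freq (Ns (u l)) (ns (u l)), fun l => 1 / (Ns (u l) : ℝ),
      fun l => hmem (u l), fun l => ?_, hlim, ?_, ?_⟩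
    · have : (0 : ℝ) < Ns (u l) := by exact_mod_cast (hP (u l)).2
      positivity
    · exact tendsto_one_div_atTop_nhds_zero_nat.comp (hNs.comp hu.tendsto_atTop)
    · intro l i j hij hl
      have hpos : (0 : ℝ) < Ns (u l) := by exact_mod_cast (hP (u l)).2
      have hj : 1 ≤ ns (u l) j := by
        unfold freq at hl
        rw [div_le_div_iff_of_pos_right hpos] at hl
        exact_mod_cast hl
      rw [← freq_transfer (hP (u l)).2 _ hj]
      exact h2 (u l) i j hij hj
  obtain ⟨i, hi, rfl⟩ := hstuck x hst hFx
  have h4 : Tendsto (fun l => dist (freq (Ns (u l)) (ns (u l))) (minPoint β q i)) atTop (𝓝 0) :=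
    tendsto_iff_dist_tendsto_zero.1 hlim
  have h5 := ge_of_tendsto h4 (Eventually.of_forall fun l => h3 (u l) i hi)
  linarith

/-- All coordinates but one are rounded down, and the remaining one collects the fractional parts.
-/
theorem exists_lattice_near (hN : 0 < N) (hq : 2 ≤ q) {x : Fin q → ℝ}
    (hx : x ∈ stdSimplex ℝ (Fin q)) :
    ∃ n ∈ lattice N q, ∀ k, |freq N n k - x k| ≤ q / N := by
  have hNr : (0 : ℝ) < N := by exact_mod_cast hN
  have hqr : (1 : ℝ) ≤ q := by exact_mod_cast (by omega : 1 ≤ q)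
  set k₀ : Fin q := ⟨0, by omega⟩
  have hfl : ∀ k, (⌊N * x k⌋₊ : ℝ) ≤ N * x k := fun k => Nat.floor_le (mul_nonneg hNr.le (hx.1 k))
  have hfl2 : ∀ k, N * x k < ⌊N * x k⌋₊ + 1 := fun k => Nat.lt_floor_add_one _
  have hsumle : ∑ k ∈ Finset.univ.erase k₀, ⌊N * x k⌋₊ ≤ N := by
    have h1 : ((∑ k ∈ Finset.univ.erase k₀, ⌊N * x k⌋₊ : ℕ) : ℝ) ≤ N := by
      push_cast
      calc _ ≤ ∑ k ∈ Finset.univ.erase k₀, N * x k := Finset.sum_le_sum fun k _ => hfl k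
        _ ≤ ∑ k, N * x k := Finset.sum_le_sum_of_subset_of_nonneg (Finset.erase_subset _ _)
            fun k _ _ => mul_nonneg hNr.le (hx.1 k)
        _ = N := by rw [← Finset.mul_sum, hx.2, mul_one]
    exact_mod_cast h1
  set n : Fin q → ℕ := fun k => if k = k₀ then N - ∑ k ∈ Finset.univ.erase k₀, ⌊N * x k⌋₊
    else ⌊N * x k⌋₊ with hn
  refine ⟨n, mem_lattice.2 ?_, fun k => ?_⟩
  · rw [← Finset.add_sum_erase _ _ (Finset.mem_univ k₀)]
    rw [Finset.sum_congr rfl fun k hk => show n k = ⌊N * x k⌋₊ by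
      simp [hn, Finset.ne_of_mem_erase hk]]
    simp only [hn, if_true]
    omega
  · have e : freq N n k - x k = (n k - N * x k) / N := by
      unfold freq; field_simp
    rw [e, abs_div, abs_of_pos hNr]
    refine div_le_div_of_nonneg_right ?_ hNr.le
    by_cases hk : k = k₀
    · subst hk
      have h1 : (n k₀ : ℝ) = N - ∑ k ∈ Finset.univ.erase k₀, (⌊N * x k⌋₊ : ℝ) := by
        simp only [hn, if_true]
        rw [Nat.cast_sub hsumle]
        push_cast
        rfl
      have h2 : (N : ℝ) - N * x k₀ = ∑ k ∈ Finset.univ.erase k₀, N * x k := by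
        have := Finset.add_sum_erase Finset.univ x (Finset.mem_univ k₀)
        rw [hx.2] at this
        rw [← Finset.mul_sum]
        linear_combination (-(N : ℝ)) * this
      have h3 : (n k₀ : ℝ) - N * x k₀ =
          ∑ k ∈ Finset.univ.erase k₀, (N * x k - ⌊N * x k⌋₊) := by
        rw [Finset.sum_sub_distrib, ← h2, h1]; ring
      rw [h3, abs_of_nonneg (Finset.sum_nonneg fun k _ => by linarith [hfl k])]
      calc _ ≤ ∑ k ∈ Finset.univ.erase k₀, (1 : ℝ) :=
            Finset.sum_le_sum fun k _ => by linarith [hfl2 k]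
        _ ≤ ∑ k : Fin q, (1 : ℝ) := Finset.sum_le_sum_of_subset_of_nonneg
            (Finset.erase_subset _ _) fun _ _ _ => zero_le_one
        _ = q := by simp
    · simp only [hn, if_neg hk]
      rw [abs_le]
      constructor <;> linarith [hfl k, hfl2 k]

theorem dist_closest_le (hN : 0 < N) (hq : 2 ≤ q) {x y : Fin q → ℝ}
    (hx : x ∈ stdSimplex ℝ (Fin q)) (hy : IsClosestLatticePoint N x y) :
    dist y x ≤ q ^ 2 / N := by
  have hNr : (0 : ℝ) < N := by exact_mod_cast hN
  have hqr : (1 : ℝ) ≤ q := by exact_mod_cast (by omega : 1 ≤ q)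
  obtain ⟨n, hn, hnx⟩ := exists_lattice_near hN hq hx
  have h1 := hy.2 (freq N n) ⟨freq_mem_stdSimplex hN hn, fun k => ⟨n k, rfl⟩⟩
  have h2 : dist (WithLp.toLp 2 (freq N n)) (WithLp.toLp 2 x) ≤ q ^ 2 / N := by
    rw [EuclideanSpace.dist_eq]
    refine Real.sqrt_le_iff.2 ⟨by positivity, ?_⟩
    calc ∑ k, dist (freq N n k) (x k) ^ 2 ≤ ∑ _k : Fin q, ((q : ℝ) / N) ^ 2 :=
          Finset.sum_le_sum fun k _ => by
            rw [Real.dist_eq]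
            exact pow_le_pow_left₀ (abs_nonneg _) (hnx k) 2
      _ = q ^ 3 / N ^ 2 := by simp; ring
      _ ≤ (q ^ 2 / N) ^ 2 := by
        rw [div_pow]
        refine div_le_div_of_nonneg_right ?_ (by positivity)
        rw [← pow_mul]
        exact pow_le_pow_right₀ hqr (by norm_num)
  refine (dist_pi_le_iff (by positivity)).2 fun k => ?_
  refine le_trans ?_ (h1.trans h2)
  rw [EuclideanSpace.dist_eq]
  refine Real.le_sqrt_of_sq_le ?_
  exact Finset.single_le_sum (f := fun k => dist (y k) (x k) ^ 2) (fun _ _ => sq_nonneg _)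
    (Finset.mem_univ k)

theorem exists_freq_eq (hN : 0 < N) {x y : Fin q → ℝ} (hy : IsClosestLatticePoint N x y) :
    ∃ t ∈ lattice N q, freq N t = y := by
  have hNr : (N : ℝ) ≠ 0 := by exact_mod_cast hN.ne'
  obtain ⟨⟨hs, hex⟩, -⟩ := hy
  choose t ht using hex
  have : freq N t = y := funext fun k => (ht k).symm
  refine ⟨t, mem_lattice.2 ?_, this⟩
  have h1 := hs.2
  rw [← this] at h1
  unfold freq at h1
  rw [← Finset.sum_div, div_eq_one_iff_eq hNr] at h1
  exact_mod_cast h1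

theorem freq_injective (hN : 0 < N) : Function.Injective (freq N : (Fin q → ℕ) → _) := by
  intro a b hab
  have hNr : (N : ℝ) ≠ 0 := by exact_mod_cast hN.ne'
  funext k
  have := congrFun hab k
  unfold freq at this
  rw [div_left_inj' hNr] at this
  exact_mod_cast this

theorem mem_levelSet_freq (hN : 0 < N) {t : Fin q → ℕ} {σ : Config N q} :
    σ ∈ levelSet N (freq N t) ↔ count σ = t := by
  have : empirical σ = freq N (count σ) := by
    funext k
    unfold empirical freq count
    push_cast
    ring
  change empirical σ = freq N t ↔ _
  rw [this]
  exact ⟨fun h => freq_injective hN h, fun h => by rw [h]⟩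

variable {m : ℕ → Option (Fin q) → Fin q → ℝ}

theorem tendsto_closest (hq : 2 ≤ q)
    (hm : ∀ N, 1 ≤ N → ∀ i, IsClosestLatticePoint N (minPoint β q i) (m N i))
    (i : Option (Fin q)) (hi : minPoint β q i ∈ stdSimplex ℝ (Fin q)) :
    Tendsto (fun N => m N i) atTop (𝓝 (minPoint β q i)) := by
  rw [tendsto_iff_dist_tendsto_zero]
  refine squeeze_zero' (Eventually.of_forall fun _ => dist_nonneg) ?_
    (tendsto_const_div_atTop_nhds_zero_nat ((q : ℝ) ^ 2))
  filter_upwards [eventually_gt_atTop 0] with N hN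
  exact dist_closest_le hN hq hi (hm N hN i)

/-- Low lattice points are connected to the minima with hardly any increase of the energy. -/
theorem Landscape.eventually_joined {IA IB : Set (Option (Fin q))} {E : ℝ}
    {Φ : (Fin q → ℝ) → ℝ} (L : Landscape β q IA IB E Φ) (hq : 2 ≤ q)
    (hm : ∀ N, 1 ≤ N → ∀ i, IsClosestLatticePoint N (minPoint β q i) (m N i)) :
    ∃ ε > 0, ∀ η > 0, ∀ᶠ N : ℕ in atTop, ∀ n ∈ sublevel β N q (E + ε),
      ∃ i ∈ IA ∪ IB, ∃ t ∈ lattice N q, freq N t = m N i ∧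
        Joined (sublevel β N q (freeEnergy β (freq N n) + η)) n t := by
  obtain ⟨ε, hε, hclose⟩ := eventually_isLatticeMin_close L
  refine ⟨ε, hε, fun η hη => ?_⟩
  have hF := continuous_freeEnergy β q
  have hζ : ∃ ζ > 0, ∀ i x, dist x (minPoint β q i) ≤ ζ →
      |freeEnergy β x - freeEnergy β (minPoint β q i)| ≤ η / 2 := by
    have h1 : ∀ i, ∃ ζ > 0, ∀ x, dist x (minPoint β q i) ≤ ζ →
        |freeEnergy β x - freeEnergy β (minPoint β q i)| ≤ η / 2 := by
      intro i
      obtain ⟨δ, hδ, h⟩ := Metric.continuous_iff.1 hF (minPoint β q i) (η / 2) (by positivity)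
      exact ⟨δ / 2, by positivity, fun x hx => (h x (by linarith)).le⟩
    choose ζ hζ hζ' using h1
    obtain ⟨i₀, hi₀⟩ := Finite.exists_min ζ
    exact ⟨ζ i₀, hζ i₀, fun i x hx => hζ' i x (hx.trans (hi₀ i))⟩
  obtain ⟨ζ, hζ, hζ'⟩ := hζ
  have hnear : ∀ᶠ N in atTop, ∀ i, dist (m N i) (minPoint β q i) < ζ :=
    eventually_all.2 fun i => (tendsto_closest hq hm i (L.mem i)).eventually
      (Metric.ball_mem_nhds _ hζ)
  filter_upwards [hclose ζ hζ, hnear, eventually_gt_atTop 0] with N h1 h2 hN n hn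
  obtain ⟨n', hn', hmin, hj⟩ := exists_joined_isLatticeMin β (mem_sublevel.1 hn).1
  have hn'' := mem_sublevel.1 hn'
  obtain ⟨i, hi, hd⟩ := h1 n' (mem_sublevel.2 ⟨hn''.1, hn''.2.trans (mem_sublevel.1 hn).2⟩) hmin
  obtain ⟨t, ht, hti⟩ := exists_freq_eq hN (hm N hN i)
  refine ⟨i, hi, t, ht, hti, ?_⟩
  -- Greedy descent leads near a minimum without climbing; inside the small ball the box path
  -- changes the energy by at most `η`.
  refine (Joined.mono (sublevel_mono (by linarith)) hj).trans
    (Joined.mono ?_ (joined_latticeBox hn''.1 ht))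
  intro a ha
  refine mem_sublevel.2 ⟨(Finset.mem_filter.1 ha).1, ?_⟩
  have h3 := dist_freq_of_mem_latticeBox ha hζ.le hd.le (by rw [hti]; exact (h2 i).le)
  have h4 := abs_le.1 (hζ' i _ h3)
  have h5 := abs_le.1 (hζ' i _ hd.le)
  linarith [hn''.2]

end LatticePaths

/-! ### Comparison of random and CWP conductances -/

section Comparison

variable {N q : ℕ} {β : ℝ}

/-- The deviation of the disordered energy from the Curie-Weiss-Potts energy. -/
def energyDev (w : ℕ → ℕ → ℝ) (σ : Config N q) : ℝ :=
  hamiltonian w σ - hamiltonian (fun _ _ => 1) σ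

theorem weight_eq_mul (β : ℝ) (w : ℕ → ℕ → ℝ) (σ : Config N q) :
    weight β w σ = weight β (fun _ _ => 1) σ * Real.exp (-β * energyDev w σ) := by
  unfold weight energyDev
  rw [← Real.exp_add]
  ring_nf

/-- Conductances depend on the larger endpoint energy only, so a one-sided bound on the deviation at
both endpoints suffices. -/
theorem cond_one_le (hβ : 0 ≤ β) (w : ℕ → ℕ → ℝ) {σ η : Config N q} (hne : σ ≠ η) {d : ℝ}
    (h1 : energyDev w σ ≤ d) (h2 : energyDev w η ≤ d) :
    cond β (fun _ _ => 1) σ η ≤ Real.exp (β * d) * cond β w σ η := by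
  rw [cond_eq β _ hne, cond_eq β _ hne]
  split_ifs
  · rw [mul_left_comm, ← Real.exp_add]
    refine mul_le_mul_of_nonneg_left (Real.exp_le_exp.2 ?_) (by positivity)
    have : max (hamiltonian w σ) (hamiltonian w η) ≤
        d + max (hamiltonian (fun _ _ => 1) σ) (hamiltonian (fun _ _ => 1) η) := by
      unfold energyDev at h1 h2
      refine max_le ?_ ?_
      · linarith [le_max_left (hamiltonian (fun _ _ => 1) σ) (hamiltonian (fun _ _ => 1) η)]
      · linarith [le_max_right (hamiltonian (fun _ _ => 1) σ) (hamiltonian (fun _ _ => 1) η)]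
    nlinarith [mul_le_mul_of_nonneg_left this hβ]
  · simp

theorem cond_le_one (hβ : 0 ≤ β) (w : ℕ → ℕ → ℝ) {σ η : Config N q} (hne : σ ≠ η) {d : ℝ}
    (h1 : -d ≤ energyDev w σ) (h2 : -d ≤ energyDev w η) :
    cond β w σ η ≤ Real.exp (β * d) * cond β (fun _ _ => 1) σ η := by
  rw [cond_eq β _ hne, cond_eq β _ hne]
  split_ifs
  · rw [mul_left_comm, ← Real.exp_add]
    refine mul_le_mul_of_nonneg_left (Real.exp_le_exp.2 ?_) (by positivity)
    have : max (hamiltonian (fun _ _ => 1) σ) (hamiltonian (fun _ _ => 1) η) ≤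
        d + max (hamiltonian w σ) (hamiltonian w η) := by
      unfold energyDev at h1 h2
      refine max_le ?_ ?_
      · linarith [le_max_left (hamiltonian w σ) (hamiltonian w η)]
      · linarith [le_max_right (hamiltonian w σ) (hamiltonian w η)]
    nlinarith [mul_le_mul_of_nonneg_left this hβ]
  · simp

theorem exp_mul_max_le (a b c : ℝ) :
    Real.exp (c * max a b) ≤ Real.exp (c * a) + Real.exp (c * b) := by
  have h1 := Real.exp_pos (c * a)
  have h2 := Real.exp_pos (c * b)
  rcases max_choice a b with h | h <;> rw [h] <;> linarith

theorem exp_mul_min_le (a b c : ℝ) :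
    Real.exp (c * min a b) ≤ Real.exp (c * a) + Real.exp (c * b) := by
  have h1 := Real.exp_pos (c * a)
  have h2 := Real.exp_pos (c * b)
  rcases min_choice a b with h | h <;> rw [h] <;> linarith

theorem cond_nonneg (hβ : 0 ≤ β) (w : ℕ → ℕ → ℝ) (σ η : Config N q) : 0 ≤ cond β w σ η :=
  (reversible hβ w).conductance_nonneg σ η

/-- The maximum of the two deviations is replaced by a sum of exponentials, each involving a single
configuration, so that moment bounds apply termwise. -/
theorem cond_one_le_add (hβ : 0 ≤ β) (w : ℕ → ℕ → ℝ) {σ η : Config N q} (hne : σ ≠ η) :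
    cond β (fun _ _ => 1) σ η ≤
      (Real.exp (β * energyDev w σ) + Real.exp (β * energyDev w η)) * cond β w σ η :=
  (cond_one_le hβ w hne (le_max_left _ _) (le_max_right _ _)).trans
    (mul_le_mul_of_nonneg_right (exp_mul_max_le _ _ _) (cond_nonneg hβ w σ η))

theorem cond_le_one_add (hβ : 0 ≤ β) (w : ℕ → ℕ → ℝ) {σ η : Config N q} (hne : σ ≠ η) :
    cond β w σ η ≤ (Real.exp (-β * energyDev w σ) + Real.exp (-β * energyDev w η)) *
      cond β (fun _ _ => 1) σ η := by
  refine (cond_le_one hβ w hne (d := -min (energyDev w σ) (energyDev w η))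
    (by rw [neg_neg]; exact min_le_left _ _) (by rw [neg_neg]; exact min_le_right _ _)).trans
    (mul_le_mul_of_nonneg_right ?_ (cond_nonneg hβ _ σ η))
  have := exp_mul_min_le (energyDev w σ) (energyDev w η) (-β)
  rwa [show β * -min (energyDev w σ) (energyDev w η) =
    -β * min (energyDev w σ) (energyDev w η) by ring]

end Comparison

/-! ### Poincare inequality and weak-type bounds in a valley -/

section Valleys

open Filter Topology

variable {N q : ℕ} {β : ℝ}

/-- The configurations whose colour counts belong to `s`. -/
def configs (N : ℕ) {q : ℕ} (s : Finset (Fin q → ℕ)) : Finset (Config N q) :=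
  Finset.univ.filter fun σ => count σ ∈ s

@[simp] theorem mem_configs {s : Finset (Fin q → ℕ)} {σ : Config N q} :
    σ ∈ configs N s ↔ count σ ∈ s := by simp [configs]

theorem sum_configs (s : Finset (Fin q → ℕ)) (g : Config N q → ℝ) :
    ∑ σ ∈ configs N s, g σ = ∑ n ∈ s, ∑ σ ∈ level N n, g σ := by
  rw [← Finset.sum_fiberwise_of_maps_to (s := configs N s) (t := s) (g := count)
    fun σ hσ => mem_configs.1 hσ]
  refine Finset.sum_congr rfl fun n hn => Finset.sum_congr ?_ fun _ _ => rfl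
  ext σ
  simp only [Finset.mem_filter, mem_configs, mem_level]
  exact ⟨fun h => h.2, fun h => ⟨h ▸ hn, h⟩⟩

theorem count_mem_lattice (σ : Config N q) : count σ ∈ lattice N q := mem_lattice.2 (sum_count σ)

theorem sum_weight_configs (β : ℝ) (s : Finset (Fin q → ℕ)) :
    ∑ σ ∈ configs N s, weight β (fun _ _ => 1) σ = ∑ n ∈ s, levelWeight β N n := by
  rw [sum_configs]
  exact Finset.sum_congr rfl fun n _ => sum_weight_level β n

/-- Each level contributes its path bound. A path rising by at most `η` costs `e^{βηN}` in the ratio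
of level weights, and the polynomial number of levels and path lengths is absorbed in `e^{κN}`. -/
theorem eventually_poincare (q : ℕ) (hβ : 0 < β) {η κ : ℝ} (hκ : 0 < κ) :
    ∀ᶠ N : ℕ in atTop, ∀ s ⊆ lattice N q, ∀ T : Set (Config N q),
      (∀ n ∈ s, ∃ t, Joined (sublevel β N q (freeEnergy β (freq N n) + η)) n t ∧
        ∀ σ ∈ level N t, σ ∈ T) → ∀ f : Config N q → ℝ, (∀ σ ∈ T, f σ = 0) →
      ∑ σ ∈ configs N s, weight β (fun _ _ => 1) σ * f σ ^ 2 ≤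
        Real.exp ((β * η + κ) * N) * dirichlet (cond β fun _ _ => 1) f f := by
  filter_upwards [eventually_levelWeight_bounds q hβ (κ := κ / 3) (by positivity),
    eventually_pow_le_exp (2 * q) (3 * q + 1) (κ := κ / 3) (by positivity)]
    with N hW hpoly s hs T hT f hf
  have hD : 0 ≤ dirichlet (cond β fun _ _ => 1) f f :=
    dirichlet_nonneg _ (cond_nonneg hβ.le _) f
  have hN1 : (1 : ℝ) ≤ (N : ℝ) + 1 := by linarith [(Nat.cast_nonneg' N : (0 : ℝ) ≤ N)]
  have hcard : ∀ s ⊆ lattice N q, (s.card : ℝ) ≤ ((N : ℝ) + 1) ^ q := fun s hs => by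
    exact_mod_cast (Finset.card_le_card hs).trans (card_lattice_le N q)
  have hlev : ∀ n ∈ s, ∑ σ ∈ level N n, weight β (fun _ _ => 1) σ * f σ ^ 2 ≤
      Real.exp ((β * η + 2 * (κ / 3)) * N) * ((((N : ℝ) + 1) ^ q) ^ 2 * (2 * (N * q))) *
        dirichlet (cond β fun _ _ => 1) f f := by
    intro n hn
    obtain ⟨t, hj, ht⟩ := hT n hn
    set c := freeEnergy β (freq N n) + η with hc
    have h1 := sum_level_sq_le hβ.le (sublevel β N q c)
      (fun a ha => mem_lattice.1 (mem_sublevel.1 ha).1)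
      (ω := Real.exp (-(β * N * c) - κ / 3 * N)) (Real.exp_pos _) (fun a ha => by
        refine le_trans (Real.exp_le_exp.2 ?_) (hW a (mem_sublevel.1 ha).1).1
        have : β * N * freeEnergy β (freq N a) ≤ β * N * c :=
          mul_le_mul_of_nonneg_left (mem_sublevel.1 ha).2 (by positivity)
        linarith) (mem_lattice.1 (hs hn)) hj f (fun σ hσ => hf σ (ht σ hσ))
    refine h1.trans ?_
    calc levelWeight β N n * (((sublevel β N q c).card : ℝ) ^ 2 *
          (2 * (N * q) * dirichlet (cond β fun _ _ => 1) f f /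
            Real.exp (-(β * N * c) - κ / 3 * N)))
        ≤ Real.exp (-(β * N * freeEnergy β (freq N n)) + κ / 3 * N) *
          ((((N : ℝ) + 1) ^ q) ^ 2 * (2 * (N * q) * dirichlet (cond β fun _ _ => 1) f f /
            Real.exp (-(β * N * c) - κ / 3 * N))) := by
          gcongr
          · exact (hW n (hs hn)).2
          · exact hcard _ (Finset.filter_subset _ _)
      _ = Real.exp (-(β * N * freeEnergy β (freq N n)) + κ / 3 * N) /
            Real.exp (-(β * N * c) - κ / 3 * N) * ((((N : ℝ) + 1) ^ q) ^ 2 * (2 * (N * q))) *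
            dirichlet (cond β fun _ _ => 1) f f := by ring
      _ = _ := by
          rw [← Real.exp_sub, hc]
          congr 3
          ring
  rw [sum_configs]
  have hpoly' : ((N : ℝ) + 1) ^ q * ((((N : ℝ) + 1) ^ q) ^ 2 * (2 * (N * q))) ≤
      Real.exp (κ / 3 * N) := by
    refine le_trans ?_ hpoly
    push_cast
    have : (N : ℝ) ≤ (N : ℝ) + 1 := by linarith
    calc ((N : ℝ) + 1) ^ q * ((((N : ℝ) + 1) ^ q) ^ 2 * (2 * (N * q)))
        ≤ ((N : ℝ) + 1) ^ q * ((((N : ℝ) + 1) ^ q) ^ 2 * (2 * (((N : ℝ) + 1) * q))) := by gcongr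
      _ = _ := by ring
  calc ∑ n ∈ s, ∑ σ ∈ level N n, weight β (fun _ _ => 1) σ * f σ ^ 2
      ≤ ∑ n ∈ s, Real.exp ((β * η + 2 * (κ / 3)) * N) *
        ((((N : ℝ) + 1) ^ q) ^ 2 * (2 * (N * q))) * dirichlet (cond β fun _ _ => 1) f f :=
        Finset.sum_le_sum hlev
    _ = s.card * (Real.exp ((β * η + 2 * (κ / 3)) * N) *
        ((((N : ℝ) + 1) ^ q) ^ 2 * (2 * (N * q))) * dirichlet (cond β fun _ _ => 1) f f) := by
        rw [Finset.sum_const, nsmul_eq_mul]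
    _ ≤ ((N : ℝ) + 1) ^ q * (Real.exp ((β * η + 2 * (κ / 3)) * N) *
        ((((N : ℝ) + 1) ^ q) ^ 2 * (2 * (N * q))) * dirichlet (cond β fun _ _ => 1) f f) := by
        gcongr
        exact hcard s hs
    _ = Real.exp ((β * η + 2 * (κ / 3)) * N) * (((N : ℝ) + 1) ^ q *
        ((((N : ℝ) + 1) ^ q) ^ 2 * (2 * (N * q)))) * dirichlet (cond β fun _ _ => 1) f f := by
        ring
    _ ≤ Real.exp ((β * η + 2 * (κ / 3)) * N) * Real.exp (κ / 3 * N) *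
        dirichlet (cond β fun _ _ => 1) f f := by gcongr
    _ = _ := by
        rw [← Real.exp_add]
        congr 2
        ring

/-- If `g` exceeds `2^{-(J+1)}`, the new summand `2^{-J}` replaces the remainder of the previous
stage; otherwise `g` lies below the new remainder itself. -/
theorem le_dyadic_sum {g : ℝ} (hg : g ≤ 1) (J : ℕ) :
    g ≤ (1 / 2) ^ J +
      ∑ j ∈ Finset.range J, (1 / 2 : ℝ) ^ j * if (1 / 2 : ℝ) ^ (j + 1) ≤ g then 1 else 0 := by
  induction J with
  | zero => simpa using hg
  | succ J ih =>
    rw [Finset.sum_range_succ]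
    have hS : 0 ≤ ∑ j ∈ Finset.range J,
        (1 / 2 : ℝ) ^ j * if (1 / 2 : ℝ) ^ (j + 1) ≤ g then (1 : ℝ) else 0 :=
      Finset.sum_nonneg fun j _ => by positivity
    split_ifs with h
    · have : (0 : ℝ) ≤ (1 / 2) ^ (J + 1) := by positivity
      linarith
    · rw [not_le] at h
      linarith

/-- Layer decomposition of a sum with weak-type control of the level sets. -/
theorem sum_le_of_weak_type {S : Type} (D : Finset S) (m g : S → ℝ) (hm : ∀ σ, 0 ≤ m σ)
    (hg : ∀ σ, g σ ≤ 1) {Q : ℝ} (J : ℕ)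
    (h : ∀ t : ℝ, 0 < t → t ≤ 1 → ∑ σ ∈ D, m σ * (if t ≤ g σ then 1 else 0) ≤ Q / t) :
    ∑ σ ∈ D, m σ * g σ ≤ (1 / 2) ^ J * ∑ σ ∈ D, m σ + 2 * J * Q := by
  calc ∑ σ ∈ D, m σ * g σ ≤ ∑ σ ∈ D, m σ * ((1 / 2) ^ J + ∑ j ∈ Finset.range J,
        (1 / 2 : ℝ) ^ j * if (1 / 2 : ℝ) ^ (j + 1) ≤ g σ then 1 else 0) :=
        Finset.sum_le_sum fun σ _ => mul_le_mul_of_nonneg_left (le_dyadic_sum (hg σ) J) (hm σ)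
    _ = (1 / 2) ^ J * ∑ σ ∈ D, m σ + ∑ j ∈ Finset.range J, (1 / 2 : ℝ) ^ j *
        ∑ σ ∈ D, m σ * (if (1 / 2 : ℝ) ^ (j + 1) ≤ g σ then 1 else 0) := by
        simp_rw [mul_add, Finset.mul_sum]
        rw [Finset.sum_add_distrib, Finset.sum_comm]
        congr 1
        · exact Finset.sum_congr rfl fun σ _ => mul_comm _ _
        · exact Finset.sum_congr rfl fun j _ => Finset.sum_congr rfl fun σ _ => by ring
    _ ≤ (1 / 2) ^ J * ∑ σ ∈ D, m σ + ∑ j ∈ Finset.range J, (1 / 2 : ℝ) ^ j *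
        (Q / (1 / 2 : ℝ) ^ (j + 1)) := by
        gcongr with j _
        exact h _ (by positivity) (pow_le_one₀ (by norm_num) (by norm_num))
    _ = _ := by
        have : ∀ j ∈ Finset.range J, (1 / 2 : ℝ) ^ j * (Q / (1 / 2 : ℝ) ^ (j + 1)) = 2 * Q := by
          intro j _
          rw [pow_succ]
          field_simp
        rw [Finset.sum_congr rfl this, Finset.sum_const, Finset.card_range, nsmul_eq_mul]
        ring

/-- A function with a Poincare inequality towards the zero set of a potential has weak-type
control of the potential. -/
theorem IsPotential.sum_weak_type (hβ : 0 ≤ β) {w : ℕ → ℕ → ℝ} {A B : Set (Config N q)}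
    {h : Config N q → ℝ} (hh : IsPotential (transProb β w) A B h) {d : ℝ}
    (hd : ∀ σ : Config N q, energyDev w σ ≤ d) {D : Finset (Config N q)} {K : ℝ} (hK : 0 ≤ K)
    (hp : ∀ f : Config N q → ℝ, (∀ σ ∈ B, f σ = 0) →
      ∑ σ ∈ D, weight β (fun _ _ => 1) σ * f σ ^ 2 ≤
        K * dirichlet (cond β fun _ _ => 1) f f) {t : ℝ} (ht0 : 0 < t) (ht1 : t ≤ 1) :
    ∑ σ ∈ D, weight β (fun _ _ => 1) σ * (if t ≤ h σ then 1 else 0) ≤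
      K * Real.exp (β * d) * dirichlet (cond β w) h h / t := by
  have h1 := hp (fun σ => min (h σ) t) fun σ hσ => by simp [hh.zero σ hσ, ht0.le]
  have h2 := dirichlet_le_of_le (c := cond β fun _ _ => 1) (c' := cond β w)
    (fun σ η hne => cond_one_le hβ w hne (hd σ) (hd η)) (fun σ => min (h σ) t)
  have h3 := hh.dirichlet_min_le (reversible hβ w) ht0.le ht1
  -- Chebyshev's inequality for the truncated potential. The energy of the truncation carries a
  -- factor `t`, so the final bound is of order `1/t` rather than `1/t²`, and the dyadic sum loses
  -- only the number of layers.
  have h4 : t ^ 2 * ∑ σ ∈ D, weight β (fun _ _ => 1) σ * (if t ≤ h σ then 1 else 0) ≤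
      ∑ σ ∈ D, weight β (fun _ _ => 1) σ * min (h σ) t ^ 2 := by
    rw [Finset.mul_sum]
    refine Finset.sum_le_sum fun σ _ => ?_
    rw [mul_left_comm]
    refine mul_le_mul_of_nonneg_left ?_ (weight_pos _ _ _).le
    split_ifs with hc
    · rw [min_eq_right hc, mul_one]
    · rw [mul_zero]; positivity
  rw [le_div_iff₀ ht0]
  have h5 : t ^ 2 * ∑ σ ∈ D, weight β (fun _ _ => 1) σ * (if t ≤ h σ then 1 else 0) ≤
      K * (Real.exp (β * d) * (t * dirichlet (cond β w) h h)) := by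
    refine (h4.trans h1).trans (mul_le_mul_of_nonneg_left (h2.trans ?_) hK)
    exact mul_le_mul_of_nonneg_left h3 (Real.exp_pos _).le
  refine le_of_mul_le_mul_left ?_ ht0
  calc _ = t ^ 2 * ∑ σ ∈ D, weight β (fun _ _ => 1) σ * (if t ≤ h σ then 1 else 0) := by ring
    _ ≤ _ := h5
    _ = _ := by ring

/-- The energy of an indicator is at most the weight of the boundary. -/
theorem dirichlet_indicator_le (hβ : 0 ≤ β) (V : Set (Config N q)) (D : Finset (Config N q))
    (hD : ∀ σ η : Config N q, hammingDist σ η = 1 → ¬ (σ ∈ V ↔ η ∈ V) → σ ∈ D) :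
    dirichlet (cond β fun _ _ => 1) (V.indicator fun _ => 1) (V.indicator fun _ => 1) ≤
      ∑ σ ∈ D, weight β (fun _ _ => 1) σ := by
  classical
  have hP := reversible (N := N) (q := q) hβ fun _ _ => 1
  set f : Config N q → ℝ := V.indicator fun _ => 1 with hf
  have hdiff : ∀ σ η, (f σ - f η) * (f σ - f η) ≤ 1 := by
    intro σ η
    by_cases h1 : σ ∈ V <;> by_cases h2 : η ∈ V <;> simp [hf, h1, h2]
  have hrow : ∀ σ, ∑ η, cond β (fun _ _ => 1) σ η * ((f σ - f η) * (f σ - f η)) ≤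
      if σ ∈ D then weight β (fun _ _ => 1) σ else 0 := by
    intro σ
    split_ifs with hσ
    · calc _ ≤ ∑ η, cond β (fun _ _ => 1) σ η * 1 := Finset.sum_le_sum fun η _ =>
            mul_le_mul_of_nonneg_left (hdiff σ η) (cond_nonneg hβ _ σ η)
        _ = weight β (fun _ _ => 1) σ := by
          simp only [mul_one, cond, conductance]
          rw [← Finset.mul_sum, hP.sum_eq_one, mul_one]
    · refine (Finset.sum_eq_zero fun η _ => ?_).le
      rcases eq_or_ne σ η with rfl | hne
      · simp
      rw [cond_eq β _ hne]
      split_ifs with h1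
      · have : σ ∈ V ↔ η ∈ V := by
          by_contra hc
          exact hσ (hD σ η h1 hc)
        have h2 : f σ = f η := by
          by_cases h3 : σ ∈ V
          · simp [hf, h3, this.1 h3]
          · have h4 : η ∉ V := fun hc => h3 (this.2 hc)
            simp [hf, h3, h4]
        rw [h2]; simp
      · simp
  have h1 := Finset.sum_le_sum fun σ (_ : σ ∈ Finset.univ) => hrow σ
  rw [Finset.sum_ite_mem, Finset.univ_inter] at h1
  have h0 := dirichlet_nonneg (cond β fun _ _ => 1) (cond_nonneg hβ _) f
  unfold dirichlet at h0 ⊢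
  linarith

end Valleys

/-! ### Lattice edges crossing the wall have high energy -/

section Wall

open Filter Topology

variable {q : ℕ} {β : ℝ} {IA IB : Set (Option (Fin q))} {E : ℝ} {Φ : (Fin q → ℝ) → ℝ}

theorem Step.dist_freq_le {N : ℕ} (hN : 0 < N) {n n' : Fin q → ℕ} (h : Step n n') :
    dist (freq N n') (freq N n) ≤ 1 / N := by
  obtain ⟨i, j, -, hj, rfl⟩ := h
  rw [freq_transfer hN n hj]
  exact dist_shift_le _ (by positivity)

theorem Step.mem_lattice {N : ℕ} {n n' : Fin q → ℕ} (h : Step n n') (hn : n ∈ lattice N q) :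
    n' ∈ lattice N q := by
  obtain ⟨i, j, hij, hj, rfl⟩ := h
  exact transfer_mem_lattice hn hij hj

theorem step_count_of_hammingDist {N : ℕ} {σ η : Config N q} (h : hammingDist σ η = 1) :
    Step (count σ) (count η) := by
  obtain ⟨v, hv⟩ := Finset.card_eq_one.1 h
  have hne : σ v ≠ η v := by
    have : v ∈ (Finset.univ.filter fun i => σ i ≠ η i) := by rw [hv]; simp
    simpa using this
  have hη : η = Function.update σ v (η v) := by
    funext u
    by_cases hu : u = v
    · subst hu; simp
    · have : u ∉ (Finset.univ.filter fun i => σ i ≠ η i) := by rw [hv]; simpa using hu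
      rw [Function.update_of_ne hu]
      exact (by simpa using this : σ u = η u).symm
  refine ⟨η v, σ v, hne.symm, ?_, ?_⟩
  · unfold count
    refine le_trans ?_ (Finset.single_le_sum (f := fun i => if σ i = σ v then 1 else 0)
      (fun _ _ => Nat.zero_le _) (Finset.mem_univ v))
    simp
  · conv_lhs => rw [hη]
    exact count_update hne.symm rfl

/-- By compactness the energy on the wall exceeds `E` by a definite amount. The segment of an edge
whose endpoints have different signs meets the wall at distance at most `1/N`, so uniform continuity
costs at most half of the gap. -/
theorem Landscape.exists_wall_gap (L : Landscape β q IA IB E Φ) :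
    ∃ e₀ > 0, ∀ e ≤ e₀, ∀ᶠ N : ℕ in atTop, ∀ n ∈ lattice N q, ∀ n', Step n n' →
      ¬ (0 < Φ (freq N n) ↔ 0 < Φ (freq N n')) → E + e ≤ freeEnergy β (freq N n) := by
  have hF := continuous_freeEnergy β q
  have hK : IsCompact (stdSimplex ℝ (Fin q) ∩ {x | Φ x = 0}) :=
    (isCompact_stdSimplex ℝ (Fin q)).inter_right (isClosed_eq L.cont continuous_const)
  obtain ⟨a, ha, hKa⟩ := hK.exists_forall_le' hF.continuousOn (a := E)
    fun x hx => L.wall x hx.1 hx.2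
  refine ⟨(a - E) / 2, by linarith, fun e he => ?_⟩
  have hu := (isCompact_stdSimplex ℝ (Fin q)).uniformContinuousOn_of_continuous hF.continuousOn
  obtain ⟨δ, hδ, hu⟩ := Metric.uniformContinuousOn_iff.1 hu ((a - E) / 2) (by linarith)
  have hlim : ∀ᶠ N : ℕ in atTop, 1 / (N : ℝ) < δ :=
    (tendsto_const_div_atTop_nhds_zero_nat 1).eventually (gt_mem_nhds hδ)
  filter_upwards [hlim, eventually_gt_atTop 0] with N hNδ hN n hn n' hnn' hsign
  have hx := freq_mem_stdSimplex hN hn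
  have hy := freq_mem_stdSimplex hN (hnn'.mem_lattice hn)
  have hseg : segment ℝ (freq N n) (freq N n') ⊆ stdSimplex ℝ (Fin q) :=
    (convex_stdSimplex ℝ (Fin q)).segment_subset hx hy
  have hconn : IsPreconnected (segment ℝ (freq N n) (freq N n')) :=
    (convex_segment _ _).isPreconnected
  have hz : ∃ z ∈ segment ℝ (freq N n) (freq N n'), Φ z = 0 := by
    have hl := left_mem_segment ℝ (freq N n) (freq N n')
    have hr := right_mem_segment ℝ (freq N n) (freq N n')
    by_cases h1 : 0 < Φ (freq N n)
    · have h2 : Φ (freq N n') ≤ 0 := by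
        by_contra hc
        exact hsign ⟨fun _ => not_le.1 hc, fun _ => h1⟩
      exact hconn.intermediate_value hr hl L.cont.continuousOn ⟨h2, h1.le⟩
    · have h2 : 0 < Φ (freq N n') := by
        by_contra hc
        exact hsign ⟨fun h => absurd h h1, fun h => absurd h hc⟩
      exact hconn.intermediate_value hl hr L.cont.continuousOn ⟨not_lt.1 h1, h2.le⟩
  obtain ⟨z, hz, hz0⟩ := hz
  have hdist : dist (freq N n) z < δ := by
    rw [dist_comm]
    refine lt_of_le_of_lt ?_ hNδ
    refine le_trans ?_ (hnn'.dist_freq_le hN)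
    have := (convex_closedBall (freq N n) (dist (freq N n') (freq N n))).segment_subset
      (Metric.mem_closedBall_self dist_nonneg) (Metric.mem_closedBall.2 le_rfl) hz
    exact Metric.mem_closedBall.1 this
  have h1 := hu _ hx z (hseg hz) hdist
  have h2 := hKa z ⟨hseg hz, hz0⟩
  rw [Real.dist_eq, abs_lt] at h1
  linarith

end Wall

/-! ### Positions of the starting and target sets relative to the wall -/

section Deterministic

open Filter Topology

variable {q : ℕ} {β : ℝ} {IA IB : Set (Option (Fin q))} {E : ℝ} {Φ : (Fin q → ℝ) → ℝ}
  {m : ℕ → Option (Fin q) → Fin q → ℝ} {A B : (N : ℕ) → Set (Config N q)}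

theorem Landscape.eventually_sign (L : Landscape β q IA IB E Φ) (hq : 2 ≤ q)
    (hm : ∀ N, 1 ≤ N → ∀ i, IsClosestLatticePoint N (minPoint β q i) (m N i)) :
    ∀ᶠ N : ℕ in atTop, (∀ i ∈ IA, 0 < Φ (m N i)) ∧ ∀ i ∈ IB, Φ (m N i) < 0 := by
  refine Eventually.and ?_ ?_
  · refine eventually_all.2 fun i => ?_
    by_cases hi : i ∈ IA
    · filter_upwards [((L.cont.tendsto _).comp (tendsto_closest hq hm i (L.mem i))).eventually
        (lt_mem_nhds (L.posA i hi))] with N h _ using h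
    · exact Eventually.of_forall fun N h => absurd h hi
  · refine eventually_all.2 fun i => ?_
    by_cases hi : i ∈ IB
    · filter_upwards [((L.cont.tendsto _).comp (tendsto_closest hq hm i (L.mem i))).eventually
        (gt_mem_nhds (L.negB i hi))] with N h _ using h
    · exact Eventually.of_forall fun N h => absurd h hi

theorem Landscape.eventually_nonempty_disjoint (L : Landscape β q IA IB E Φ) (hq : 2 ≤ q)
    (hm : ∀ N, 1 ≤ N → ∀ i, IsClosestLatticePoint N (minPoint β q i) (m N i))
    (hA : ∀ N, A N = ⋃ i ∈ IA, levelSet N (m N i))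
    (hB : ∀ N, B N = ⋃ i ∈ IB, levelSet N (m N i)) :
    ∀ᶠ N : ℕ in atTop, Disjoint (A N) (B N) ∧ (A N).Nonempty ∧ (B N).Nonempty := by
  filter_upwards [L.eventually_sign hq hm, eventually_gt_atTop 0] with N hs hN
  have hne : ∀ I : Set (Option (Fin q)), I.Nonempty →
      (⋃ i ∈ I, levelSet N (m N i) : Set (Config N q)).Nonempty := by
    rintro I ⟨i, hi⟩
    obtain ⟨t, ht, hti⟩ := exists_freq_eq hN (hm N hN i)
    obtain ⟨σ, hσ⟩ := Finset.card_pos.1 (card_level_pos (mem_lattice.1 ht))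
    refine ⟨σ, Set.mem_biUnion hi ?_⟩
    rw [← hti]
    exact (mem_levelSet_freq hN).2 (mem_level.1 hσ)
  refine ⟨?_, by rw [hA]; exact hne _ L.nonemptyA, by rw [hB]; exact hne _ L.nonemptyB⟩
  rw [hA, hB, Set.disjoint_left]
  intro σ h1 h2
  simp only [Set.mem_iUnion] at h1 h2
  obtain ⟨i, hi, h1⟩ := h1
  obtain ⟨j, hj, h2⟩ := h2
  have h1 : empirical σ = m N i := h1
  have h2 : empirical σ = m N j := h2
  have h3 := hs.1 i hi
  have h4 := hs.2 j hj
  rw [← h1] at h3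
  rw [← h2] at h4
  linarith

/-- A path of unit transfers can change the sign of `Φ` only at wall height, which it never reaches.
-/
theorem Joined.sign_iff {N : ℕ} {c c' : ℝ} (hc : c < c')
    (hwall : ∀ n ∈ lattice N q, ∀ n', Step n n' →
      ¬ (0 < Φ (freq N n) ↔ 0 < Φ (freq N n')) → c' ≤ freeEnergy β (freq N n))
    {n t : Fin q → ℕ} (h : Joined (sublevel β N q c) n t) :
    0 < Φ (freq N n) ↔ 0 < Φ (freq N t) := by
  induction h with
  | refl => exact Iff.rfl
  | tail _ hab ih =>
    refine ih.trans ?_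
    by_contra hcon
    have h1 := mem_sublevel.1 hab.1
    linarith [hwall _ h1.1 _ hab.2.2 hcon]

end Deterministic

/-! ### The equilibrium potential concentrates on the starting valley -/

section Concentration

open Filter Topology

variable {N q : ℕ} {β : ℝ}

/-- The potential is summed by layers. The three factors `e^{βd}` come from changing the weights,
from comparing Dirichlet forms in the Poincare inequality, and from bounding the random capacity by
the CWP energy of the test function `g`. -/
theorem sum_weight_mul_potential_le (hβ : 0 ≤ β) {w : ℕ → ℕ → ℝ} {A B : Set (Config N q)}
    {h : Config N q → ℝ} (hh : IsPotential (transProb β w) A B h) {d : ℝ}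
    (hd : ∀ σ : Config N q, |energyDev w σ| ≤ d) {D : Finset (Config N q)} {K : ℝ} (hK : 0 ≤ K)
    (hp : ∀ f : Config N q → ℝ, (∀ σ ∈ B, f σ = 0) →
      ∑ σ ∈ D, weight β (fun _ _ => 1) σ * f σ ^ 2 ≤ K * dirichlet (cond β fun _ _ => 1) f f)
    {g : Config N q → ℝ} (hgA : ∀ σ ∈ A, g σ = 1) (hgB : ∀ σ ∈ B, g σ = 0) {Q : ℝ}
    (hg : dirichlet (cond β fun _ _ => 1) g g ≤ Q) (J : ℕ) :
    ∑ σ ∈ D, weight β w σ * h σ ≤ Real.exp (β * d) * ((1 / 2) ^ J *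
      ∑ σ ∈ D, weight β (fun _ _ => 1) σ +
        2 * J * (K * Real.exp (β * d) * (Real.exp (β * d) * Q))) := by
  have hC : dirichlet (cond β w) h h ≤ Real.exp (β * d) * Q := by
    refine (hh.dirichlet_le (reversible hβ w) g hgA hgB).trans ?_
    refine (dirichlet_le_of_le (c' := cond β fun _ _ => 1) (fun σ η hne =>
      cond_le_one hβ w hne (neg_le_of_abs_le (hd σ)) (neg_le_of_abs_le (hd η))) g).trans ?_
    exact mul_le_mul_of_nonneg_left hg (Real.exp_pos _).le
  have h1 := sum_le_of_weak_type D (weight β fun _ _ => 1) h (fun σ => (weight_pos _ _ σ).le)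
    hh.le_one (Q := K * Real.exp (β * d) * (Real.exp (β * d) * Q)) J fun t ht0 ht1 => by
      refine (hh.sum_weak_type hβ (fun σ => le_of_abs_le (hd σ)) hK hp ht0 ht1).trans ?_
      gcongr
  calc ∑ σ ∈ D, weight β w σ * h σ
      ≤ ∑ σ ∈ D, Real.exp (β * d) * (weight β (fun _ _ => 1) σ * h σ) := by
        refine Finset.sum_le_sum fun σ _ => ?_
        rw [weight_eq_mul, ← mul_assoc, mul_comm (Real.exp (β * d))]
        refine mul_le_mul_of_nonneg_right (mul_le_mul_of_nonneg_left (Real.exp_le_exp.2 ?_)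
          (weight_pos _ _ σ).le) (hh.nonneg σ)
        nlinarith [neg_le_of_abs_le (hd σ)]
    _ = Real.exp (β * d) * ∑ σ ∈ D, weight β (fun _ _ => 1) σ * h σ := by rw [Finset.mul_sum]
    _ ≤ _ := mul_le_mul_of_nonneg_left h1 (Real.exp_pos _).le

theorem eventually_sum_levelWeight_le (q : ℕ) (hβ : 0 < β) {κ : ℝ} (hκ : 0 < κ) :
    ∀ᶠ N : ℕ in atTop, ∀ s ⊆ lattice N q, ∀ c : ℝ, (∀ n ∈ s, c ≤ freeEnergy β (freq N n)) →
      ∑ σ ∈ configs N s, weight β (fun _ _ => 1) σ ≤ Real.exp ((-(β * c) + 2 * κ) * N) := by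
  filter_upwards [eventually_levelWeight_bounds q hβ hκ, eventually_pow_le_exp 1 q hκ]
    with N hW hp s hs c hc
  rw [sum_weight_configs]
  calc ∑ n ∈ s, levelWeight β N n ≤ ∑ n ∈ s, Real.exp (-(β * N * c) + κ * N) := by
        refine Finset.sum_le_sum fun n hn => (hW n (hs hn)).2.trans (Real.exp_le_exp.2 ?_)
        have := mul_le_mul_of_nonneg_left (hc n hn) (by positivity : 0 ≤ β * N)
        linarith
    _ = s.card * Real.exp (-(β * N * c) + κ * N) := by rw [Finset.sum_const, nsmul_eq_mul]
    _ ≤ Real.exp (κ * N) * Real.exp (-(β * N * c) + κ * N) := by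
        gcongr
        refine le_trans ?_ hp
        rw [Nat.cast_one, one_mul]
        exact_mod_cast (Finset.card_le_card hs).trans (card_lattice_le N q)
    _ = _ := by rw [← Real.exp_add]; ring_nf

theorem exists_nat_half_pow_le (r : ℝ) : ∃ J : ℕ, ∀ N : ℕ,
    (1 / 2 : ℝ) ^ (J * N) ≤ Real.exp (-(r * N)) := by
  obtain ⟨J, hJ⟩ := exists_pow_lt_of_lt_one (Real.exp_pos (-r)) (by norm_num : (1 / 2 : ℝ) < 1)
  refine ⟨J, fun N => ?_⟩
  rw [pow_mul, show -(r * (N : ℝ)) = N * -r by ring, Real.exp_nat_mul]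
  exact pow_le_pow_left₀ (by positivity) hJ.le N

theorem eventually_exp_neg_le {c θ : ℝ} (hc : 0 < c) (hθ : 0 < θ) :
    ∀ᶠ N : ℕ in atTop, Real.exp (-(c * N)) ≤ θ := by
  have h : Tendsto (fun N : ℕ => Real.exp (-(c * N))) atTop (𝓝 0) :=
    Real.tendsto_exp_neg_atTop_nhds_zero.comp
      (tendsto_natCast_atTop_atTop.const_mul_atTop hc)
  filter_upwards [h.eventually (gt_mem_nhds hθ)] with N h using h.le

variable {IA IB : Set (Option (Fin q))} {E : ℝ} {Φ : (Fin q → ℝ) → ℝ}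
  {m : ℕ → Option (Fin q) → Fin q → ℝ} {A B : (N : ℕ) → Set (Config N q)}

/-- If the energy deviations are at most `δ N`, then the mass of the equilibrium potential is, up
to an error `θ M`, the mass of the starting valley `D`, whose unperturbed mass is `M`. -/
theorem Landscape.exists_eventually_mass (L : Landscape β q IA IB E Φ) (hq : 2 ≤ q) (hβ : 0 < β)
    (hm : ∀ N, 1 ≤ N → ∀ i, IsClosestLatticePoint N (minPoint β q i) (m N i))
    (hA : ∀ N, A N = ⋃ i ∈ IA, levelSet N (m N i))
    (hB : ∀ N, B N = ⋃ i ∈ IB, levelSet N (m N i)) :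
    ∃ δ > 0, ∃ R > 0, ∀ θ > 0, ∀ᶠ N : ℕ in atTop, ∃ D S : Finset (Config N q), ∃ M > 0,
      M = ∑ σ ∈ D, weight β (fun _ _ => 1) σ ∧
      ∑ σ ∈ S, weight β (fun _ _ => 1) σ ≤ (1 + θ) * M ∧
      ∑ σ : Config N q, weight β (fun _ _ => 1) σ ≤ Real.exp (R * N) * M ∧
      ∀ w : ℕ → ℕ → ℝ, (∀ σ : Config N q, |energyDev w σ| ≤ δ * N) →
        ∀ h, IsPotential (transProb β w) (A N) (B N) h →
          ∑ σ ∈ D, weight β w σ - θ * M ≤ ∑ σ, weight β w σ * h σ ∧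
          ∑ σ, weight β w σ * h σ ≤ ∑ σ ∈ S, weight β w σ + θ * M := by
  classical
  obtain ⟨e₀, he₀, hwall⟩ := L.exists_wall_gap
  obtain ⟨ε, hε, hjoin⟩ := L.eventually_joined hq hm
  -- Energy budget: the wall stands at `E + 4e`, valleys are cut at `E + e`, paths climb by `e`, and
  -- deviations are at most `(e/4) N`. The subexponential error rate is `κ = βe/20`.
  set e := min (e₀ / 4) ε with he_def
  have he : 0 < e := lt_min (by positivity) hε
  have he1 : 4 * e ≤ e₀ := by linarith [min_le_left (e₀ / 4) ε]
  have he2 : e ≤ ε := min_le_right _ _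
  set κ := β * e / 20 with hκ_def
  have hκ : 0 < κ := by positivity
  obtain ⟨x₀, hx₀, hmin⟩ := exists_isMinOn_freeEnergy (q := q) β hq
  set R := β * (E - freeEnergy β x₀) + 4 * κ with hR_def
  obtain ⟨iA, hiA⟩ := L.nonemptyA
  have hE0 : freeEnergy β x₀ ≤ E := by
    rw [← L.level iA hiA]
    exact hmin (L.mem iA)
  have hR : 0 < R := by
    have := mul_nonneg hβ.le (sub_nonneg.2 hE0)
    linarith
  -- With `J₀ N` dyadic layers the remainder beats the ratio `e^{RN}` of the partition function to
  -- `M` and one factor `e^{βδN}`.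
  obtain ⟨J₀, hJ₀⟩ := exists_nat_half_pow_le (β * (e / 4) + R + 1)
  refine ⟨e / 4, by positivity, R, hR, fun θ hθ => ?_⟩
  obtain ⟨a, ha⟩ := exists_nat_ge (4 * J₀ / θ)
  have hFA : ∀ᶠ N : ℕ in atTop, freeEnergy β (m N iA) < E + e / 20 := by
    refine (((continuous_freeEnergy β q).tendsto _).comp
      (tendsto_closest hq hm iA (L.mem iA))).eventually (gt_mem_nhds ?_)
    rw [L.level iA hiA]
    linarith
  filter_upwards [hwall (4 * e) he1, hjoin e he, L.eventually_sign hq hm, hFA,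
    eventually_gt_atTop 0, eventually_levelWeight_bounds q hβ hκ,
    eventually_sum_levelWeight_le q hβ hκ, eventually_poincare q hβ (η := e) hκ,
    eventually_exp_neg_le one_pos (half_pos hθ),
    eventually_exp_neg_le (c := 16 * κ) (by positivity) hθ,
    eventually_pow_le_exp a 1 (κ := 40 * κ) (by positivity)]
    with N hwall hjoin hsign hFA hN hW hsum hpoin hθ1 hθ2 hpow
  have hNr : (0 : ℝ) < N := by exact_mod_cast hN
  set low := sublevel β N q (E + e) with hlow
  -- Low lattice points are split by their side of the wall: `s₁` is the starting side, `s₂` the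
  -- target side, and `s₃` collects the high points, of negligible weight.
  set s₁ := low.filter fun n => 0 < Φ (freq N n) with hs₁
  set s₂ := low.filter fun n => ¬ 0 < Φ (freq N n) with hs₂
  set s₃ := lattice N q \ low with hs₃
  have hlowL : low ⊆ lattice N q := Finset.filter_subset _ _
  have hs₁L : s₁ ⊆ lattice N q := (Finset.filter_subset _ _).trans hlowL
  have hs₂L : s₂ ⊆ lattice N q := (Finset.filter_subset _ _).trans hlowL
  have hs₃L : s₃ ⊆ lattice N q := Finset.sdiff_subset
  have hsplit : ∀ g : Config N q → ℝ, ∑ σ, g σ =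
      ∑ σ ∈ configs N s₁, g σ + ∑ σ ∈ configs N s₂, g σ + ∑ σ ∈ configs N s₃, g σ := by
    intro g
    have h0 : ∑ σ, g σ = ∑ σ ∈ configs N (lattice N q), g σ :=
      (Finset.sum_congr (Finset.filter_true_of_mem fun σ _ => count_mem_lattice σ)
        fun _ _ => rfl).symm
    rw [h0]
    simp only [sum_configs]
    rw [← Finset.sum_sdiff hlowL, ← Finset.sum_filter_add_sum_filter_not low
      (fun n => 0 < Φ (freq N n))]
    ring
  set M := ∑ σ ∈ configs N s₁, weight β (fun _ _ => 1) σ with hM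
  have hm0 : ∀ σ : Config N q, 0 < weight β (fun _ _ => 1) σ := weight_pos β _
  have hMlow : Real.exp ((-(β * E) - 2 * κ) * N) ≤ M := by
    obtain ⟨t, ht, hti⟩ := exists_freq_eq hN (hm N hN iA)
    have hts : t ∈ s₁ := by
      rw [hs₁, Finset.mem_filter, hlow, mem_sublevel, hti]
      exact ⟨⟨ht, by linarith⟩, hsign.1 iA hiA⟩
    rw [hM, sum_weight_configs]
    refine le_trans ?_ (Finset.single_le_sum
      (fun n hn => (levelWeight_pos β (mem_lattice.1 (hs₁L hn))).le) hts)
    refine le_trans (Real.exp_le_exp.2 ?_) (hW t ht).1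
    rw [hti]
    have := mul_le_mul_of_nonneg_left hFA.le (by positivity : 0 ≤ β * N)
    have h2 : κ * N = β * N * (e / 20) := by rw [hκ_def]; ring
    nlinarith
  have hMpos : 0 < M := (Real.exp_pos _).trans_le hMlow
  have hhigh : ∑ σ ∈ configs N s₃, weight β (fun _ _ => 1) σ ≤ θ * M := by
    have h1 := hsum s₃ hs₃L (E + e) fun n hn => by
      rw [hs₃, Finset.mem_sdiff, hlow, mem_sublevel] at hn
      exact (not_le.1 fun h => hn.2 ⟨hn.1, h⟩).le
    calc _ ≤ Real.exp ((-(β * (E + e)) + 2 * κ) * N) := h1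
      _ = Real.exp (-(16 * κ * N)) * Real.exp ((-(β * E) - 2 * κ) * N) := by
        rw [← Real.exp_add]; congr 1; rw [hκ_def]; ring
      _ ≤ θ * M := mul_le_mul hθ2 hMlow (Real.exp_pos _).le hθ.le
  have hZ : ∑ σ : Config N q, weight β (fun _ _ => 1) σ ≤ Real.exp (R * N) * M := by
    have h1 := hsum (lattice N q) subset_rfl (freeEnergy β x₀) fun n hn =>
      hmin (freq_mem_stdSimplex hN hn)
    have h0 : ∑ σ : Config N q, weight β (fun _ _ => 1) σ =
        ∑ σ ∈ configs N (lattice N q), weight β (fun _ _ => 1) σ :=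
      (Finset.sum_congr (Finset.filter_true_of_mem fun σ _ => count_mem_lattice σ)
        fun _ _ => rfl).symm
    rw [h0]
    calc _ ≤ Real.exp ((-(β * freeEnergy β x₀) + 2 * κ) * N) := h1
      _ = Real.exp (R * N) * Real.exp ((-(β * E) - 2 * κ) * N) := by
        rw [← Real.exp_add]; congr 1; rw [hR_def]; ring
      _ ≤ _ := mul_le_mul_of_nonneg_left hMlow (Real.exp_pos _).le
  set V : Set (Config N q) := {σ | 0 < Φ (freq N (count σ))} with hV
  set g : Config N q → ℝ := V.indicator fun _ => 1 with hg_def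
  have hemp : ∀ i, ∀ σ : Config N q, σ ∈ levelSet N (m N i) → freq N (count σ) = m N i := by
    intro i σ hσ
    obtain ⟨t, ht, hti⟩ := exists_freq_eq hN (hm N hN i)
    rw [← hti] at hσ ⊢
    rw [(mem_levelSet_freq hN).1 hσ]
  have hgA : ∀ σ ∈ A N, g σ = 1 := by
    intro σ hσ
    rw [hA] at hσ
    simp only [Set.mem_iUnion] at hσ
    obtain ⟨i, hi, hσ⟩ := hσ
    refine Set.indicator_of_mem ?_ _
    change 0 < Φ (freq N (count σ))
    rw [hemp i σ hσ]
    exact hsign.1 i hi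
  have hgB : ∀ σ ∈ B N, g σ = 0 := by
    intro σ hσ
    rw [hB] at hσ
    simp only [Set.mem_iUnion] at hσ
    obtain ⟨i, hi, hσ⟩ := hσ
    refine Set.indicator_of_notMem ?_ _
    change ¬ 0 < Φ (freq N (count σ))
    rw [hemp i σ hσ]
    exact (hsign.2 i hi).not_gt
  set Q := Real.exp ((-(β * (E + 4 * e)) + 2 * κ) * N) with hQ
  have hgQ : dirichlet (cond β fun _ _ => 1) g g ≤ Q := by
    set s := (lattice N q).filter fun n => E + 4 * e ≤ freeEnergy β (freq N n) with hs
    refine (dirichlet_indicator_le hβ.le V (configs N s) fun σ η h1 h2 => ?_).trans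
      (hsum s (Finset.filter_subset _ _) _ fun n hn => (Finset.mem_filter.1 hn).2)
    rw [mem_configs, hs, Finset.mem_filter]
    exact ⟨count_mem_lattice σ, hwall _ (count_mem_lattice σ) _
      (step_count_of_hammingDist h1) h2⟩
  have hpath : ∀ n ∈ low, ∃ i ∈ IA ∪ IB, ∃ t ∈ lattice N q, freq N t = m N i ∧
      Joined (sublevel β N q (freeEnergy β (freq N n) + e)) n t ∧
      (0 < Φ (freq N n) ↔ 0 < Φ (m N i)) := by
    intro n hn
    have hn' := mem_sublevel.1 hn
    obtain ⟨i, hi, t, ht, hti, hj⟩ := hjoin n (sublevel_mono (by linarith) hn)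
    refine ⟨i, hi, t, ht, hti, hj, ?_⟩
    rw [← hti]
    -- The path stays below `E + 2e`, hence below the wall, and ends on the side where it started;
    -- this decides whether its endpoint belongs to `A` or to `B`.
    exact (hj.mono (sublevel_mono (c' := E + 2 * e) (by linarith))).sign_iff (by linarith) hwall
  have hpB : ∀ f : Config N q → ℝ, (∀ σ ∈ B N, f σ = 0) →
      ∑ σ ∈ configs N s₂, weight β (fun _ _ => 1) σ * f σ ^ 2 ≤
        Real.exp ((β * e + κ) * N) * dirichlet (cond β fun _ _ => 1) f f := by
    refine hpoin s₂ hs₂L (B N) fun n hn => ?_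
    rw [hs₂, Finset.mem_filter] at hn
    obtain ⟨i, hi, t, -, hti, hj, hs⟩ := hpath n hn.1
    refine ⟨t, hj, fun σ hσ => ?_⟩
    have hiB : i ∈ IB := hi.resolve_left fun h => hn.2 (hs.2 (hsign.1 i h))
    rw [hB]
    refine Set.mem_biUnion hiB ?_
    rw [← hti]
    exact (mem_levelSet_freq hN).2 (mem_level.1 hσ)
  have hpA : ∀ f : Config N q → ℝ, (∀ σ ∈ A N, f σ = 0) →
      ∑ σ ∈ configs N s₁, weight β (fun _ _ => 1) σ * f σ ^ 2 ≤
        Real.exp ((β * e + κ) * N) * dirichlet (cond β fun _ _ => 1) f f := by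
    refine hpoin s₁ hs₁L (A N) fun n hn => ?_
    rw [hs₁, Finset.mem_filter] at hn
    obtain ⟨i, hi, t, -, hti, hj, hs⟩ := hpath n hn.1
    refine ⟨t, hj, fun σ hσ => ?_⟩
    have hiA : i ∈ IA := hi.resolve_right fun h => (hsign.2 i h).not_gt (hs.1 hn.2)
    rw [hA]
    refine Set.mem_biUnion hiA ?_
    rw [← hti]
    exact (mem_levelSet_freq hN).2 (mem_level.1 hσ)
  have hnum : ∀ s : Finset (Config N q), Real.exp (β * (e / 4 * N)) * ((1 / 2) ^ (J₀ * N) *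
      ∑ σ ∈ s, weight β (fun _ _ => 1) σ + 2 * (J₀ * N : ℕ) * (Real.exp ((β * e + κ) * N) *
        Real.exp (β * (e / 4 * N)) * (Real.exp (β * (e / 4 * N)) * Q))) ≤ θ * M := by
    intro s
    have h1 : ∑ σ ∈ s, weight β (fun _ _ => 1) σ ≤ Real.exp (R * N) * M :=
      (Finset.sum_le_sum_of_subset_of_nonneg (Finset.subset_univ s)
        fun σ _ _ => (hm0 σ).le).trans hZ
    have h2 : Real.exp (β * (e / 4 * N)) * ((1 / 2) ^ (J₀ * N) *
        ∑ σ ∈ s, weight β (fun _ _ => 1) σ) ≤ θ / 2 * M := by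
      calc _ ≤ Real.exp (β * (e / 4 * N)) * (Real.exp (-((β * (e / 4) + R + 1) * N)) *
            (Real.exp (R * N) * M)) := by
            gcongr
            · exact Finset.sum_nonneg fun σ _ => (hm0 σ).le
            · exact hJ₀ N
        _ = Real.exp (-(1 * N)) * M := by
            rw [← mul_assoc, ← mul_assoc, ← Real.exp_add, ← Real.exp_add]
            congr 2
            ring
        _ ≤ _ := mul_le_mul_of_nonneg_right hθ1 hMpos.le
    have h3 : Real.exp (β * (e / 4 * N)) * (2 * (J₀ * N : ℕ) * (Real.exp ((β * e + κ) * N) *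
        Real.exp (β * (e / 4 * N)) * (Real.exp (β * (e / 4 * N)) * Q))) ≤ θ / 2 * M := by
      have h4 : 2 * (J₀ * N : ℕ) ≤ θ / 2 * Real.exp (40 * κ * N) := by
        rw [div_le_iff₀ hθ] at ha
        have h5 : (a : ℝ) * N ≤ Real.exp (40 * κ * N) := by
          refine le_trans ?_ hpow
          rw [pow_one]
          gcongr
          linarith
        push_cast
        calc 2 * ((J₀ : ℝ) * N) = (4 * J₀) / 2 * N := by ring
          _ ≤ (a * θ) / 2 * N := by gcongr
          _ = θ / 2 * (a * N) := by ring
          _ ≤ _ := by gcongr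
      calc _ ≤ Real.exp (β * (e / 4 * N)) * (θ / 2 * Real.exp (40 * κ * N) *
            (Real.exp ((β * e + κ) * N) *
            Real.exp (β * (e / 4 * N)) * (Real.exp (β * (e / 4 * N)) * Q))) := by gcongr
        _ = θ / 2 * (Real.exp (β * (e / 4 * N)) * Real.exp (40 * κ * N) *
            Real.exp ((β * e + κ) * N) * Real.exp (β * (e / 4 * N)) *
            Real.exp (β * (e / 4 * N)) * Q) := by ring
        _ = θ / 2 * Real.exp ((-(β * E) - 2 * κ) * N) := by
            rw [hQ]
            simp only [← Real.exp_add]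
            -- Since `βe = 20κ`, the exponents beyond `-βE` add up to `15κ + 40κ + 21κ - 80κ + 2κ =
            -- -2κ`.
            congr 2
            rw [hκ_def]
            ring
        _ ≤ _ := by gcongr
    rw [mul_add]
    linarith
  refine ⟨configs N s₁, configs N s₁ ∪ configs N s₃, M, hMpos, rfl, ?_, hZ, fun w hw h hh => ?_⟩
  · have h1 := Finset.sum_union_inter (s₁ := configs N s₁) (s₂ := configs N s₃)
      (f := weight β fun _ _ => 1)
    have h2 : 0 ≤ ∑ σ ∈ configs N s₁ ∩ configs N s₃, weight β (fun _ _ => 1) σ :=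
      Finset.sum_nonneg fun σ _ => (hm0 σ).le
    rw [← hM] at h1
    linarith
  have hwpos : ∀ σ : Config N q, 0 < weight β w σ := weight_pos β w
  constructor
  -- The same estimate with `A` and `B` exchanged controls `1 - h` on the starting valley.
  · have h1 := (sum_weight_mul_potential_le hβ.le (hh.one_sub (reversible hβ.le w)) hw
      (Real.exp_pos _).le hpA (g := fun σ => 1 - g σ) (fun σ hσ => by simp [hgB σ hσ])
      (fun σ hσ => by simp [hgA σ hσ]) (by rw [dirichlet_one_sub, dirichlet_comm, dirichlet_one_sub, neg_neg]; exact hgQ) (J₀ * N)).trans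
      (hnum _)
    simp_rw [mul_sub, mul_one] at h1
    rw [Finset.sum_sub_distrib] at h1
    have h2 : ∑ σ ∈ configs N s₁, weight β w σ * h σ ≤ ∑ σ, weight β w σ * h σ :=
      Finset.sum_le_sum_of_subset_of_nonneg (Finset.subset_univ _)
        fun σ _ _ => mul_nonneg (hwpos σ).le (hh.nonneg σ)
    linarith
  · have h1 := (sum_weight_mul_potential_le hβ.le hh hw (Real.exp_pos _).le hpB hgA hgB hgQ
      (J₀ * N)).trans (hnum _)
    have hdisj : Disjoint (configs N s₁) (configs N s₃) := by
      rw [Finset.disjoint_left]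
      intro σ h1 h2
      rw [mem_configs] at h1 h2
      exact (Finset.mem_sdiff.1 h2).2 (Finset.filter_subset _ _ h1)
    rw [hsplit, Finset.sum_union hdisj]
    have h2 : ∀ s : Finset (Config N q), ∑ σ ∈ s, weight β w σ * h σ ≤ ∑ σ ∈ s, weight β w σ :=
      fun s => Finset.sum_le_sum fun σ _ => mul_le_of_le_one_right (hwpos σ).le (hh.le_one σ)
    linarith [h2 (configs N s₁), h2 (configs N s₃)]

end Concentration

/-! ### Moment norms -/

section MomentNorm

variable {Ω : Type*} [MeasurableSpace Ω] {P : Measure Ω}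

/-- The `L^p` norm of the positive part of a function. -/
def posNorm (P : Measure Ω) (p : ℝ) (f : Ω → ℝ) : ℝ≥0∞ :=
  (∫⁻ ω, ENNReal.ofReal (f ω) ^ p ∂P) ^ (1 / p)

theorem posNorm_mono {p : ℝ} (hp : 0 ≤ p) {f g : Ω → ℝ} (h : ∀ ω, f ω ≤ g ω) :
    posNorm P p f ≤ posNorm P p g := by
  unfold posNorm
  gcongr with ω
  exact h ω

theorem posNorm_const [IsProbabilityMeasure P] {p : ℝ} (hp : 0 < p) (c : ℝ) :
    posNorm P p (fun _ => c) = ENNReal.ofReal c := by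
  unfold posNorm
  rw [lintegral_const, measure_univ, mul_one, ← ENNReal.rpow_mul, mul_one_div_cancel hp.ne',
    ENNReal.rpow_one]

theorem posNorm_const_mul {p : ℝ} (hp : 0 < p) {c : ℝ} (hc : 0 ≤ c) (f : Ω → ℝ) :
    posNorm P p (fun ω => c * f ω) = ENNReal.ofReal c * posNorm P p f := by
  unfold posNorm
  simp_rw [ENNReal.ofReal_mul hc, ENNReal.mul_rpow_of_nonneg _ _ hp.le]
  rw [lintegral_const_mul' _ _ (ENNReal.rpow_ne_top_of_nonneg hp.le ENNReal.ofReal_ne_top),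
    ENNReal.mul_rpow_of_nonneg _ _ (by positivity), ← ENNReal.rpow_mul,
    mul_one_div_cancel hp.ne', ENNReal.rpow_one]

theorem posNorm_add_le {p : ℝ} (hp : 1 ≤ p) {f g : Ω → ℝ} (hf : Measurable f)
    (hg : Measurable g) :
    posNorm P p (fun ω => f ω + g ω) ≤ posNorm P p f + posNorm P p g := by
  refine le_trans ?_ (ENNReal.lintegral_Lp_add_le (μ := P) hf.ennreal_ofReal.aemeasurable
    hg.ennreal_ofReal.aemeasurable hp)
  unfold posNorm
  gcongr with ω
  exact ENNReal.ofReal_add_le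

theorem posNorm_mul_le {p : ℝ} (hp : 0 < p) {f g : Ω → ℝ} (hf : Measurable f)
    (hg : Measurable g) (hf0 : ∀ ω, 0 ≤ f ω) :
    posNorm P p (fun ω => f ω * g ω) ≤ posNorm P (2 * p) f * posNorm P (2 * p) g := by
  refine le_trans (le_of_eq ?_) (ENNReal.lintegral_Lp_mul_le_Lq_mul_Lr hp (q := 2 * p)
    (r := 2 * p) (by linarith) (by field_simp; norm_num) P hf.ennreal_ofReal.aemeasurable
    hg.ennreal_ofReal.aemeasurable)
  unfold posNorm
  simp_rw [ENNReal.ofReal_mul (hf0 _)]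
  rfl

/-- Minkowski's inequality with nonnegative weights: a bound that is uniform over the terms survives
averaging, whatever the number of terms or their dependence. -/
theorem posNorm_sum_le {p : ℝ} (hp : 1 ≤ p) {ι : Type*} (s : Finset ι) (a : ι → ℝ)
    (ha : ∀ i ∈ s, 0 ≤ a i) (f : ι → Ω → ℝ) (hf : ∀ i ∈ s, Measurable (f i)) {C : ℝ≥0∞}
    (hC : ∀ i ∈ s, posNorm P p (f i) ≤ C) :
    posNorm P p (fun ω => ∑ i ∈ s, a i * f i ω) ≤ ENNReal.ofReal (∑ i ∈ s, a i) * C := by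
  classical
  have hp0 : 0 < p := by linarith
  induction s using Finset.induction_on with
  | empty =>
    unfold posNorm
    simp [hp0]
  | insert i s hi ih =>
    have ha' : ∀ j ∈ s, 0 ≤ a j := fun j hj => ha j (Finset.mem_insert_of_mem hj)
    have hf' : ∀ j ∈ s, Measurable (f j) := fun j hj => hf j (Finset.mem_insert_of_mem hj)
    have hai := ha i (Finset.mem_insert_self i s)
    have hfi := hf i (Finset.mem_insert_self i s)
    simp_rw [Finset.sum_insert hi]
    refine (posNorm_add_le hp (hfi.const_mul _)
      (Finset.measurable_sum _ fun j hj => (hf' j hj).const_mul _)).trans ?_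
    rw [ENNReal.ofReal_add hai (Finset.sum_nonneg ha'), add_mul, posNorm_const_mul hp0 hai]
    gcongr
    · exact hC i (Finset.mem_insert_self i s)
    · exact ih ha' hf' fun j hj => hC j (Finset.mem_insert_of_mem hj)

/-- A variable that is at least `c` outside of the event that a variable of mean at most `1 / 2`
exceeds `1` has moments at least of the order of `c`. -/
theorem half_le_posNorm [IsProbabilityMeasure P] {p : ℝ} (hp : 1 ≤ p) {f T : Ω → ℝ}
    (hT : Measurable T) (hmean : posNorm P 1 T ≤ 1 / 2) {c : ℝ} (hc : 0 ≤ c)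
    (h : ∀ ω, T ω < 1 → c ≤ f ω) : ENNReal.ofReal (c / 2) ≤ posNorm P p f := by
  have hp0 : 0 < p := by linarith
  set G : Set Ω := {ω | T ω < 1} with hG
  have hGm : MeasurableSet G := measurableSet_lt hT measurable_const
  have hcompl : P Gᶜ ≤ 1 / 2 := by
    unfold posNorm at hmean
    simp only [ENNReal.rpow_one, div_one] at hmean
    refine le_trans (le_trans (measure_mono fun ω hω => ?_)
      (meas_ge_le_lintegral_div hT.ennreal_ofReal.aemeasurable (ε := 1) one_ne_zero
        ENNReal.one_ne_top)) ?_
    · change (1 : ℝ≥0∞) ≤ ENNReal.ofReal (T ω)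
      rw [← ENNReal.ofReal_one]
      exact ENNReal.ofReal_le_ofReal (not_lt.1 hω)
    · simpa using hmean
  have hPG : 1 / 2 ≤ P G := by
    have h1 := prob_add_prob_compl (μ := P) hGm
    by_contra hcon
    have : P G + P Gᶜ < 1 / 2 + 1 / 2 :=
      ENNReal.add_lt_add_of_lt_of_le (measure_ne_top _ _) (not_le.1 hcon) hcompl
    rw [h1, ENNReal.add_halves] at this
    exact lt_irrefl _ this
  unfold posNorm
  have h2 : ENNReal.ofReal c ^ p * (1 / 2) ^ p ≤ ∫⁻ ω, ENNReal.ofReal (f ω) ^ p ∂P := by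
    calc ENNReal.ofReal c ^ p * (1 / 2) ^ p ≤ ENNReal.ofReal c ^ p * P G := by
          gcongr
          refine le_trans ?_ hPG
          calc (1 / 2 : ℝ≥0∞) ^ p ≤ (1 / 2) ^ (1 : ℝ) :=
                ENNReal.rpow_le_rpow_of_exponent_ge (by simp) hp
            _ = 1 / 2 := ENNReal.rpow_one _
      _ = ∫⁻ _ in G, ENNReal.ofReal c ^ p ∂P := by rw [setLIntegral_const]
      _ ≤ ∫⁻ ω in G, ENNReal.ofReal (f ω) ^ p ∂P := by
          refine setLIntegral_mono' hGm fun ω hω => ?_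
          gcongr
          exact h ω hω
      _ ≤ _ := setLIntegral_le_lintegral _ _
  rw [← ENNReal.mul_rpow_of_nonneg _ _ hp0.le] at h2
  have h3 := ENNReal.rpow_le_rpow h2 (by positivity : 0 ≤ 1 / p)
  rw [← ENNReal.rpow_mul, mul_one_div_cancel hp0.ne', ENNReal.rpow_one] at h3
  refine le_trans (le_of_eq ?_) h3
  rw [div_eq_mul_one_div, ENNReal.ofReal_mul hc, ENNReal.ofReal_div_of_pos two_pos]
  simp

end MomentNorm

/-! ### The energy deviation as a random variable -/

section Measurability

variable {Ω : Type*} [MeasurableSpace Ω] {P : Measure Ω} {J : ℕ → ℕ → Ω → ℝ} {v : ℝ}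

theorem measurable_energyDev (hJ : DisorderAssumption P J v) {N q : ℕ} (σ : Config N q) :
    Measurable fun ω => energyDev (fun i j => J i j ω) σ := by
  unfold energyDev hamiltonian
  refine ((Finset.measurable_sum _ fun i _ => Finset.measurable_sum _ fun j _ => ?_).const_mul
    _).sub measurable_const
  split_ifs with h
  · exact hJ.measurable _ _ h.1
  · exact measurable_const

theorem measurable_exp_energyDev (hJ : DisorderAssumption P J v) {N q : ℕ} (t : ℝ)
    (σ : Config N q) :
    Measurable fun ω => Real.exp (t * energyDev (fun i j => J i j ω) σ) :=
  ((measurable_energyDev hJ σ).const_mul t).exp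

/-- Indexing by ordered pairs writes the deviation as a centred sum over the monochromatic pairs, to
which independence can be applied. -/
theorem energyDev_eq {N q : ℕ} (w : ℕ → ℕ → ℝ) (σ : Config N q) :
    energyDev w σ = -(1 / (N : ℝ)) *
      ((∑ e ∈ Finset.univ.filter fun e : {e : Fin N × Fin N // e.1 < e.2} => σ e.1.1 = σ e.1.2,
        w e.1.1 e.1.2) -
      (Finset.univ.filter fun e : {e : Fin N × Fin N // e.1 < e.2} =>
        σ e.1.1 = σ e.1.2).card) := by
  have key : ∀ w : ℕ → ℕ → ℝ, (∑ i : Fin N, ∑ j : Fin N,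
      if i < j ∧ σ i = σ j then w i j else 0) =
      ∑ e ∈ Finset.univ.filter fun e : {e : Fin N × Fin N // e.1 < e.2} => σ e.1.1 = σ e.1.2,
        w e.1.1 e.1.2 := by
    intro w
    rw [← Fintype.sum_prod_type', Finset.sum_filter,
      ← Finset.sum_subtype (Finset.univ.filter fun e : Fin N × Fin N => e.1 < e.2) (by simp)
        (fun e : Fin N × Fin N => if σ e.1 = σ e.2 then w e.1 e.2 else 0), Finset.sum_filter]
    refine Finset.sum_congr rfl fun e _ => ?_
    by_cases h1 : e.1 < e.2 <;> simp [h1]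
  unfold energyDev hamiltonian
  rw [key, key fun _ _ => 1, Finset.sum_const, nsmul_eq_mul, mul_one]
  ring

end Measurability

/-! ### Uniform exponential moments of the energy deviation -/

section Disorder

open Filter Topology

variable {Ω : Type*} [MeasurableSpace Ω] {P : Measure Ω} [IsProbabilityMeasure P]
  {J : ℕ → ℕ → Ω → ℝ} {v : ℝ}

/-- The moment generating function is analytic at `0` with value and derivative equal to `1`; its
Taylor expansion with quadratic remainder is then combined with `1 + x ≤ e^x`. -/
theorem DisorderAssumption.mgf_le (hJ : DisorderAssumption P J v) :
    ∃ K : ℝ, ∃ s₀ > 0, ∀ s, |s| < s₀ → s ∈ integrableExpSet (J 0 1) P ∧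
      mgf (J 0 1) P s ≤ Real.exp (s + K * s ^ 2) := by
  obtain ⟨p, hp⟩ := analyticAt_mgf hJ.expMoment
  have h1 := hp.isBigO_sub_partialSum_pow 2
  obtain ⟨K, hK⟩ := h1.bound
  have h2 : ∀ᶠ s : ℝ in 𝓝 0, s ∈ integrableExpSet (J 0 1) P := by
    filter_upwards [isOpen_interior.mem_nhds hJ.expMoment] with s hs using interior_subset hs
  obtain ⟨s₀, hs₀, h3⟩ := Metric.eventually_nhds_iff.1 (hK.and h2)
  refine ⟨K, s₀, hs₀, fun s hs => ?_⟩
  obtain ⟨h4, h5⟩ := h3 (y := s) (by simpa using hs)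
  refine ⟨h5, ?_⟩
  have e0 : p 0 (fun _ => s) = 1 := by
    rw [hp.coeff_zero]
    simp
  have e1 : p 1 (fun _ => s) = s := by
    have hd := hp.deriv
    rw [deriv_mgf_zero hJ.expMoment, hJ.mean] at hd
    have hc : p.coeff 1 = 1 := hd.symm
    rw [FormalMultilinearSeries.apply_eq_pow_smul_coeff, hc]
    simp
  rw [FormalMultilinearSeries.partialSum, Finset.sum_range_succ, Finset.sum_range_one, e0, e1,
    zero_add, Real.norm_eq_abs, norm_pow, norm_norm, Real.norm_eq_abs, sq_abs] at h4
  have h6 := le_of_abs_le h4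
  have h7 := Real.add_one_le_exp (s + K * s ^ 2)
  linarith

/-- Each coupling enters with parameter `s = -t/N`. Centring cancels the linear terms, and at most
`N²` pairs contribute `K t²/N²` each. -/
theorem DisorderAssumption.exists_moment_bound (hJ : DisorderAssumption P J v) (q : ℕ) :
    ∃ K > 0, ∀ t : ℝ, ∀ᶠ N : ℕ in atTop, ∀ σ : Config N q,
      ∫⁻ ω, ENNReal.ofReal (Real.exp (t * energyDev (fun i j => J i j ω) σ)) ∂P ≤
        ENNReal.ofReal (Real.exp (K * t ^ 2)) := by
  obtain ⟨K, s₀, hs₀, hmgf⟩ := hJ.mgf_le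
  refine ⟨|K| + 1, by positivity, fun t => ?_⟩
  have hlim : ∀ᶠ N : ℕ in atTop, |t| / (N : ℝ) < s₀ :=
    (tendsto_const_div_atTop_nhds_zero_nat |t|).eventually (gt_mem_nhds hs₀)
  filter_upwards [hlim, eventually_gt_atTop 0] with N hNs hN σ
  have hNr : (0 : ℝ) < N := by exact_mod_cast hN
  set s : ℝ := -(t / N) with hs
  have hsabs : |s| < s₀ := by rwa [hs, abs_neg, abs_div, abs_of_pos hNr]
  obtain ⟨hint, hle⟩ := hmgf s hsabs
  set F := Finset.univ.filter fun e : {e : Fin N × Fin N // e.1 < e.2} => σ e.1.1 = σ e.1.2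
    with hF
  set X : {e : Fin N × Fin N // e.1 < e.2} → Ω → ℝ := fun e => J e.1.1 e.1.2 with hX
  have hXm : ∀ e, Measurable (X e) := fun e => hJ.measurable _ _ e.2
  have hXind : iIndepFun X P := by
    have hinj : Function.Injective fun e : {e : Fin N × Fin N // e.1 < e.2} =>
        (⟨((e.1.1 : ℕ), (e.1.2 : ℕ)), e.2⟩ : {e : ℕ × ℕ // e.1 < e.2}) := by
      intro a b hab
      simp only [Subtype.mk.injEq, Prod.mk.injEq, Fin.val_inj] at hab
      exact Subtype.ext (Prod.ext hab.1 hab.2)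
    exact hJ.indep.precomp hinj
  have hXi : ∀ e, IdentDistrib (X e) (J 0 1) P P := fun e => hJ.ident _ _ e.2
  have hXint : ∀ e, Integrable (fun ω => Real.exp (s * X e ω)) P := fun e =>
    ((hXi e).comp (measurable_const_mul s).exp).integrable_iff.2 hint
  have hexp : ∀ ω, Real.exp (t * energyDev (fun i j => J i j ω) σ) =
      Real.exp (-(s * F.card)) * Real.exp (s * (∑ e ∈ F, X e) ω) := by
    intro ω
    rw [energyDev_eq, ← Real.exp_add, Finset.sum_apply]
    congr 1
    simp only [hX, hs]
    ring
  simp_rw [hexp]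
  have hI : Integrable (fun ω => Real.exp (s * (∑ e ∈ F, X e) ω)) P :=
    hXind.integrable_exp_mul_sum hXm fun e _ => hXint e
  rw [← ofReal_integral_eq_lintegral_ofReal (hI.const_mul _)
    (Eventually.of_forall fun ω => by positivity), integral_const_mul]
  refine ENNReal.ofReal_le_ofReal ?_
  have h1 : ∫ ω, Real.exp (s * (∑ e ∈ F, X e) ω) ∂P ≤ Real.exp (s + K * s ^ 2) ^ F.card := by
    have h2 := hXind.mgf_sum hXm F (t := s)
    unfold mgf at h2
    rw [h2, ← Finset.prod_const]
    refine Finset.prod_le_prod (fun e _ => integral_nonneg fun ω => (Real.exp_pos _).le)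
      fun e _ => ?_
    exact (mgf_congr_of_identDistrib (X e) (J 0 1) (hXi e) s).le.trans hle
  have hcard : (F.card : ℝ) ≤ (N : ℝ) ^ 2 := by
    have : F.card ≤ N * N := by
      refine (Finset.card_le_univ F).trans ((Fintype.card_subtype_le _).trans ?_)
      simp
    rw [sq]
    exact_mod_cast this
  calc Real.exp (-(s * F.card)) * ∫ ω, Real.exp (s * (∑ e ∈ F, X e) ω) ∂P
      ≤ Real.exp (-(s * F.card)) * Real.exp (s + K * s ^ 2) ^ F.card := by gcongr
    _ = Real.exp (F.card * (K * s ^ 2)) := by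
        rw [← Real.exp_nat_mul, ← Real.exp_add]
        congr 1
        ring
    _ ≤ Real.exp ((|K| + 1) * t ^ 2) := by
        refine Real.exp_le_exp.2 ?_
        have hs2 : (N : ℝ) ^ 2 * s ^ 2 = t ^ 2 := by rw [hs]; field_simp
        calc (F.card : ℝ) * (K * s ^ 2) ≤ F.card * ((|K| + 1) * s ^ 2) := by
              gcongr
              linarith [le_abs_self K]
          _ ≤ (N : ℝ) ^ 2 * ((|K| + 1) * s ^ 2) := by gcongr
          _ = (|K| + 1) * ((N : ℝ) ^ 2 * s ^ 2) := by ring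
          _ = _ := by rw [hs2]

theorem DisorderAssumption.exists_posNorm_bound (hJ : DisorderAssumption P J v) (q : ℕ) :
    ∃ K > 0, ∀ p > 0, ∀ t : ℝ, ∀ᶠ N : ℕ in atTop, ∀ σ : Config N q,
      posNorm P p (fun ω => Real.exp (t * energyDev (fun i j => J i j ω) σ)) ≤
        ENNReal.ofReal (Real.exp (K * p * t ^ 2)) := by
  obtain ⟨K, hK, h⟩ := hJ.exists_moment_bound q
  refine ⟨K, hK, fun p hp t => ?_⟩
  filter_upwards [h (p * t)] with N hN σ
  unfold posNorm
  have e1 : ∀ ω, ENNReal.ofReal (Real.exp (t * energyDev (fun i j => J i j ω) σ)) ^ p =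
      ENNReal.ofReal (Real.exp (p * t * energyDev (fun i j => J i j ω) σ)) := by
    intro ω
    rw [ENNReal.ofReal_rpow_of_pos (Real.exp_pos _), ← Real.exp_mul]
    congr 2
    ring
  simp_rw [e1]
  refine (ENNReal.rpow_le_rpow (hN σ) (by positivity)).trans (le_of_eq ?_)
  rw [ENNReal.ofReal_rpow_of_pos (Real.exp_pos _), ← Real.exp_mul]
  congr 2
  field_simp

end Disorder

/-! ### The edge energies of a potential as a probability distribution -/

section EdgeWeight

variable {S : Type} [Fintype S]

/-- The normalized energy of a function on an edge. -/
def edgeWeight (c : S → S → ℝ) (h : S → ℝ) (x : S × S) : ℝ :=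
  1 / 2 * (c x.1 x.2 * ((h x.1 - h x.2) * (h x.1 - h x.2))) / dirichlet c h h

theorem edgeWeight_nonneg {c : S → S → ℝ} (hc : ∀ σ η, 0 ≤ c σ η) (h : S → ℝ) (x : S × S) :
    0 ≤ edgeWeight c h x :=
  div_nonneg (mul_nonneg (by norm_num) (mul_nonneg (hc _ _) (mul_self_nonneg _)))
    (dirichlet_nonneg c hc h)

theorem dirichlet_mul_eq {c : S → S → ℝ} {h : S → ℝ} (hd : dirichlet c h h ≠ 0)
    (K : S → S → ℝ) :
    dirichlet (fun σ η => c σ η * K σ η) h h =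
      dirichlet c h h * ∑ x : S × S, edgeWeight c h x * K x.1 x.2 := by
  rw [Finset.mul_sum, Fintype.sum_prod_type, dirichlet, Finset.mul_sum]
  refine Finset.sum_congr rfl fun σ _ => ?_
  rw [Finset.mul_sum]
  refine Finset.sum_congr rfl fun η _ => ?_
  unfold edgeWeight
  field_simp

/-- For the CWP potential these weights are deterministic, so error factors averaged with them
inherit the moment bound of a single configuration. -/
theorem sum_edgeWeight {c : S → S → ℝ} {h : S → ℝ} (hd : dirichlet c h h ≠ 0) :
    ∑ x : S × S, edgeWeight c h x = 1 := by
  have h1 := dirichlet_mul_eq hd fun _ _ => 1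
  simp only [mul_one] at h1
  exact mul_left_cancel₀ hd (by rw [mul_one]; exact h1.symm)

end EdgeWeight

/-! ### Two-sided comparison of capacities -/

section Capacity

variable {N q : ℕ} {β : ℝ} {w : ℕ → ℕ → ℝ} {A B : Set (Config N q)} {h h' : Config N q → ℝ}

/-- The Thomson-type inequality is applied with the CWP potential in the weighted energy, so the
averaging weights do not depend on the disorder; one factor of the CWP capacity cancels. -/
theorem dirichlet_one_le_mul_sum (hβ : 0 ≤ β) (hh : IsPotential (transProb β w) A B h)
    (hh' : IsPotential (transProb β fun _ _ => 1) A B h')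
    (hd : 0 < dirichlet (cond β fun _ _ => 1) h' h') :
    dirichlet (cond β fun _ _ => 1) h' h' ≤ dirichlet (cond β w) h h *
      ∑ x, edgeWeight (cond β fun _ _ => 1) h' x *
        (Real.exp (β * energyDev w x.1) + Real.exp (β * energyDev w x.2)) := by
  have h1 := hh'.sq_dirichlet_le (reversible hβ fun _ _ => 1) (reversible hβ w) hh
    (fun σ η => Real.exp (β * energyDev w σ) + Real.exp (β * energyDev w η))
    (fun σ η => by positivity) (fun σ η hne => cond_one_le_add hβ w hne)
  have h2 := dirichlet_mul_eq hd.ne'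
    (fun σ η => Real.exp (β * energyDev w σ) + Real.exp (β * energyDev w η))
  rw [h2, sq, mul_assoc] at h1
  rw [mul_comm (dirichlet (cond β w) h h)]
  exact le_of_mul_le_mul_left h1 hd

/-- Dirichlet principle for the random model with the CWP potential as test function. -/
theorem dirichlet_le_one_mul_sum (hβ : 0 ≤ β) (hh : IsPotential (transProb β w) A B h)
    (hh' : IsPotential (transProb β fun _ _ => 1) A B h')
    (hd : 0 < dirichlet (cond β fun _ _ => 1) h' h') :
    dirichlet (cond β w) h h ≤ dirichlet (cond β fun _ _ => 1) h' h' *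
      ∑ x, edgeWeight (cond β fun _ _ => 1) h' x *
        (Real.exp (-β * energyDev w x.1) + Real.exp (-β * energyDev w x.2)) := by
  have h1 := hh.dirichlet_le (reversible hβ w) h' hh'.one hh'.zero
  have h2 := dirichlet_mul_eq hd.ne'
    (fun σ η => Real.exp (-β * energyDev w σ) + Real.exp (-β * energyDev w η))
  rw [← h2]
  refine h1.trans ((dirichlet_le_of_le (K := 1) (fun σ η hne => ?_) h').trans_eq (one_mul _))
  rw [one_mul, mul_comm]
  exact cond_le_one_add hβ w hne

end Capacity

/-! ### Large deviations of the energy -/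

section Deviations

variable {Ω : Type*} {J : ℕ → ℕ → Ω → ℝ} {N q : ℕ}

/-- The exponential of a multiple of the energy deviation, as a random variable. -/
def devExp (J : ℕ → ℕ → Ω → ℝ) (t : ℝ) (σ : Config N q) (ω : Ω) : ℝ :=
  Real.exp (t * energyDev (fun i j => J i j ω) σ)

theorem devExp_pos (J : ℕ → ℕ → Ω → ℝ) (t : ℝ) (σ : Config N q) (ω : Ω) : 0 < devExp J t σ ω :=
  Real.exp_pos _

/-- A random variable that exceeds `1` as soon as some energy deviation exceeds `δ N`. -/
def badSum (J : ℕ → ℕ → Ω → ℝ) (N q : ℕ) (l δ : ℝ) (ω : Ω) : ℝ :=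
  ∑ η : Config N q, Real.exp (-(l * δ * N)) * (devExp J l η ω + devExp J (-l) η ω)

theorem badSum_nonneg (J : ℕ → ℕ → Ω → ℝ) (N q : ℕ) (l δ : ℝ) (ω : Ω) :
    0 ≤ badSum J N q l δ ω :=
  Finset.sum_nonneg fun η _ => mul_nonneg (Real.exp_pos _).le
    (add_pos (devExp_pos J l η ω) (devExp_pos J (-l) η ω)).le

theorem one_le_badSum {l δ : ℝ} (hl : 0 ≤ l) {ω : Ω}
    (h : ¬ ∀ σ : Config N q, |energyDev (fun i j => J i j ω) σ| ≤ δ * N) :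
    1 ≤ badSum J N q l δ ω := by
  push Not at h
  obtain ⟨σ, hσ⟩ := h
  refine le_trans ?_ (Finset.single_le_sum (fun η _ => mul_nonneg (Real.exp_pos _).le
    (add_pos (devExp_pos J l η ω) (devExp_pos J (-l) η ω)).le) (Finset.mem_univ σ))
  have h1 := devExp_pos J l σ ω
  have h2 := devExp_pos J (-l) σ ω
  have h3 : Real.exp (l * δ * N) ≤ devExp J l σ ω + devExp J (-l) σ ω := by
    rcases lt_abs.1 hσ with h4 | h4
    · have : Real.exp (l * δ * N) ≤ devExp J l σ ω := by
        refine Real.exp_le_exp.2 ?_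
        rw [mul_assoc]
        exact mul_le_mul_of_nonneg_left h4.le hl
      linarith
    · have : Real.exp (l * δ * N) ≤ devExp J (-l) σ ω := by
        refine Real.exp_le_exp.2 ?_
        rw [mul_assoc, neg_mul, ← mul_neg]
        exact mul_le_mul_of_nonneg_left h4.le hl
      linarith
  calc (1 : ℝ) = Real.exp (-(l * δ * N)) * Real.exp (l * δ * N) := by
        rw [← Real.exp_add]; simp
    _ ≤ _ := mul_le_mul_of_nonneg_left h3 (Real.exp_pos _).le

/-- The rate `l` pays for the `q^N` configurations of a union bound and still leaves a gain
`e^{-RN}`. -/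
theorem pow_mul_exp_le {l δ R : ℝ} (hl : (q : ℝ) * Real.exp R ≤ Real.exp (l * δ)) :
    (q : ℝ) ^ N * Real.exp (-(l * δ * N)) ≤ Real.exp (-(R * N)) := by
  have h1 : ((q : ℝ) * Real.exp R) ^ N ≤ Real.exp (l * δ) ^ N :=
    pow_le_pow_left₀ (by positivity) hl N
  rw [mul_pow, ← Real.exp_nat_mul, ← Real.exp_nat_mul] at h1
  calc (q : ℝ) ^ N * Real.exp (-(l * δ * N))
      = (q : ℝ) ^ N * Real.exp (N * R) * Real.exp (-(l * δ * N) - N * R) := by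
        rw [mul_assoc ((q : ℝ) ^ N), ← Real.exp_add]; congr 2; ring
    _ ≤ Real.exp (N * (l * δ)) * Real.exp (-(l * δ * N) - N * R) := by gcongr
    _ = _ := by rw [← Real.exp_add]; ring_nf

end Deviations

/-! ### Upper and lower moment bounds -/

section Moments

variable {Ω : Type*} [MeasurableSpace Ω] {P : Measure Ω}
  {J : ℕ → ℕ → Ω → ℝ} {v : ℝ} {N q : ℕ} {β : ℝ} {A B : Set (Config N q)}

theorem measurable_devExp (hJ : DisorderAssumption P J v) (t : ℝ) (σ : Config N q) :
    Measurable (devExp J t σ) := measurable_exp_energyDev hJ t σ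

theorem posNorm_devExp_add_le (hJ : DisorderAssumption P J v) {p : ℝ} (hp : 1 ≤ p) {C : ℝ}
    (hC0 : 0 ≤ C) {s t : ℝ} {σ η : Config N q}
    (h1 : posNorm P p (devExp J s σ) ≤ ENNReal.ofReal C)
    (h2 : posNorm P p (devExp J t η) ≤ ENNReal.ofReal C) :
    posNorm P p (fun ω => devExp J s σ ω + devExp J t η ω) ≤ ENNReal.ofReal (2 * C) := by
  refine (posNorm_add_le hp (measurable_devExp hJ s σ) (measurable_devExp hJ t η)).trans ?_
  rw [two_mul, ENNReal.ofReal_add hC0 hC0]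
  exact add_le_add h1 h2

variable [IsProbabilityMeasure P]

/-- The mass is bounded by `M (X₁ + 1 + X₂)`, where `X₁` is the starting valley, `1` absorbs the
error `θ`, and `X₂` covers the exceptional event; the inverse capacity is at most `Y / C'`.
Cauchy-Schwarz separates the two factors at order `2k`, and once more at order `4k` for the product
inside `X₂`. -/
theorem moment_upper (hβ : 0 ≤ β) (hJ : DisorderAssumption P J v) {k : ℝ} (hk : 1 ≤ k)
    {l δ R θ C : ℝ} (hl0 : 0 ≤ l) (hl : (q : ℝ) * Real.exp R ≤ Real.exp (l * δ)) (hC1 : 1 ≤ C)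
    (hC2 : ∀ t ∈ ({β, -β} : Finset ℝ), ∀ σ : Config N q,
      posNorm P (2 * k) (devExp J t σ) ≤ ENNReal.ofReal C)
    (hC4 : ∀ t ∈ ({-β, l, -l} : Finset ℝ), ∀ σ : Config N q,
      posNorm P (2 * (2 * k)) (devExp J t σ) ≤ ENNReal.ofReal C)
    (hAB : Disjoint A B) (hA : A.Nonempty) (hB : B.Nonempty)
    {D S : Finset (Config N q)} {M : ℝ} (hM : 0 < M) (hθ : θ ≤ 1 / 2)
    (hD : M = ∑ σ ∈ D, weight β (fun _ _ => 1) σ)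
    (hS : ∑ σ ∈ S, weight β (fun _ _ => 1) σ ≤ (1 + θ) * M)
    (hZ : ∑ σ : Config N q, weight β (fun _ _ => 1) σ ≤ Real.exp (R * N) * M)
    (hmass : ∀ w : ℕ → ℕ → ℝ, (∀ σ : Config N q, |energyDev w σ| ≤ δ * N) →
        ∀ h, IsPotential (transProb β w) A B h →
          ∑ σ ∈ D, weight β w σ - θ * M ≤ ∑ σ, weight β w σ * h σ ∧
          ∑ σ, weight β w σ * h σ ≤ ∑ σ ∈ S, weight β w σ + θ * M) (hδ : 0 ≤ δ) :
    (∫⁻ ω, meanHit β hβ (fun i j => J i j ω) A B ^ k ∂P) ^ (1 / k) ≤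
      ENNReal.ofReal (20 * C ^ 3) * meanHit β hβ (fun _ _ => 1) A B := by
  have hk0 : 0 < k := by linarith
  have h2k : 1 ≤ 2 * k := by linarith
  have hC0 : 0 ≤ C := by linarith
  choose h hpot hdpos hmean using fun ω =>
    exists_meanHit_eq hβ (fun i j => J i j ω) hAB hA hB
  obtain ⟨h', hpot', hd', hmean'⟩ := exists_meanHit_eq hβ (fun _ _ => 1) hAB hA hB
  simp_rw [hmean, hmean']
  set C' := dirichlet (cond β fun _ _ => 1) h' h' with hC'
  set mw : Config N q → ℝ := weight β fun _ _ => 1 with hmw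
  have hm0 : ∀ σ, 0 < mw σ := weight_pos β _
  set Y : Ω → ℝ := fun ω => ∑ x, edgeWeight (cond β fun _ _ => 1) h' x *
    (devExp J β x.1 ω + devExp J β x.2 ω) with hY
  set X₁ : Ω → ℝ := fun ω => ∑ σ ∈ S, mw σ / M * devExp J (-β) σ ω with hX₁
  set X₂ : Ω → ℝ := fun ω => ∑ x : Config N q × Config N q,
    Real.exp (-(l * δ * N)) * (mw x.2 / M) *
      ((devExp J l x.1 ω + devExp J (-l) x.1 ω) * devExp J (-β) x.2 ω) with hX₂
  have hweight : ∀ ω (σ : Config N q), weight β (fun i j => J i j ω) σ =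
      M * (mw σ / M * devExp J (-β) σ ω) := by
    intro ω σ
    rw [weight_eq_mul, devExp, hmw]
    field_simp
  have hX₂eq : ∀ ω, X₂ ω =
      badSum J N q l δ ω * ∑ σ : Config N q, mw σ / M * devExp J (-β) σ ω := by
    intro ω
    rw [hX₂, badSum, Fintype.sum_mul_sum, ← Fintype.sum_prod_type']
    refine Finset.sum_congr rfl fun x _ => ?_
    ring
  have hterm : ∀ ω (σ : Config N q), 0 ≤ mw σ / M * devExp J (-β) σ ω := fun ω σ =>
    mul_nonneg (div_nonneg (hm0 σ).le hM.le) (devExp_pos J _ σ ω).le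
  have hX₁0 : ∀ ω, 0 ≤ X₁ ω := fun ω => Finset.sum_nonneg fun σ _ => hterm ω σ
  have hX₂0 : ∀ ω, 0 ≤ X₂ ω := fun ω => by
    rw [hX₂eq]
    exact mul_nonneg (badSum_nonneg J N q l δ ω) (Finset.sum_nonneg fun σ _ => hterm ω σ)
  have hX : ∀ ω, ∑ σ, weight β (fun i j => J i j ω) σ * h ω σ ≤ M * (X₁ ω + (1 + X₂ ω)) := by
    intro ω
    by_cases hgood : ∀ σ : Config N q, |energyDev (fun i j => J i j ω) σ| ≤ δ * N
    · refine ((hmass _ hgood _ (hpot ω)).2).trans ?_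
      simp_rw [hweight ω]
      rw [← Finset.mul_sum]
      have := hX₂0 ω
      nlinarith
    -- On the exceptional event `h ≤ 1` bounds the mass by the whole partition function, and
    -- multiplication by a quantity at least `1` gives `X₂`.
    · have h1 := one_le_badSum hl0 hgood
      have h2 : ∑ σ, weight β (fun i j => J i j ω) σ * h ω σ ≤
          M * ∑ σ : Config N q, mw σ / M * devExp J (-β) σ ω := by
        rw [Finset.mul_sum]
        refine Finset.sum_le_sum fun σ _ => ?_
        rw [← hweight]
        exact mul_le_of_le_one_right (weight_pos _ _ _).le ((hpot ω).le_one σ)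
      refine h2.trans (mul_le_mul_of_nonneg_left ?_ hM.le)
      have h3 := le_mul_of_one_le_left (Finset.sum_nonneg fun σ (_ : σ ∈ Finset.univ) =>
        hterm ω σ) h1
      rw [← hX₂eq] at h3
      linarith [hX₁0 ω]
  have hYle : ∀ ω, 1 / dirichlet (cond β fun i j => J i j ω) (h ω) (h ω) ≤ Y ω / C' := by
    intro ω
    rw [div_le_div_iff₀ (hdpos ω) hd', one_mul, mul_comm]
    exact dirichlet_one_le_mul_sum hβ (hpot ω) hpot' hd'
  have hpt : ∀ ω, (∑ σ, weight β (fun i j => J i j ω) σ * h ω σ) /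
      dirichlet (cond β fun i j => J i j ω) (h ω) (h ω) ≤
      M / C' * ((X₁ ω + (1 + X₂ ω)) * Y ω) := by
    intro ω
    have h0 : 0 ≤ 1 / dirichlet (cond β fun i j => J i j ω) (h ω) (h ω) :=
      (one_div_pos.2 (hdpos ω)).le
    rw [div_eq_mul_one_div]
    calc _ ≤ M * (X₁ ω + (1 + X₂ ω)) * (Y ω / C') := by
          refine mul_le_mul (hX ω) (hYle ω) h0 ?_
          have := hX₁0 ω
          have := hX₂0 ω
          positivity
      _ = _ := by ring
  have hmS : ∑ σ ∈ S, mw σ / M ≤ 2 := by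
    rw [← Finset.sum_div, div_le_iff₀ hM]
    nlinarith
  have hY2 : posNorm P (2 * k) Y ≤ ENNReal.ofReal (2 * C) := by
    refine (posNorm_sum_le h2k Finset.univ _
      (fun x _ => edgeWeight_nonneg (cond_nonneg hβ _) h' x) _
      (fun x _ => (measurable_devExp hJ β x.1).add (measurable_devExp hJ β x.2))
      (C := ENNReal.ofReal (2 * C)) fun x _ => posNorm_devExp_add_le hJ h2k hC0
        (hC2 _ (by simp) _) (hC2 _ (by simp) _)).trans ?_
    rw [sum_edgeWeight hd'.ne']
    simp
  have hX12 : posNorm P (2 * k) X₁ ≤ ENNReal.ofReal (2 * C) := by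
    refine (posNorm_sum_le h2k S _ (fun σ _ => div_nonneg (hm0 σ).le hM.le) _
      (fun σ _ => measurable_devExp hJ (-β) σ) fun σ _ => hC2 _ (by simp) _).trans ?_
    rw [ENNReal.ofReal_mul two_pos.le]
    gcongr
  have hX22 : posNorm P (2 * k) X₂ ≤ ENNReal.ofReal (2 * C * C) := by
    refine (posNorm_sum_le h2k Finset.univ _ (fun x _ => mul_nonneg (Real.exp_pos _).le
      (div_nonneg (hm0 x.2).le hM.le)) _
      (fun x _ => ((measurable_devExp hJ l x.1).add (measurable_devExp hJ (-l) x.1)).mul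
        (measurable_devExp hJ (-β) x.2)) (C := ENNReal.ofReal (2 * C * C)) fun x _ => ?_).trans ?_
    · refine (posNorm_mul_le (by linarith)
        ((measurable_devExp hJ l x.1).add (measurable_devExp hJ (-l) x.1))
        (measurable_devExp hJ (-β) x.2)
        fun ω => (add_pos (devExp_pos J _ _ ω) (devExp_pos J _ _ ω)).le).trans ?_
      rw [ENNReal.ofReal_mul (by linarith)]
      exact mul_le_mul' (posNorm_devExp_add_le hJ (by linarith) hC0 (hC4 _ (by simp) _)
        (hC4 _ (by simp) _)) (hC4 _ (by simp) _)
    -- The weights in `X₂` sum to at most `q^N e^{-lδN} · Z/M ≤ e^{-RN} e^{RN} = 1`.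
    · refine mul_le_of_le_one_left (zero_le) ?_
      rw [← ENNReal.ofReal_one]
      refine ENNReal.ofReal_le_ofReal ?_
      rw [Fintype.sum_prod_type]
      dsimp only
      rw [Finset.sum_const, ← Finset.mul_sum, ← Finset.sum_div, nsmul_eq_mul, Finset.card_univ, Fintype.card_fun, Fintype.card_fin,
        Fintype.card_fin]
      push_cast
      have h1 : (∑ σ, mw σ) / M ≤ Real.exp (R * N) := by rwa [div_le_iff₀ hM]
      calc (q : ℝ) ^ N * (Real.exp (-(l * δ * N)) * ((∑ σ, mw σ) / M))
          ≤ (q : ℝ) ^ N * (Real.exp (-(l * δ * N)) * Real.exp (R * N)) := by gcongr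
        _ = (q : ℝ) ^ N * Real.exp (-(l * δ * N)) * Real.exp (R * N) := by ring
        _ ≤ Real.exp (-(R * N)) * Real.exp (R * N) := by
            gcongr
            exact pow_mul_exp_le hl
        _ = 1 := by rw [← Real.exp_add]; simp
  have hX₁m : Measurable X₁ :=
    Finset.measurable_sum _ fun σ _ => (measurable_devExp hJ (-β) σ).const_mul _
  have hX₂m : Measurable X₂ := Finset.measurable_sum _ fun x _ =>
    (((measurable_devExp hJ l x.1).add (measurable_devExp hJ (-l) x.1)).mul
      (measurable_devExp hJ (-β) x.2)).const_mul _
  have hYm : Measurable Y := Finset.measurable_sum _ fun x _ =>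
    ((measurable_devExp hJ β x.1).add (measurable_devExp hJ β x.2)).const_mul _
  have hXX : posNorm P (2 * k) (fun ω => X₁ ω + (1 + X₂ ω)) ≤ ENNReal.ofReal (5 * C ^ 2) := by
    refine (posNorm_add_le h2k hX₁m (hX₂m.const_add 1)).trans ?_
    refine (add_le_add hX12 ((posNorm_add_le h2k measurable_const hX₂m).trans
      (add_le_add (posNorm_const (by linarith) 1).le hX22))).trans ?_
    rw [← ENNReal.ofReal_add (by linarith) (by positivity),
      ← ENNReal.ofReal_add (by linarith) (by positivity)]
    refine ENNReal.ofReal_le_ofReal ?_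
    nlinarith
  -- The zero deviation satisfies the mass estimate, so the CWP mass is at least `(1 - θ) M ≥ M/2`.
  -- This factor `2` combines with `5 C²` and `2 C` to `20 C³`.
  have hlow : M / C' / 2 ≤ (∑ σ, mw σ * h' σ) / C' := by
    have h1 := (hmass (fun _ _ => 1) (fun σ => by simp [energyDev]; positivity) h' hpot').1
    rw [← hD] at h1
    rw [div_right_comm]
    refine div_le_div_of_nonneg_right ?_ hd'.le
    nlinarith
  calc (∫⁻ ω, ENNReal.ofReal ((∑ σ, weight β (fun i j => J i j ω) σ * h ω σ) /
        dirichlet (cond β fun i j => J i j ω) (h ω) (h ω)) ^ k ∂P) ^ (1 / k)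
      ≤ posNorm P k (fun ω => M / C' * ((X₁ ω + (1 + X₂ ω)) * Y ω)) := posNorm_mono hk0.le hpt
    _ = ENNReal.ofReal (M / C') * posNorm P k (fun ω => (X₁ ω + (1 + X₂ ω)) * Y ω) :=
        posNorm_const_mul hk0 (div_nonneg hM.le hd'.le) _
    _ ≤ ENNReal.ofReal (M / C') * (ENNReal.ofReal (5 * C ^ 2) * ENNReal.ofReal (2 * C)) := by
        gcongr
        refine (posNorm_mul_le hk0 (hX₁m.add (hX₂m.const_add 1)) hYm fun ω => ?_).trans
          (mul_le_mul' hXX hY2)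
        exact add_nonneg (hX₁0 ω) (add_nonneg zero_le_one (hX₂0 ω))
    _ = ENNReal.ofReal (20 * C ^ 3) * ENNReal.ofReal (M / C' / 2) := by
        have : 0 ≤ M / C' := div_nonneg hM.le hd'.le
        rw [← ENNReal.ofReal_mul (by positivity), ← ENNReal.ofReal_mul (by positivity),
          ← ENNReal.ofReal_mul (by positivity)]
        congr 1
        ring
    _ ≤ _ := by gcongr

/-- It suffices to bound the quotient below on an event of probability at least `1/2`. Where `T <
1`, no deviation is large, the capacity is at most `12 C` times the CWP one, and the mass is at
least `M/(12 C)`. -/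
theorem moment_lower (hβ : 0 ≤ β) (hJ : DisorderAssumption P J v) {k : ℝ} (hk : 1 ≤ k)
    {l δ θ C : ℝ} (hl0 : 0 ≤ l) (hC1 : 1 ≤ C)
    (hsmall : (q : ℝ) ^ N * Real.exp (-(l * δ * N)) ≤ 1 / (12 * C))
    (hC : ∀ t ∈ ({β, -β, l, -l} : Finset ℝ), ∀ σ : Config N q,
      posNorm P 1 (devExp J t σ) ≤ ENNReal.ofReal C)
    (hAB : Disjoint A B) (hA : A.Nonempty) (hB : B.Nonempty)
    {D S : Finset (Config N q)} {M : ℝ} (hM : 0 < M) (hθ : θ ≤ 1 / (12 * C))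
    (hD : M = ∑ σ ∈ D, weight β (fun _ _ => 1) σ)
    (hS : ∑ σ ∈ S, weight β (fun _ _ => 1) σ ≤ (1 + θ) * M)
    (hmass : ∀ w : ℕ → ℕ → ℝ, (∀ σ : Config N q, |energyDev w σ| ≤ δ * N) →
        ∀ h, IsPotential (transProb β w) A B h →
          ∑ σ ∈ D, weight β w σ - θ * M ≤ ∑ σ, weight β w σ * h σ ∧
          ∑ σ, weight β w σ * h σ ≤ ∑ σ ∈ S, weight β w σ + θ * M) (hδ : 0 ≤ δ) :
    ENNReal.ofReal (1 / (864 * C ^ 2)) * meanHit β hβ (fun _ _ => 1) A B ≤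
      (∫⁻ ω, meanHit β hβ (fun i j => J i j ω) A B ^ k ∂P) ^ (1 / k) := by
  have hC0 : 0 < C := by linarith
  choose h hpot hdpos hmean using fun ω =>
    exists_meanHit_eq hβ (fun i j => J i j ω) hAB hA hB
  obtain ⟨h', hpot', hd', hmean'⟩ := exists_meanHit_eq hβ (fun _ _ => 1) hAB hA hB
  simp_rw [hmean, hmean']
  set C' := dirichlet (cond β fun _ _ => 1) h' h' with hC'
  set mw : Config N q → ℝ := weight β fun _ _ => 1 with hmw
  have hm0 : ∀ σ, 0 < mw σ := weight_pos β _
  set Y : Ω → ℝ := fun ω => ∑ x, edgeWeight (cond β fun _ _ => 1) h' x *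
    (devExp J (-β) x.1 ω + devExp J (-β) x.2 ω) with hY
  set U : Ω → ℝ := fun ω => ∑ σ ∈ D, mw σ / M * devExp J β σ ω with hU
  -- The coefficients make each of the three terms have mean at most `1/6`.
  set T : Ω → ℝ := fun ω => 1 / (6 * C) * U ω + (1 / (12 * C) * Y ω + badSum J N q l δ ω)
    with hT
  have hUm : Measurable U :=
    Finset.measurable_sum _ fun σ _ => (measurable_devExp hJ β σ).const_mul _
  have hYm : Measurable Y := Finset.measurable_sum _ fun x _ =>
    ((measurable_devExp hJ (-β) x.1).add (measurable_devExp hJ (-β) x.2)).const_mul _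
  have hBm : Measurable (badSum J N q l δ) := Finset.measurable_sum _ fun x _ =>
    ((measurable_devExp hJ l x).add (measurable_devExp hJ (-l) x)).const_mul _
  have hU0 : ∀ ω, 0 ≤ U ω := fun ω => Finset.sum_nonneg fun σ _ =>
    mul_nonneg (div_nonneg (hm0 σ).le hM.le) (devExp_pos J _ σ ω).le
  have hY0 : ∀ ω, 0 ≤ Y ω := fun ω => Finset.sum_nonneg fun x _ =>
    mul_nonneg (edgeWeight_nonneg (cond_nonneg hβ _) h' x)
      (add_pos (devExp_pos J _ _ ω) (devExp_pos J _ _ ω)).le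
  have hU1 : posNorm P 1 U ≤ ENNReal.ofReal C := by
    refine (posNorm_sum_le le_rfl D _ (fun σ _ => div_nonneg (hm0 σ).le hM.le) _
      (fun σ _ => measurable_devExp hJ β σ) fun σ _ => hC _ (by simp) _).trans ?_
    rw [← Finset.sum_div, ← hD, div_self hM.ne']
    simp
  have hY1 : posNorm P 1 Y ≤ ENNReal.ofReal (2 * C) := by
    refine (posNorm_sum_le le_rfl Finset.univ _
      (fun x _ => edgeWeight_nonneg (cond_nonneg hβ _) h' x) _
      (fun x _ => (measurable_devExp hJ (-β) x.1).add (measurable_devExp hJ (-β) x.2))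
      (C := ENNReal.ofReal (2 * C)) fun x _ => posNorm_devExp_add_le hJ le_rfl hC0.le
        (hC _ (by simp) _) (hC _ (by simp) _)).trans ?_
    rw [sum_edgeWeight hd'.ne']
    simp
  have hB1 : posNorm P 1 (badSum J N q l δ) ≤ ENNReal.ofReal (1 / 6) := by
    refine (posNorm_sum_le le_rfl Finset.univ _ (fun x _ => (Real.exp_pos _).le) _
      (fun x _ => (measurable_devExp hJ l x).add (measurable_devExp hJ (-l) x))
      (C := ENNReal.ofReal (2 * C)) fun x _ => posNorm_devExp_add_le hJ le_rfl hC0.le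
        (hC _ (by simp) _) (hC _ (by simp) _)).trans ?_
    rw [← ENNReal.ofReal_mul (Finset.sum_nonneg fun x _ => (Real.exp_pos _).le)]
    refine ENNReal.ofReal_le_ofReal ?_
    rw [Finset.sum_const, nsmul_eq_mul, Finset.card_univ, Fintype.card_fun, Fintype.card_fin,
      Fintype.card_fin]
    push_cast
    calc _ ≤ 1 / (12 * C) * (2 * C) := by gcongr
      _ = 1 / 6 := by field_simp; norm_num
  have hT1 : posNorm P 1 T ≤ 1 / 2 := by
    refine (posNorm_add_le le_rfl (hUm.const_mul _) ((hYm.const_mul _).add hBm)).trans ?_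
    refine (add_le_add le_rfl (posNorm_add_le le_rfl (hYm.const_mul _) hBm)).trans ?_
    rw [posNorm_const_mul one_pos (by positivity), posNorm_const_mul one_pos (by positivity)]
    calc _ ≤ ENNReal.ofReal (1 / (6 * C)) * ENNReal.ofReal C +
          (ENNReal.ofReal (1 / (12 * C)) * ENNReal.ofReal (2 * C) + ENNReal.ofReal (1 / 6)) := by
          gcongr
      _ = ENNReal.ofReal (1 / 2) := by
          rw [← ENNReal.ofReal_mul (by positivity), ← ENNReal.ofReal_mul (by positivity),
            ← ENNReal.ofReal_add (by positivity) (by positivity),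
            ← ENNReal.ofReal_add (by positivity) (by positivity)]
          congr 1
          field_simp
          norm_num
      _ = 1 / 2 := by
          rw [ENNReal.ofReal_div_of_pos two_pos]
          simp
  have hpt : ∀ ω, T ω < 1 → M / C' * (1 / (144 * C ^ 2)) ≤
      (∑ σ, weight β (fun i j => J i j ω) σ * h ω σ) /
        dirichlet (cond β fun i j => J i j ω) (h ω) (h ω) := by
    intro ω hω
    have hb0 := badSum_nonneg J N q l δ ω
    have hgood : ∀ σ : Config N q, |energyDev (fun i j => J i j ω) σ| ≤ δ * N := by
      by_contra hcon
      have h1 := one_le_badSum hl0 hcon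
      have h2 : 0 ≤ 1 / (6 * C) * U ω := mul_nonneg (by positivity) (hU0 ω)
      have h3 : 0 ≤ 1 / (12 * C) * Y ω := mul_nonneg (by positivity) (hY0 ω)
      simp only [hT] at hω
      linarith
    have hUle : U ω ≤ 6 * C := by
      have h3 : 0 ≤ 1 / (12 * C) * Y ω := mul_nonneg (by positivity) (hY0 ω)
      have h4 : 1 / (6 * C) * U ω ≤ 1 := by simp only [hT] at hω; linarith
      rwa [one_div_mul_eq_div, div_le_one (by positivity)] at h4
    have hYle : Y ω ≤ 12 * C := by
      have h2 : 0 ≤ 1 / (6 * C) * U ω := mul_nonneg (by positivity) (hU0 ω)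
      have h4 : 1 / (12 * C) * Y ω ≤ 1 := by simp only [hT] at hω; linarith
      rwa [one_div_mul_eq_div, div_le_one (by positivity)] at h4
    -- Cauchy-Schwarz: an upper bound on the average of `e^{βΔ}` over the valley forces a lower
    -- bound on its random mass.
    have hcs : M ^ 2 ≤ (∑ σ ∈ D, weight β (fun i j => J i j ω) σ) * (M * U ω) := by
      rw [hD, ← hD, hU, Finset.mul_sum]
      conv_lhs => rw [hD]
      refine Finset.sum_sq_le_sum_mul_sum_of_sq_le_mul D (fun σ _ => (weight_pos _ _ _).le)
        (fun σ _ => ?_) fun σ _ => ?_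
      · exact mul_nonneg hM.le (mul_nonneg (div_nonneg (hm0 σ).le hM.le)
          (devExp_pos J _ σ ω).le)
      · have e : Real.exp (-β * energyDev (fun i j => J i j ω) σ) *
            Real.exp (β * energyDev (fun i j => J i j ω) σ) = 1 := by
          rw [← Real.exp_add]; simp
        rw [weight_eq_mul, devExp, ← hmw]
        refine le_of_eq ?_
        calc mw σ ^ 2 = mw σ * mw σ * (Real.exp (-β * energyDev (fun i j => J i j ω) σ) *
              Real.exp (β * energyDev (fun i j => J i j ω) σ)) := by rw [e]; ring
          _ = _ := by field_simp
    have hDw : M / (6 * C) ≤ ∑ σ ∈ D, weight β (fun i j => J i j ω) σ := by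
      rw [div_le_iff₀ (by positivity)]
      refine le_of_mul_le_mul_left ?_ hM
      have h0 : 0 ≤ ∑ σ ∈ D, weight β (fun i j => J i j ω) σ :=
        Finset.sum_nonneg fun σ _ => (weight_pos _ _ _).le
      calc M * M = M ^ 2 := by ring
        _ ≤ _ := hcs
        _ ≤ (∑ σ ∈ D, weight β (fun i j => J i j ω) σ) * (M * (6 * C)) := by gcongr
        _ = _ := by ring
    have hXge : M / (12 * C) ≤ ∑ σ, weight β (fun i j => J i j ω) σ * h ω σ := by
      have h1 := (hmass _ hgood _ (hpot ω)).1
      have h2 : θ * M ≤ 1 / (12 * C) * M := mul_le_mul_of_nonneg_right hθ hM.le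
      have h3 : M / (6 * C) = M / (12 * C) + 1 / (12 * C) * M := by field_simp; norm_num
      linarith
    have hCle : dirichlet (cond β fun i j => J i j ω) (h ω) (h ω) ≤ C' * (12 * C) :=
      (dirichlet_le_one_mul_sum hβ (hpot ω) hpot' hd').trans
        (mul_le_mul_of_nonneg_left hYle hd'.le)
    calc M / C' * (1 / (144 * C ^ 2)) = M / (12 * C) / (C' * (12 * C)) := by
          field_simp; norm_num
      _ ≤ M / (12 * C) / dirichlet (cond β fun i j => J i j ω) (h ω) (h ω) :=
          div_le_div_of_nonneg_left (by positivity) (hdpos ω) hCle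
      _ ≤ _ := div_le_div_of_nonneg_right hXge (hdpos ω).le
  have hTm : Measurable T := (hUm.const_mul _).add ((hYm.const_mul _).add hBm)
  refine le_trans ?_ (half_le_posNorm hk hTm hT1 (mul_nonneg (div_nonneg hM.le hd'.le)
    (by positivity)) hpt)
  rw [← ENNReal.ofReal_mul (by positivity)]
  refine ENNReal.ofReal_le_ofReal ?_
  have h1 := (hmass (fun _ _ => 1) (fun σ => by simp [energyDev]; positivity) h' hpot').2
  have hθ1 : θ ≤ 1 := hθ.trans (by
    rw [div_le_one (by positivity)]
    linarith)
  -- The CWP mass is at most `(1 + 2θ) M`. With the `2` from `half_le_posNorm` this gives `864 = 144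
  -- · 2 · 3`.
  have h2 : ∑ σ, mw σ * h' σ ≤ 3 * M := by nlinarith
  calc 1 / (864 * C ^ 2) * ((∑ σ, mw σ * h' σ) / C')
      ≤ 1 / (864 * C ^ 2) * (3 * M / C') := by gcongr
    _ = M / C' * (1 / (144 * C ^ 2)) / 2 := by field_simp; norm_num

end Moments
end CWP
end

/-! ### Assembly and choice of constants -/

open MeasureTheory in
theorem theorem4 (q : ℕ) (hq : 2 ≤ q) (β : ℝ) (hβ₀ : 0 ≤ β) (hβ : CWP.beta1 q < β)
    {Ω : Type*} [MeasurableSpace Ω] (P : Measure Ω) [IsProbabilityMeasure P]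
    (J : ℕ → ℕ → Ω → ℝ) (v : ℝ) (hJ : CWP.DisorderAssumption P J v)
    (m : ℕ → Option (Fin q) → Fin q → ℝ)
    (hm : ∀ N, 1 ≤ N → ∀ i, CWP.IsClosestLatticePoint N (CWP.minPoint β q i) (m N i))
    (A B : (N : ℕ) → Set (CWP.Config N q)) (hAB : CWP.IsTransition β q m A B)
    (k : ℝ) (hk : 1 ≤ k) :
    ∃ c₇ > 0, ∃ c₈ > 0, ∃ N₀ : ℕ, ∀ N ≥ N₀,
      ENNReal.ofReal (Real.exp (-c₇)) ≤
          (∫⁻ ω, CWP.meanHit β hβ₀ (fun i j => J i j ω) (A N) (B N) ^ k ∂P) ^ (1 / k) /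
            CWP.meanHit β hβ₀ (fun _ _ => 1) (A N) (B N) ∧
      (∫⁻ ω, CWP.meanHit β hβ₀ (fun i j => J i j ω) (A N) (B N) ^ k ∂P) ^ (1 / k) /
            CWP.meanHit β hβ₀ (fun _ _ => 1) (A N) (B N) ≤
          ENNReal.ofReal (Real.exp (c₈ * k)) := by
  have hβ' : 0 < β := (CWP.beta1_nonneg q).trans_lt hβ
  obtain ⟨IA, IB, E, Φ, L, hA, hB⟩ := hAB.exists_landscape hq hβ
  obtain ⟨δ, hδ, R, hR, hmass⟩ := L.exists_eventually_mass hq hβ' hm hA hB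
  obtain ⟨K, hK, hbound⟩ := hJ.exists_posNorm_bound q
  have hq1 : (1 : ℝ) ≤ q := by exact_mod_cast (by omega : 1 ≤ q)
  -- This is the rate for which `q e^R = e^{lδ}`.
  set l := (R + Real.log q) / δ with hl_def
  have hlog : 0 ≤ Real.log q := Real.log_nonneg hq1
  have hl0 : 0 ≤ l := div_nonneg (by linarith) hδ.le
  have hl : (q : ℝ) * Real.exp R ≤ Real.exp (l * δ) := by
    rw [hl_def, div_mul_cancel₀ _ hδ.ne', Real.exp_add, Real.exp_log (by linarith), mul_comm]
  -- One constant for all moment orders up to `4k` and all four exponents in `I`; it depends on `k`,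
  -- and so do the final constants.
  set C := Real.exp (K * (4 * k) * (β ^ 2 + l ^ 2)) with hC_def
  have hC1 : 1 ≤ C := Real.one_le_exp (by positivity)
  have hC0 : 0 < C := Real.exp_pos _
  set I : Finset ℝ := {β, -β, l, -l} with hI
  have hbound' : ∀ p > 0, p ≤ 4 * k → ∀ᶠ N : ℕ in Filter.atTop, ∀ t ∈ I,
      ∀ σ : CWP.Config N q, CWP.posNorm P p (CWP.devExp J t σ) ≤ ENNReal.ofReal C := by
    intro p hp hpk
    refine (Filter.eventually_all_finset I).2 fun t ht => ?_
    filter_upwards [hbound p hp t] with N hN σ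
    refine (hN σ).trans (ENNReal.ofReal_le_ofReal (Real.exp_le_exp.2 ?_))
    have ht2 : t ^ 2 ≤ β ^ 2 + l ^ 2 := by
      simp only [hI, Finset.mem_insert, Finset.mem_singleton] at ht
      rcases ht with h | h | h | h <;> rw [h] <;> nlinarith [sq_nonneg β, sq_nonneg l]
    gcongr
  have hevent : ∀ᶠ N : ℕ in Filter.atTop,
      ENNReal.ofReal (1 / (864 * C ^ 2)) * CWP.meanHit β hβ₀ (fun _ _ => 1) (A N) (B N) ≤
        (∫⁻ ω, CWP.meanHit β hβ₀ (fun i j => J i j ω) (A N) (B N) ^ k ∂P) ^ (1 / k) ∧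
      (∫⁻ ω, CWP.meanHit β hβ₀ (fun i j => J i j ω) (A N) (B N) ^ k ∂P) ^ (1 / k) ≤
        ENNReal.ofReal (20 * C ^ 3) * CWP.meanHit β hβ₀ (fun _ _ => 1) (A N) (B N) ∧
      CWP.meanHit β hβ₀ (fun _ _ => 1) (A N) (B N) ≠ 0 ∧
      CWP.meanHit β hβ₀ (fun _ _ => 1) (A N) (B N) ≠ ⊤ := by
    filter_upwards [hmass (1 / (12 * C)) (by positivity),
      L.eventually_nonempty_disjoint hq hm hA hB, hbound' 1 one_pos (by linarith),
      hbound' (2 * k) (by linarith) (by linarith),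
      hbound' (2 * (2 * k)) (by linarith) (by linarith),
      CWP.eventually_exp_neg_le hR (θ := 1 / (12 * C)) (by positivity)]
      with N ⟨D, S, M, hM, hD, hS, hZ, hmass⟩ ⟨hdisj, hAne, hBne⟩ h1 h2 h4 hsmall
    have hθ : 1 / (12 * C) ≤ 1 / 2 := one_div_le_one_div_of_le (by norm_num) (by linarith)
    have hsub2 : ({β, -β} : Finset ℝ) ⊆ I := by
      intro t ht; simp only [hI, Finset.mem_insert, Finset.mem_singleton] at ht ⊢; tauto
    have hsub4 : ({-β, l, -l} : Finset ℝ) ⊆ I := by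
      intro t ht; simp only [hI, Finset.mem_insert, Finset.mem_singleton] at ht ⊢; tauto
    refine ⟨CWP.moment_lower hβ₀ hJ hk hl0 hC1 ((CWP.pow_mul_exp_le hl).trans hsmall) h1
      hdisj hAne hBne hM le_rfl hD hS hmass hδ.le, CWP.moment_upper hβ₀ hJ hk hl0 hl hC1
      (fun t ht => h2 t (hsub2 ht)) (fun t ht => h4 t (hsub4 ht)) hdisj hAne hBne hM
      hθ hD hS hZ hmass hδ.le, ?_, ?_⟩
    · obtain ⟨h, hpot, hd, hmean⟩ := CWP.exists_meanHit_eq hβ₀ (fun _ _ => 1) hdisj hAne hBne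
      rw [hmean]
      refine (ENNReal.ofReal_pos.2 (div_pos ?_ hd)).ne'
      have h5 := (hmass (fun _ _ => 1) (fun σ => by simp [CWP.energyDev]; positivity) h hpot).1
      rw [← hD] at h5
      nlinarith
    · obtain ⟨h, -, -, hmean⟩ := CWP.exists_meanHit_eq hβ₀ (fun _ _ => 1) hdisj hAne hBne
      rw [hmean]
      exact ENNReal.ofReal_ne_top
  obtain ⟨N₀, hN₀⟩ := Filter.eventually_atTop.1 hevent
  have hlow : 1 < 864 * C ^ 2 := by nlinarith
  have hup : 1 < 20 * C ^ 3 := by nlinarith [one_le_pow₀ hC1 (n := 3)]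
  refine ⟨Real.log (864 * C ^ 2), Real.log_pos hlow, Real.log (20 * C ^ 3), Real.log_pos hup,
    N₀, fun N hN => ?_⟩
  obtain ⟨h1, h2, h3, h4⟩ := hN₀ N hN
  constructor
  · rw [ENNReal.le_div_iff_mul_le (Or.inl h3) (Or.inl h4), Real.exp_neg,
      Real.exp_log (by linarith), ← one_div]
    exact h1
  -- Here `k ≥ 1` turns `c₈` into `c₈ k`, the logarithm being positive.
  · refine ENNReal.div_le_of_le_mul (h2.trans (mul_le_mul_left (ENNReal.ofReal_le_ofReal ?_) _))
    calc 20 * C ^ 3 = Real.exp (Real.log (20 * C ^ 3)) := (Real.exp_log (by linarith)).symm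
      _ ≤ _ := Real.exp_le_exp.2 (le_mul_of_one_le_right (Real.log_pos hup).le hk)
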